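/- Definitions. Let $\kappa$ be an infinite cardinal. $H(\theta)$ is the collection of sets whose transitive closure has size less than $\theta$. $\mathsf{ZFC}^-$ is $\mathsf{ZFC}$ without the power set axiom, with the collection scheme and with choice in the form that every set can be well-ordered. A \emph{weak $\kappa$-model} is a (not necessarily transitive) set $M$ of size $\kappa$ with $\kappa+1\subseteq M$ and $\langle M,\in\rangle\models\mathsf{ZFC}^-$; it is a \emph{$\kappa$-model} if moreover $M^{<\kappa}\subseteq M$. An elementary embedding $j\colon M\to N$ into a transitive set $N$ is \emph{$\kappa$-powerset preserving} if it has critical point $\kappa$ and $M$ and $N$ have the same subsets of $\kappa$. For regular $\alpha\le\kappa$, $\kappa$ is \emph{$\alpha$-Ramsey} if for arbitrarily large regular cardinals $\theta$, every $A\subseteq\kappa$ is an element of some weak $\kappa$-model $M\prec H(\theta)$ which is closed under ${<}\alpha$-sequences and for which there exists a $\kappa$-powerset preserving elementary embedding $j\colon M\to N$. A \emph{filter} on $\kappa$ is a set $F\subseteq\mathcal P(\kappa)$ such that the intersection of any finitely many elements of $F$ has size $\kappa$. It is \emph{$M$-normal} if for every $A\in\mathcal P(\kappa)\cap M$ we have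 $A\in F$ or $\kappa\setminus A\in F$, and the diagonal intersection $\{\beta<\kappa\mid\beta\in X_\gamma\text{ for all }\gamma<\beta\}$ belongs to $F$ whenever $\langle X_\gamma\mid\gamma<\kappa\rangle\in M$ is a sequence of elements of $F$. For an ordinal $\alpha$, $\vec M=\langle M_i\mid i<\alpha\rangle$ and $F$ witness that $\kappa$ has an \emph{$\alpha$-filter sequence} if $\vec M$ is a $\subseteq$-increasing $\in$-chain of $\kappa$-models, $F$ is an $M$-normal filter on $\kappa$ for $M=\bigcup_{i<\alpha}M_i$, and $F\cap M_i\in M_{i+1}$ whenever $i+1<\alpha$. If additionally the ultrapower of $M$ by $F$ (formed with the functions $f\in M$ with domain $\kappa$) is well-founded, they witness that $\kappa$ has a \emph{well-founded} $\alpha$-filter sequence. Proposition. Let $\alpha\le\kappa$ be regular (infinite) cardinals. The following are equivalent. (a) $\kappa$ is $\alpha$-Ramsey. (b) For every regular $\theta>\kappa$, $\kappa$ has a well-founded $\alpha$-filter sequence, as witnessed by some $\vec M=\langle M_i\mid i<\alpha\rangle$ and $F$, where each $M_i\prec H(\theta)$. If $\alpha>\omega$, then each of the following is also equivalent to the above.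 (b$'$) For every regular $\theta>\kappa$, $\kappa$ has an $\alpha$-filter sequence, as witnessed by some $\vec M=\langle M_i\mid i<\alpha\rangle$ and $F$, where each $M_i\prec H(\theta)$. (c) For some regular $\theta>2^\kappa$ and every $A\subseteq\kappa$, $\kappa$ has an $\alpha$-filter sequence, as witnessed by some $\vec M=\langle M_i\mid i<\alpha\rangle$ and $F$, where $A\in M_0$ and each $M_i\prec H(\theta)$. -/

import Mathlib

universe u

namespace RamseyLike

open FirstOrder Cardinal

/-! The universe of sets is `ZFSet.{u}`; cardinals are elements of `Cardinal.{u}`, identified with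
initial von Neumann ordinals. -/

/-- The relation symbols of the language of set theory: one binary symbol. -/
inductive MemRel : ℕ → Type
  | mem : MemRel 2

/-- The first-order language of set theory. -/
def setLang : FirstOrder.Language.{0, 0} := ⟨fun _ => Empty, MemRel⟩

/-- The membership symbol. -/
abbrev memSymb : setLang.Relations 2 := MemRel.mem

/-- Every collection of sets is a structure for the language of set theory, the symbol being
interpreted by true membership. -/
instance memStructure (p : ZFSet.{u} → Prop) : setLang.Structure {x : ZFSet.{u} // p x} where
  funMap := fun f _ => Empty.elim f
  RelMap := fun r => match r with
    | MemRel.mem => fun v => (v 0).1 ∈ (v 1).1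

section ZFCMinus

variable {X : Type*} [setLang.Structure X]

/-- The membership relation of a structure for the language of set theory. -/
def E (x y : X) : Prop :=
  FirstOrder.Language.Structure.RelMap (L := setLang) memSymb ![x, y]

/-- The structure thinks that `p` is the Kuratowski pair `(a, b) = {{a}, {a, b}}`. -/
def IsPair (a b p : X) : Prop :=
  ∀ z, E z p ↔ ((∀ w, E w z ↔ w = a) ∨ (∀ w, E w z ↔ w = a ∨ w = b))

variable (X) in
/-- The structure `X` is a model of `ZFC⁻`: the axioms of `ZFC` without the power set axiom, with
the scheme of collection (and that of separation), and with choice in the form that every set can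
be well-ordered. In the two schemes `q` is a tuple of parameters. -/
structure ModelsZFCMinus : Prop where
  extensionality : ∀ x y : X, (∀ z, E z x ↔ E z y) → x = y
  foundation : ∀ x : X, (∃ y, E y x) → ∃ y, E y x ∧ ∀ z, E z y → ¬ E z x
  pairing : ∀ a b : X, ∃ c, ∀ z, E z c ↔ (z = a ∨ z = b)
  union : ∀ a : X, ∃ c, ∀ z, E z c ↔ ∃ y, E y a ∧ E z y
  infinity : ∃ a : X, (∃ e, E e a ∧ ∀ z, ¬ E z e) ∧
    ∀ y, E y a → ∃ s, E s a ∧ ∀ z, E z s ↔ (E z y ∨ z = y)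
  separation : ∀ (n : ℕ) (φ : setLang.Formula (Fin (n + 1))) (q : Fin n → X) (a : X),
    ∃ c, ∀ x, E x c ↔ (E x a ∧ φ.Realize (Fin.cons x q : Fin (n + 1) → X))
  collection :
    ∀ (n : ℕ) (φ : setLang.Formula (Fin (n + 2))) (q : Fin n → X) (a : X),
    (∀ x, E x a →
      ∃ y, φ.Realize (Fin.cons x (Fin.cons y q : Fin (n + 1) → X) : Fin (n + 2) → X)) →
    ∃ c, ∀ x, E x a →
      ∃ y, E y c ∧ φ.Realize (Fin.cons x (Fin.cons y q : Fin (n + 1) → X) : Fin (n + 2) → X)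
  wellOrdering : ∀ a : X, ∃ r : X,
    (∀ x, E x a → ¬ ∃ p, IsPair x x p ∧ E p r) ∧
    (∀ x y z, E x a → E y a → E z a → (∃ p, IsPair x y p ∧ E p r) →
      (∃ p, IsPair y z p ∧ E p r) → ∃ p, IsPair x z p ∧ E p r) ∧
    (∀ x y, E x a → E y a → x ≠ y →
      (∃ p, IsPair x y p ∧ E p r) ∨ ∃ p, IsPair y x p ∧ E p r) ∧
    ∀ b : X, (∃ x, E x b) → (∀ x, E x b → E x a) →
      ∃ m, E m b ∧ ∀ x, E x b → ¬ ∃ p, IsPair x m p ∧ E p r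

end ZFCMinus

/-- The cardinal `κ` as a von Neumann ordinal. -/
noncomputable abbrev cardSet (κ : Cardinal.{u}) : ZFSet.{u} := κ.ord.toZFSet

/-- `H(θ)`: the sets whose transitive closure has size less than `θ`, that is, the sets contained
in a transitive set of size less than `θ`. -/
def H (θ : Cardinal.{u}) : Set ZFSet.{u} :=
  {x | ∃ t : ZFSet.{u}, t.IsTransitive ∧ x ⊆ t ∧ t.card < θ}

/-- `M ≺ H(θ)`: the inclusion is a map from `M` to `H(θ)` and is elementary. -/
def ElemSubH (M : ZFSet.{u}) (θ : Cardinal.{u}) : Prop :=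
  ∃ j : {x // x ∈ M} ↪ₑ[setLang] {x // x ∈ H θ}, ∀ x, (j x).1 = x.1

/-- `M` contains all sequences of elements of `M` of length less than `γ`. -/
def ClosedUnderLT (M : ZFSet.{u}) (γ : Ordinal.{u}) : Prop :=
  ∀ β < γ, ∀ s : ZFSet.{u}, ZFSet.IsFunc β.toZFSet M s → s ∈ M

/-- A weak `κ`-model: a set `M` of size `κ`, not necessarily transitive, with `κ + 1 ⊆ M`, that is
a model of `ZFC⁻`. -/
structure IsWeakModel (κ : Cardinal.{u}) (M : ZFSet.{u}) : Prop where
  card_eq : M.card = κ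
  ordinals : ∀ β ≤ κ.ord, β.toZFSet ∈ M
  models : ModelsZFCMinus {x // x ∈ M}

/-- A `κ`-model: a weak `κ`-model closed under sequences of length less than `κ`. -/
structure IsModel (κ : Cardinal.{u}) (M : ZFSet.{u}) : Prop extends IsWeakModel κ M where
  closed : ClosedUnderLT M κ.ord

/-- The elementary embedding `j : M → N` is `κ`-powerset preserving: its critical point is `κ`, and
`M` and `N` have the same subsets of `κ`. -/
structure IsPowersetPreserving (κ : Cardinal.{u}) (M N : ZFSet.{u})
    (j : {x // x ∈ M} ↪ₑ[setLang] {x // x ∈ N}) : Prop where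
  fixes : ∀ x : {x // x ∈ M}, x.1 ∈ cardSet κ → (j x).1 = x.1
  moves : ∃ x : {x // x ∈ M}, x.1 = cardSet κ ∧ (j x).1 ≠ cardSet κ
  same_subsets : ∀ A : ZFSet.{u}, A ⊆ cardSet κ → (A ∈ M ↔ A ∈ N)

/-- `κ` is `α`-Ramsey (`α ≤ κ` regular cardinals). The target `N` of the embedding is a transitive
set. -/
def IsRamsey (α κ : Cardinal.{u}) : Prop :=
  ∀ μ : Cardinal.{u}, ∃ θ : Cardinal.{u}, μ ≤ θ ∧ θ.IsRegular ∧
    ∀ A : ZFSet.{u}, A ⊆ cardSet κ → ∃ M : ZFSet.{u},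
      A ∈ M ∧ IsWeakModel κ M ∧ ElemSubH M θ ∧ ClosedUnderLT M α.ord ∧
      ∃ N : ZFSet.{u}, N.IsTransitive ∧
        ∃ j : {x // x ∈ M} ↪ₑ[setLang] {x // x ∈ N}, IsPowersetPreserving κ M N j

/-- A (partial) filter on `κ`: a set of subsets of `κ` such that the intersection of any finitely
many of them (within `κ`) has size `κ`. -/
def IsFilter (κ : Cardinal.{u}) (F : ZFSet.{u}) : Prop :=
  (∀ A ∈ F, A ⊆ cardSet κ) ∧
  ∀ s : Finset ZFSet.{u}, (∀ A ∈ s, A ∈ F) →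
    (ZFSet.sep (fun β => ∀ A ∈ s, β ∈ A) (cardSet κ)).card = κ

/-- The diagonal intersection `{β < κ | ∀ γ < β, β ∈ X γ}` of a sequence `X` with domain `κ`. -/
noncomputable def diagInter (κ : Cardinal.{u}) (X : ZFSet.{u}) : ZFSet.{u} :=
  ZFSet.sep (fun β => ∀ γ ∈ β, ∃ A, ZFSet.pair γ A ∈ X ∧ β ∈ A) (cardSet κ)

/-- `F` is an `M`-normal filter on `κ`. -/
structure IsNormalFilter (κ : Cardinal.{u}) (M F : ZFSet.{u}) : Prop where
  filter : IsFilter κ F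
  measures : ∀ A ∈ M, A ⊆ cardSet κ → A ∈ F ∨ cardSet κ \ A ∈ F
  diag_mem : ∀ X ∈ M, ZFSet.IsFunc (cardSet κ) F X → diagInter κ X ∈ F

/-- The functions with domain `κ` that belong to `M`; they represent the elements of the ultrapower
of `M` by a filter on `κ`. -/
def UltraFun (κ : Cardinal.{u}) (M : ZFSet.{u}) : Type (u + 1) :=
  {f : ZFSet.{u} // f ∈ M ∧ ∃ y, ZFSet.IsFunc (cardSet κ) y f}

/-- The membership relation of the ultrapower of `M` by `F`, on representatives:
`{β < κ | f β ∈ g β} ∈ F`. -/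
def ultraMem (κ : Cardinal.{u}) (M F : ZFSet.{u}) (f g : UltraFun κ M) : Prop :=
  ZFSet.sep (fun β => ∃ a b, ZFSet.pair β a ∈ f.1 ∧ ZFSet.pair β b ∈ g.1 ∧ a ∈ b) (cardSet κ) ∈ F

/-- The ultrapower of `M` by `F` is well-founded. (Membership in the ultrapower does not depend on
the choice of representatives, so well-foundedness can be tested on these.) -/
def WellFoundedUltrapower (κ : Cardinal.{u}) (M F : ZFSet.{u}) : Prop :=
  WellFounded (ultraMem κ M F)

/-- The union `⋃_{i < α} M i` of an `α`-sequence of sets. -/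
noncomputable def seqUnion (α : Ordinal.{u}) (M : Ordinal.{u} → ZFSet.{u}) : ZFSet.{u} :=
  ZFSet.iUnion (fun i : Set.Iio α => M i)

/-- The sequence `⟨M i | i < α⟩` and `F` witness that `κ` has an `α`-filter sequence: the `M i` form
a `⊆`-increasing `∈`-chain of `κ`-models, and `F` is a filter on `κ` that is normal for their
union and amenable for the sequence. Only the values `M i` for `i < α` matter. -/
structure IsFilterSequence (α : Ordinal.{u}) (κ : Cardinal.{u}) (M : Ordinal.{u} → ZFSet.{u})
    (F : ZFSet.{u}) : Prop where
  model : ∀ i < α, IsModel κ (M i)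
  subset : ∀ i j, i < j → j < α → M i ⊆ M j
  mem : ∀ i j, i < j → j < α → M i ∈ M j
  normal : IsNormalFilter κ (seqUnion α M) F
  amenable : ∀ i, i + 1 < α → F ∩ M i ∈ M (i + 1)

end RamseyLike

/-! All the conditions are compared with one auxiliary statement, `AllGood α κ θ` for a regular θ >
2^κ. It concerns pairs (h, f) in H(θ), where h contains all of its subsets of size at most κ and f
maps h to h. It says that every such pair has a `GoodSeq`: an α-chain of subsets of h of size κ,
each closed under f and under subsets of size less than κ, with a filter that is normal and amenable
for the chain and has a well-founded ultrapower. This is first-order over H(θ) with parameters α and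
κ. Hence, if it fails, a counterexample lies in every M ≺ H(θ) that contains α and κ
(`ElemSub.exists_bad`), and it suffices to serve the pairs that belong to one convenient M.

From an embedding. Let j : M → N be κ-powerset preserving with M closed under <α-sequences, and let
F be the set of A ∈ M with A ⊆ κ and κ ∈ j(A). Then κ is a strong limit, and F ∩ m ∈ M for each m ∈
M of size κ, because M and N have the same subsets of κ. For a pair in M, a chain of length α is
built with every proper initial segment in M: at each stage the earlier models and their traces of F
form a set of size less than α, so it belongs to M, and elementarity provides the next model. The
ultrapower is well-founded since [g] ↦ j(g)(κ) maps it into N (`EmbSetup.not_bad`,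
`IsRamsey.exists_allGood`).

From a filter sequence in H(θ), θ > 2^κ. A counterexample would lie in M_0, but the sets M_i ∩ h and
the restriction of F to the union of the M_i serve it (`allGood_of_isFilterSequence`). When α is
uncountable, well-foundedness is automatic: a descending sequence of functions is contained in a
single M_i, which is closed under ω-sequences, and normality yields a β at which all the values
descend (`IsFilterSequence.wellFounded`).

Changing θ. Given `AllGood α κ θ₀`, an arbitrary regular θ > κ and A ⊆ κ, let X ≺ H(θ) have size at
most 2^κ and be closed under subsets of size at most κ and under a Skolem function that is modified
to send κ to A. The transitive collapse of X with this function is a pair in H(θ₀). The collapse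
fixes all subsets of κ, so the filter sequence of the pair pulls back to one whose models are
elementary in H(θ), the first of them containing A (`AllGood.exists_isFilterSequence`).

Back to embeddings. Łoś's theorem gives an embedding of U = ⋃ M_i into its ultrapower. Normality
gives critical point κ and puts the subsets of κ in U into the ultrapower; amenability gives the
reverse inclusion (`IsFilterSequence.exists_isPowersetPreserving`). -/

namespace RamseyLike

open FirstOrder Cardinal

set_option linter.unusedVariables false
set_option synthInstance.maxSize 100000
set_option synthInstance.maxHeartbeats 400000

/-! ### Predicates definable over transitive classes -/

/-- Types of tuples of sets. -/
class Ctx (Γ : Type (u + 1)) where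
  ι : Type
  fin : Finite ι
  var : ι → Γ → ZFSet.{u}
  tuple : (ι → ZFSet.{u}) → Γ
  var_tuple : ∀ v i, var i (tuple v) = v i

instance : Ctx ZFSet.{u} where
  ι := Unit
  fin := inferInstance
  var _ x := x
  tuple v := v ()
  var_tuple _ _ := rfl

instance (Γ Δ : Type (u + 1)) [Ctx Γ] [Ctx Δ] : Ctx (Γ × Δ) where
  ι := Ctx.ι Γ ⊕ Ctx.ι Δ
  fin := by
    have := Ctx.fin (Γ := Γ)
    have := Ctx.fin (Γ := Δ)
    infer_instance
  var := Sum.elim (fun i p => Ctx.var i p.1) (fun i p => Ctx.var i p.2)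
  tuple v := (Ctx.tuple fun i => v (Sum.inl i), Ctx.tuple fun i => v (Sum.inr i))
  var_tuple := by
    rintro v (i | i) <;> simp [Ctx.var_tuple]

instance (n : ℕ) : Ctx (Fin n → ZFSet.{u}) where
  ι := Fin n
  fin := inferInstance
  var i v := v i
  tuple v := v
  var_tuple _ _ := rfl

/-- All entries of the tuple satisfy `p`. -/
def AllIn {Γ : Type (u + 1)} [Ctx Γ] (p : Set ZFSet.{u}) (g : Γ) : Prop :=
  ∀ i, Ctx.var i g ∈ p

@[simp] lemma allIn_set {p : Set ZFSet.{u}} {x : ZFSet.{u}} : AllIn p x ↔ x ∈ p :=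
  ⟨fun h => h (), fun h _ => h⟩

@[simp] lemma allIn_prod {Γ Δ : Type (u + 1)} [Ctx Γ] [Ctx Δ] {p : Set ZFSet.{u}} {g : Γ × Δ} :
    AllIn p g ↔ AllIn p g.1 ∧ AllIn p g.2 :=
  ⟨fun h => ⟨fun i => h (Sum.inl i), fun i => h (Sum.inr i)⟩, fun h i => by
    rcases i with i | i
    exacts [h.1 i, h.2 i]⟩

@[simp] lemma allIn_fin {n : ℕ} {p : Set ZFSet.{u}} {v : Fin n → ZFSet.{u}} :
    AllIn p v ↔ ∀ i, v i ∈ p := Iff.rfl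

/-- The entries of two tuples are related by `r`. -/
def RelTuple {Γ : Type (u + 1)} [Ctx Γ] (r : ZFSet.{u} → ZFSet.{u} → Prop) (g g' : Γ) : Prop :=
  ∀ i, r (Ctx.var i g) (Ctx.var i g')

@[simp] lemma relTuple_set {r : ZFSet.{u} → ZFSet.{u} → Prop} {x y : ZFSet.{u}} :
    RelTuple r x y ↔ r x y :=
  ⟨fun h => h (), fun h _ => h⟩

@[simp] lemma relTuple_prod {Γ Δ : Type (u + 1)} [Ctx Γ] [Ctx Δ]
    {r : ZFSet.{u} → ZFSet.{u} → Prop} {g g' : Γ × Δ} :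
    RelTuple r g g' ↔ RelTuple r g.1 g'.1 ∧ RelTuple r g.2 g'.2 :=
  ⟨fun h => ⟨fun i => h (Sum.inl i), fun i => h (Sum.inr i)⟩, fun h i => by
    rcases i with i | i
    exacts [h.1 i, h.2 i]⟩

/-- A class is transitive. -/
def TransClass (T : Set ZFSet.{u}) : Prop := ∀ y ∈ T, ∀ x ∈ y, x ∈ T

/-- The valuation in the class `T` given by a tuple. -/
def val {Γ : Type (u + 1)} [Ctx Γ] {T : Set ZFSet.{u}} (g : Γ) (h : AllIn T g) :
    Ctx.ι Γ → {x // x ∈ T} := fun i => ⟨Ctx.var i g, h i⟩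

/-- A predicate on tuples, depending on a class `T`, is definable if one formula defines it over
all transitive `T`. -/
class Def {Γ : Type (u + 1)} [Ctx Γ] (P : Set ZFSet.{u} → Γ → Prop) : Prop where
  out : ∃ φ : setLang.Formula (Ctx.ι Γ), ∀ T : Set ZFSet.{u}, TransClass T →
    ∀ (g : Γ) (hg : AllIn T g), φ.Realize (val g hg) ↔ P T g

/-- A map of tuples whose entries are among the entries of the argument. -/
class IsProj {Γ Δ : Type (u + 1)} [Ctx Γ] [Ctx Δ] (t : Γ → Δ) : Prop where
  out : ∃ σ : Ctx.ι Δ → Ctx.ι Γ, ∀ g i, Ctx.var i (t g) = Ctx.var (σ i) g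

/-! ### Substitution of variables and closure of definability under logical operations -/

section

variable {Γ Δ Θ : Type (u + 1)} [Ctx Γ] [Ctx Δ] [Ctx Θ]

instance : IsProj (fun g : Γ => g) := ⟨id, fun _ _ => rfl⟩

instance (t : Γ → Δ × Θ) [h : IsProj t] : IsProj (fun g => (t g).1) := by
  obtain ⟨σ, hσ⟩ := h.out
  exact ⟨fun i => σ (Sum.inl i), fun g i => hσ g (Sum.inl i)⟩

instance (t : Γ → Δ × Θ) [h : IsProj t] : IsProj (fun g => (t g).2) := by
  obtain ⟨σ, hσ⟩ := h.out
  exact ⟨fun i => σ (Sum.inr i), fun g i => hσ g (Sum.inr i)⟩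

instance (n : ℕ) (t : Γ → (Fin n → ZFSet.{u})) [h : IsProj t] (i : Fin n) :
    IsProj (fun g => t g i) := by
  obtain ⟨σ, hσ⟩ := h.out
  exact ⟨fun _ => σ i, fun g _ => hσ g i⟩

lemma IsProj.prodMk (s : Γ → Δ) (t : Γ → Θ) [hs : IsProj s] [ht : IsProj t] :
    IsProj (fun g => (s g, t g)) := by
  obtain ⟨σ, hσ⟩ := hs.out
  obtain ⟨τ, hτ⟩ := ht.out
  exact ⟨Sum.elim σ τ, by rintro g (i | i); exacts [hσ g i, hτ g i]⟩

instance (n : ℕ) (s : Γ → ZFSet.{u}) (t : Γ → (Fin n → ZFSet.{u})) [hs : IsProj s]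
    [ht : IsProj t] : IsProj (fun g => (Fin.cons (s g) (t g) : Fin (n + 1) → ZFSet.{u})) := by
  obtain ⟨σ, hσ⟩ := hs.out
  obtain ⟨τ, hτ⟩ := ht.out
  exact ⟨Fin.cons (σ ()) τ, fun g i => by
    refine Fin.cases ?_ (fun i => ?_) i
    exacts [hσ g (), hτ g i]⟩

lemma IsProj.allIn {t : Γ → Δ} (h : IsProj t) {T : Set ZFSet.{u}} {g : Γ} (hg : AllIn T g) :
    AllIn T (t g) := by
  obtain ⟨σ, hσ⟩ := h.out
  intro i
  rw [hσ]
  exact hg _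

lemma Def.subst {P : Set ZFSet.{u} → Δ → Prop} (hP : Def P) (t : Γ → Δ) [ht : IsProj t] :
    Def (fun T g => P T (t g)) := by
  obtain ⟨φ, hφ⟩ := hP.out
  obtain ⟨σ, hσ⟩ := ht.out
  refine ⟨φ.relabel σ, fun T hT g hg => ?_⟩
  rw [Language.Formula.realize_relabel, ← hφ T hT (t g) (ht.allIn hg)]
  have : val g hg ∘ σ = val (t g) (ht.allIn hg) := by
    funext i
    exact Subtype.ext (hσ g i).symm
  rw [this]

lemma Def.subst₂ {P : Set ZFSet.{u} → Δ × Θ → Prop} (hP : Def P) (s : Γ → Δ) (t : Γ → Θ)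
    [IsProj s] [IsProj t] : Def (fun T g => P T (s g, t g)) :=
  hP.subst _ (ht := .prodMk s t)

lemma Def.subst₃ {Ξ : Type (u + 1)} [Ctx Ξ] {P : Set ZFSet.{u} → Δ × Θ × Ξ → Prop} (hP : Def P)
    (r : Γ → Δ) (s : Γ → Θ) (t : Γ → Ξ) [IsProj r] [IsProj s] [IsProj t] :
    Def (fun T g => P T (r g, s g, t g)) :=
  have := IsProj.prodMk s t
  hP.subst₂ r _

lemma Def.congr {P Q : Set ZFSet.{u} → Γ → Prop} (hP : Def P)
    (h : ∀ T, TransClass T → ∀ g, AllIn T g → (P T g ↔ Q T g)) : Def Q := by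
  obtain ⟨φ, hφ⟩ := hP.out
  exact ⟨φ, fun T hT g hg => (hφ T hT g hg).trans (h T hT g hg)⟩

instance Def.mem (s t : Γ → ZFSet.{u}) [IsProj s] [IsProj t] :
    Def (fun _ g => s g ∈ t g) := by
  have : Def (fun (_ : Set ZFSet.{u}) (g : ZFSet.{u} × ZFSet.{u}) => g.1 ∈ g.2) :=
    ⟨memSymb.formula₂ (Language.Term.var (Sum.inl ())) (Language.Term.var (Sum.inr ())),
      fun T hT g hg => by
        rw [Language.Formula.realize_rel₂]
        exact Iff.rfl⟩
  exact this.subst₂ s t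

instance Def.eq (s t : Γ → ZFSet.{u}) [IsProj s] [IsProj t] :
    Def (fun _ g => s g = t g) := by
  have : Def (fun (_ : Set ZFSet.{u}) (g : ZFSet.{u} × ZFSet.{u}) => g.1 = g.2) :=
    ⟨(Language.Term.var (Sum.inl ())).equal (Language.Term.var (Sum.inr ())),
      fun T hT g hg => by
        rw [Language.Formula.realize_equal]
        exact Subtype.ext_iff⟩
  exact this.subst₂ s t

instance Def.and (P Q : Set ZFSet.{u} → Γ → Prop) [hP : Def P] [hQ : Def Q] :
    Def (fun T g => P T g ∧ Q T g) := by
  obtain ⟨φ, hφ⟩ := hP.out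
  obtain ⟨ψ, hψ⟩ := hQ.out
  exact ⟨φ ⊓ ψ, fun T hT g hg => by
    rw [Language.Formula.realize_inf, hφ T hT, hψ T hT]⟩

instance Def.not (P : Set ZFSet.{u} → Γ → Prop) [hP : Def P] : Def (fun T g => ¬ P T g) := by
  obtain ⟨φ, hφ⟩ := hP.out
  exact ⟨φ.not, fun T hT g hg => by rw [Language.Formula.realize_not, hφ T hT]⟩

instance Def.or (P Q : Set ZFSet.{u} → Γ → Prop) [Def P] [Def Q] :
    Def (fun T g => P T g ∨ Q T g) :=
  Def.congr (P := fun T g => ¬ (¬ P T g ∧ ¬ Q T g)) inferInstance fun _ _ _ _ => by tauto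

instance Def.imp (P Q : Set ZFSet.{u} → Γ → Prop) [Def P] [Def Q] :
    Def (fun T g => P T g → Q T g) :=
  Def.congr (P := fun T g => ¬ (P T g ∧ ¬ Q T g)) inferInstance fun _ _ _ _ => by tauto

instance Def.iff (P Q : Set ZFSet.{u} → Γ → Prop) [Def P] [Def Q] :
    Def (fun T g => P T g ↔ Q T g) :=
  Def.congr (P := fun T g => (P T g → Q T g) ∧ (Q T g → P T g)) inferInstance
    fun _ _ _ _ => by tauto

lemma val_sum {T : Set ZFSet.{u}} {g : Γ} (hg : AllIn T g) {d : Δ} (hd : AllIn T d) :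
    val (g, d) (allIn_prod.2 ⟨hg, hd⟩) = Sum.elim (val g hg) (val d hd) := by
  funext i
  rcases i with i | i <;> rfl

instance Def.exTuple (P : Set ZFSet.{u} → Γ → Δ → Prop) [hP : Def (fun T (p : Γ × Δ) => P T p.1 p.2)] :
    Def (fun T g => ∃ d : Δ, AllIn T d ∧ P T g d) := by
  obtain ⟨φ, hφ⟩ := hP.out
  have := Ctx.fin (Γ := Δ)
  refine ⟨Language.Formula.iExs (Ctx.ι Δ) φ, fun T hT g hg => ?_⟩
  rw [Language.Formula.realize_iExs]
  constructor
  · rintro ⟨v, hv⟩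
    have hd : AllIn T (Ctx.tuple fun i => (v i).1 : Δ) := fun i => by
      rw [Ctx.var_tuple]
      exact (v i).2
    refine ⟨_, hd, ?_⟩
    rw [← hφ T hT (g, _) (allIn_prod.2 ⟨hg, hd⟩), val_sum hg hd]
    have : v = val _ hd := by
      funext i
      exact Subtype.ext (Ctx.var_tuple (Γ := Δ) (fun i => (v i).1) i).symm
    rwa [← this]
  · rintro ⟨d, hd, h⟩
    refine ⟨val d hd, ?_⟩
    rwa [← val_sum hg hd, hφ T hT]

instance Def.ex (P : Set ZFSet.{u} → Γ → ZFSet.{u} → Prop)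
    [Def (fun T (p : Γ × ZFSet.{u}) => P T p.1 p.2)] :
    Def (fun T g => ∃ x, x ∈ T ∧ P T g x) :=
  (Def.exTuple P).congr fun _ _ _ _ => by simp only [allIn_set]

instance Def.all (P : Set ZFSet.{u} → Γ → ZFSet.{u} → Prop)
    [Def (fun T (p : Γ × ZFSet.{u}) => P T p.1 p.2)] :
    Def (fun T g => ∀ x, x ∈ T → P T g x) :=
  Def.congr (P := fun T g => ¬ ∃ x, x ∈ T ∧ ¬ P T g x) inferInstance
    fun _ _ _ _ => by push Not; rfl

lemma IsProj.comp_fst (t : Γ → Δ) [ht : IsProj t] : IsProj (fun p : Γ × Θ => t p.1) := by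
  obtain ⟨σ, hσ⟩ := ht.out
  exact ⟨fun i => Sum.inl (σ i), fun g i => hσ g.1 i⟩

/-- The witnesses of a bounded quantifier lie in `T` because `T` is transitive. This is the reason
for restricting definability to transitive classes: predicates with bounded quantifiers keep their
true meaning in each of them. -/
instance Def.bex (t : Γ → ZFSet.{u}) (P : Set ZFSet.{u} → Γ → ZFSet.{u} → Prop) [ht : IsProj t]
    [Def (fun T (p : Γ × ZFSet.{u}) => P T p.1 p.2)] :
    Def (fun T g => ∃ x, x ∈ t g ∧ P T g x) :=
  have : IsProj (fun p : Γ × ZFSet.{u} => t p.1) := IsProj.comp_fst t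
  Def.congr (P := fun T g => ∃ x, x ∈ T ∧ (x ∈ t g ∧ P T g x)) inferInstance
    fun T hT g hg => exists_congr fun x => and_iff_right_of_imp fun h =>
      hT _ (allIn_set.1 (ht.allIn hg)) _ h.1

instance Def.ball (t : Γ → ZFSet.{u}) (P : Set ZFSet.{u} → Γ → ZFSet.{u} → Prop) [IsProj t]
    [Def (fun T (p : Γ × ZFSet.{u}) => P T p.1 p.2)] :
    Def (fun T g => ∀ x, x ∈ t g → P T g x) :=
  Def.congr (P := fun T g => ¬ ∃ x, x ∈ t g ∧ ¬ P T g x) inferInstance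
    fun _ _ _ _ => by push Not; rfl

instance Def.subset (s t : Γ → ZFSet.{u}) [IsProj s] [IsProj t] :
    Def (fun _ g => s g ⊆ t g) :=
  have : Def (fun _ (g : ZFSet.{u} × ZFSet.{u}) => g.1 ⊆ g.2) :=
    Def.congr (P := fun _ g => ∀ x, x ∈ g.1 → x ∈ g.2) inferInstance fun _ _ _ _ => Iff.rfl
  this.subst₂ s t

/-- The predicate on tuples of elements of `T` defined by a formula. -/
def Sat {n : ℕ} (φ : setLang.Formula (Fin n)) (T : Set ZFSet.{u}) (v : Fin n → ZFSet.{u}) : Prop :=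
  ∃ h : ∀ i, v i ∈ T, φ.Realize (fun i => (⟨v i, h i⟩ : {x // x ∈ T}))

/-- This lets an arbitrary formula occur inside a definable predicate, as is needed for the axiom
schemes, the Tarski–Vaught test and Łoś's theorem. -/
instance Def.sat {n : ℕ} (φ : setLang.Formula (Fin n)) (t : Γ → (Fin n → ZFSet.{u})) [IsProj t] :
    Def (fun T g => Sat φ T (t g)) := by
  have : Def (fun T (v : Fin n → ZFSet.{u}) => Sat φ T v) :=
    ⟨φ, fun T hT g hg => ⟨fun h => ⟨hg, h⟩, fun h => h.2⟩⟩
  exact this.subst t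

end

/-! ### Definability of pairs and functions -/

section

variable {Γ : Type (u + 1)} [Ctx Γ]

instance Def.eq_pairSet (r s t : Γ → ZFSet.{u}) [IsProj r] [IsProj s] [IsProj t] :
    Def (fun _ g => r g = {s g, t g}) := by
  have : Def (fun _ (g : ZFSet.{u} × ZFSet.{u} × ZFSet.{u}) => g.1 = {g.2.1, g.2.2}) :=
    Def.congr (P := fun _ g => g.2.1 ∈ g.1 ∧ g.2.2 ∈ g.1 ∧
      ∀ x, x ∈ g.1 → x = g.2.1 ∨ x = g.2.2) inferInstance fun _ _ g _ => by
        constructor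
        · rintro ⟨h1, h2, h3⟩
          ext x
          rw [ZFSet.mem_pair]
          exact ⟨h3 x, by rintro (h | h) <;> rwa [h]⟩
        · intro h
          simp [h]
  exact this.subst₃ r s t

/-- All quantifiers are bounded by `p`, so definability follows from that of unordered pairs; the
singleton is written `{x, x}` to be one of these. -/
lemma eq_pair_iff {p x y : ZFSet.{u}} : p = ZFSet.pair x y ↔
    ∃ a, a ∈ p ∧ ∃ b, b ∈ p ∧ a = {x, x} ∧ b = {x, y} ∧ p = {a, b} := by
  simp only [ZFSet.pair_eq_singleton]
  constructor
  · rintro rfl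
    exact ⟨{x}, by simp [ZFSet.pair], {x, y}, by simp [ZFSet.pair], rfl, rfl, rfl⟩
  · rintro ⟨_, _, _, _, rfl, rfl, h⟩
    exact h

instance Def.eq_pair (r s t : Γ → ZFSet.{u}) [IsProj r] [IsProj s] [IsProj t] :
    Def (fun _ g => r g = ZFSet.pair (s g) (t g)) := by
  have : Def (fun _ (g : ZFSet.{u} × ZFSet.{u} × ZFSet.{u}) => g.1 = ZFSet.pair g.2.1 g.2.2) := by
    simp only [eq_pair_iff]
    infer_instance
  exact this.subst₃ r s t

instance Def.pair_mem (r s t : Γ → ZFSet.{u}) [IsProj r] [IsProj s] [IsProj t] :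
    Def (fun _ g => ZFSet.pair (s g) (t g) ∈ r g) :=
  have : Def (fun _ (g : ZFSet.{u} × ZFSet.{u} × ZFSet.{u}) => ZFSet.pair g.2.1 g.2.2 ∈ g.1) :=
    Def.congr (P := fun _ g => ∃ p, p ∈ g.1 ∧ p = ZFSet.pair g.2.1 g.2.2) inferInstance
      fun _ _ _ _ => by simp
  this.subst₃ r s t

lemma isFunc_iff {x y f : ZFSet.{u}} : ZFSet.IsFunc x y f ↔
    (∀ p, p ∈ f → ∃ a, a ∈ x ∧ ∃ b, b ∈ y ∧ p = ZFSet.pair a b) ∧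
    ∀ a, a ∈ x → ∃ b, b ∈ y ∧ ZFSet.pair a b ∈ f ∧ ∀ c, c ∈ y → ZFSet.pair a c ∈ f → c = b := by
  unfold ZFSet.IsFunc
  constructor
  · rintro ⟨h1, h2⟩
    refine ⟨fun p hp => ZFSet.mem_prod.1 (h1 hp), fun a ha => ?_⟩
    obtain ⟨b, hb, hb'⟩ := h2 a ha
    exact ⟨b, (ZFSet.pair_mem_prod.1 (h1 hb)).2, hb, fun c _ hc => hb' c hc⟩
  · rintro ⟨h1, h2⟩
    have h0 : f ⊆ ZFSet.prod x y := fun p hp => ZFSet.mem_prod.2 (h1 p hp)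
    refine ⟨h0, fun a ha => ?_⟩
    obtain ⟨b, hb, hb1, hb'⟩ := h2 a ha
    exact ⟨b, hb1, fun c hc => hb' c (ZFSet.pair_mem_prod.1 (h0 hc)).2 hc⟩

instance Def.isFunc (r s t : Γ → ZFSet.{u}) [IsProj r] [IsProj s] [IsProj t] :
    Def (fun _ g => ZFSet.IsFunc (r g) (s g) (t g)) := by
  have : Def (fun _ (g : ZFSet.{u} × ZFSet.{u} × ZFSet.{u}) => ZFSet.IsFunc g.1 g.2.1 g.2.2) := by
    simp only [isFunc_iff]
    infer_instance
  exact this.subst₃ r s t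

end

/-! ### Elementary substructures and embeddings -/

section

variable {Γ Δ : Type (u + 1)} [Ctx Γ] [Ctx Δ]

/-- `M` is an elementary substructure of the class `T`. -/
def ElemSub (M : ZFSet.{u}) (T : Set ZFSet.{u}) : Prop :=
  ∃ j : {x // x ∈ M} ↪ₑ[setLang] {x // x ∈ T}, ∀ x, (j x).1 = x.1

lemma ElemSub.subset {M : ZFSet.{u}} {T : Set ZFSet.{u}} (h : ElemSub M T) {x : ZFSet.{u}}
    (hx : x ∈ M) : x ∈ T := by
  obtain ⟨j, hj⟩ := h
  have := (j ⟨x, hx⟩).2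
  rwa [hj] at this

/-- A definable nonempty class with parameters in an elementary substructure meets it. -/
lemma ElemSub.exists_mem_tuple {M : ZFSet.{u}} {T : Set ZFSet.{u}} (h : ElemSub M T) (hT : TransClass T)
    (P : Set ZFSet.{u} → Γ → Δ → Prop) [hP : Def (fun T (p : Γ × Δ) => P T p.1 p.2)] {g : Γ}
    (hg : AllIn (M : Set ZFSet.{u}) g) (hex : ∃ d, AllIn T d ∧ P T g d) :
    ∃ d, AllIn (M : Set ZFSet.{u}) d ∧ P T g d := by
  obtain ⟨φ, hφ⟩ := hP.out
  obtain ⟨j, hj⟩ := id h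
  have := Ctx.fin (Γ := Δ)
  obtain ⟨d, hd, hex⟩ := hex
  have hgT : AllIn T g := fun i => h.subset (hg i)
  have key := j.map_formula (φ.iExs (Ctx.ι Δ)) (fun i => ⟨Ctx.var i g, hg i⟩)
  rw [Language.Formula.realize_iExs, Language.Formula.realize_iExs] at key
  have hjg : (j ∘ fun i => (⟨Ctx.var i g, hg i⟩ : {x // x ∈ M})) = val g hgT := by
    funext i
    exact Subtype.ext (hj _)
  rw [hjg] at key
  obtain ⟨v, hv⟩ := key.1 ⟨val d hd, by rwa [← val_sum, hφ T hT]⟩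
  have hd' : AllIn (M : Set ZFSet.{u}) (Ctx.tuple fun i => (v i).1 : Δ) := fun i => by
    rw [Ctx.var_tuple]
    exact (v i).2
  have hdT : AllIn T (Ctx.tuple fun i => (v i).1 : Δ) := fun i => h.subset (hd' i)
  refine ⟨_, hd', ?_⟩
  rw [← hφ T hT (g, _) (allIn_prod.2 ⟨hgT, hdT⟩), val_sum hgT hdT]
  rw [← j.map_formula] at hv
  refine (iff_of_eq (congrArg φ.Realize ?_)).1 hv
  funext i
  rcases i with i | i
  · exact congrFun hjg i
  · refine Subtype.ext ?_
    simp only [Sum.elim_inr, Function.comp_apply, hj]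
    exact (Ctx.var_tuple (Γ := Δ) (fun i => (v i).1) i).symm

lemma ElemSub.exists_mem {M : ZFSet.{u}} {T : Set ZFSet.{u}} (h : ElemSub M T) (hT : TransClass T)
    (P : Set ZFSet.{u} → Γ → ZFSet.{u} → Prop) [Def (fun T (p : Γ × ZFSet.{u}) => P T p.1 p.2)]
    {g : Γ} (hg : AllIn (M : Set ZFSet.{u}) g) (hex : ∃ x, x ∈ T ∧ P T g x) :
    ∃ x, x ∈ M ∧ P T g x := by
  simpa using h.exists_mem_tuple hT P hg (by simpa using hex)

/-- Elementary embeddings preserve definable predicates. -/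
lemma Def.map_iff {M : ZFSet.{u}} {T T' : Set ZFSet.{u}} (h : ElemSub M T) (hT : TransClass T)
    (hT' : TransClass T') (j : {x // x ∈ M} ↪ₑ[setLang] {x // x ∈ T'})
    (P : Set ZFSet.{u} → Γ → Prop) [hP : Def P] {g g' : Γ}
    (hg : RelTuple (fun x y => ∃ h : x ∈ M, (j ⟨x, h⟩).1 = y) g g') : P T g ↔ P T' g' := by
  obtain ⟨φ, hφ⟩ := hP.out
  obtain ⟨k, hk⟩ := id h
  have hgM : AllIn (M : Set ZFSet.{u}) g := fun i => (hg i).1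
  have hgT : AllIn T g := fun i => h.subset (hgM i)
  have hgT' : AllIn T' g' := fun i => by
    obtain ⟨h1, h2⟩ := hg i
    rw [← h2]
    exact (j _).2
  rw [← hφ T hT g hgT, ← hφ T' hT' g' hgT']
  have h1 : val g hgT = k ∘ fun i => ⟨Ctx.var i g, hgM i⟩ := by
    funext i
    exact Subtype.ext (hk ⟨_, hgM i⟩).symm
  have h2 : val g' hgT' = j ∘ fun i => ⟨Ctx.var i g, hgM i⟩ := by
    funext i
    exact Subtype.ext (hg i).2.symm
  rw [h1, h2, k.map_formula, j.map_formula]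

end

/-! ### Images, graphs and values of set functions -/

/-- The image of a set under a class function. -/
noncomputable def img (f : ZFSet.{u} → ZFSet.{u}) (x : ZFSet.{u}) : ZFSet.{u} :=
  ZFSet.range (fun y : {y // y ∈ x} => f y)

@[simp] lemma mem_img {f : ZFSet.{u} → ZFSet.{u}} {x y : ZFSet.{u}} :
    y ∈ img f x ↔ ∃ z ∈ x, f z = y := by
  simp [img]

lemma card_img_le (f : ZFSet.{u} → ZFSet.{u}) (x : ZFSet.{u}) : (img f x).card ≤ x.card := by
  rw [← lift_le.{u + 1}, ← ZFSet.cardinalMk_coe_sort, ← ZFSet.cardinalMk_coe_sort]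
  refine mk_le_of_surjective (f := fun z : x => (⟨f z, mem_img.2 ⟨z, z.2, rfl⟩⟩ : img f x)) ?_
  rintro ⟨y, hy⟩
  obtain ⟨z, hz, rfl⟩ := mem_img.1 hy
  exact ⟨⟨z, hz⟩, rfl⟩

lemma card_le_of_injOn {f : ZFSet.{u} → ZFSet.{u}} {x y : ZFSet.{u}} (h : ∀ z ∈ x, f z ∈ y)
    (hf : ∀ z ∈ x, ∀ w ∈ x, f z = f w → z = w) : x.card ≤ y.card := by
  rw [← lift_le.{u + 1}, ← ZFSet.cardinalMk_coe_sort, ← ZFSet.cardinalMk_coe_sort]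
  refine mk_le_of_injective (f := fun z : x => (⟨f z, h z z.2⟩ : y)) ?_
  rintro ⟨z, hz⟩ ⟨w, hw⟩ hzw
  exact Subtype.ext (hf z hz w hw (congrArg Subtype.val hzw))

/-- A set of cardinality at most that of `y` injects into `y`. -/
lemma exists_img_eq {x y : ZFSet.{u}} (h : x.card ≤ y.card) :
    ∃ f : ZFSet.{u} → ZFSet.{u}, (∀ z ∈ x, f z ∈ y) ∧ ∀ z ∈ x, ∀ w ∈ x, f z = f w → z = w := by
  classical
  rw [← lift_le.{u + 1}, ← ZFSet.cardinalMk_coe_sort, ← ZFSet.cardinalMk_coe_sort] at h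
  obtain ⟨f⟩ := h
  refine ⟨fun z => if hz : z ∈ x then (f ⟨z, hz⟩).1 else ∅, fun z hz => ?_, fun z hz w hw e => ?_⟩
  · simp only [hz, dif_pos]
    exact (f _).2
  · simp only [hz, hw, dif_pos] at e
    exact congrArg Subtype.val (f.injective (Subtype.ext e))

/-- The restriction of a class function to a set. -/
noncomputable def graph (x : ZFSet.{u}) (f : ZFSet.{u} → ZFSet.{u}) : ZFSet.{u} :=
  img (fun z => ZFSet.pair z (f z)) x

lemma mem_graph {x p : ZFSet.{u}} {f : ZFSet.{u} → ZFSet.{u}} :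
    p ∈ graph x f ↔ ∃ z ∈ x, ZFSet.pair z (f z) = p := mem_img

@[simp] lemma pair_mem_graph {x a b : ZFSet.{u}} {f : ZFSet.{u} → ZFSet.{u}} :
    ZFSet.pair a b ∈ graph x f ↔ a ∈ x ∧ b = f a := by
  rw [mem_graph]
  constructor
  · rintro ⟨z, hz, h⟩
    obtain ⟨rfl, rfl⟩ := ZFSet.pair_inj.1 h
    exact ⟨hz, rfl⟩
  · rintro ⟨h, rfl⟩
    exact ⟨a, h, rfl⟩

lemma isFunc_graph {x y : ZFSet.{u}} {f : ZFSet.{u} → ZFSet.{u}} (h : ∀ z ∈ x, f z ∈ y) :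
    ZFSet.IsFunc x y (graph x f) := by
  refine ⟨fun p hp => ?_, fun z hz => ⟨f z, by simp [hz], fun w hw => (pair_mem_graph.1 hw).2⟩⟩
  obtain ⟨z, hz, rfl⟩ := mem_graph.1 hp
  exact ZFSet.pair_mem_prod.2 ⟨hz, h z hz⟩

open Classical in
/-- The value of a set function. -/
noncomputable def app (f a : ZFSet.{u}) : ZFSet.{u} :=
  if h : ∃ b, ZFSet.pair a b ∈ f then h.choose else ∅

lemma app_spec {x y f a : ZFSet.{u}} (hf : ZFSet.IsFunc x y f) (ha : a ∈ x) :
    ZFSet.pair a (app f a) ∈ f := by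
  have h : ∃ b, ZFSet.pair a b ∈ f := (hf.2 a ha).exists
  rw [app, dif_pos h]
  exact h.choose_spec

lemma app_mem {x y f a : ZFSet.{u}} (hf : ZFSet.IsFunc x y f) (ha : a ∈ x) : app f a ∈ y :=
  (ZFSet.pair_mem_prod.1 (hf.1 (app_spec hf ha))).2

lemma pair_mem_iff {x y f a b : ZFSet.{u}} (hf : ZFSet.IsFunc x y f) :
    ZFSet.pair a b ∈ f ↔ a ∈ x ∧ b = app f a := by
  constructor
  · intro h
    have ha := (ZFSet.pair_mem_prod.1 (hf.1 h)).1
    exact ⟨ha, (hf.2 a ha).unique h (app_spec hf ha)⟩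
  · rintro ⟨ha, rfl⟩
    exact app_spec hf ha

lemma mem_isFunc_iff {x y f p : ZFSet.{u}} (hf : ZFSet.IsFunc x y f) :
    p ∈ f ↔ ∃ a ∈ x, p = ZFSet.pair a (app f a) := by
  constructor
  · intro h
    obtain ⟨a, ha, b, hb, rfl⟩ := ZFSet.mem_prod.1 (hf.1 h)
    exact ⟨a, ha, by rw [((pair_mem_iff hf).1 h).2]⟩
  · rintro ⟨a, ha, rfl⟩
    exact app_spec hf ha

lemma app_graph {x a : ZFSet.{u}} {f : ZFSet.{u} → ZFSet.{u}} (ha : a ∈ x) :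
    app (graph x f) a = f a := by
  have h := app_spec (isFunc_graph (y := img f x) fun z hz => mem_img.2 ⟨z, hz, rfl⟩) ha
  exact (pair_mem_graph.1 h).2

lemma isFunc_app {x y z f : ZFSet.{u}} (hf : ZFSet.IsFunc x y f) (h : ∀ a ∈ x, app f a ∈ z) :
    ZFSet.IsFunc x z f := by
  refine ⟨fun p hp => ?_, hf.2⟩
  obtain ⟨a, ha, rfl⟩ := (mem_isFunc_iff hf).1 hp
  exact ZFSet.pair_mem_prod.2 ⟨ha, h a ha⟩

/-! ### Cardinality of unions -/

/-- The union of a set-indexed family. -/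
noncomputable def bUnion (x : ZFSet.{u}) (f : ZFSet.{u} → ZFSet.{u}) : ZFSet.{u} :=
  ZFSet.sUnion (img f x)

@[simp] lemma mem_bUnion {x y : ZFSet.{u}} {f : ZFSet.{u} → ZFSet.{u}} :
    y ∈ bUnion x f ↔ ∃ z ∈ x, y ∈ f z := by
  simp [bUnion]

lemma card_bUnion_le_sum (x : ZFSet.{u}) (f : ZFSet.{u} → ZFSet.{u}) :
    (bUnion x f).card ≤ Cardinal.sum (fun i : Shrink.{u} x => (f ((equivShrink x).symm i)).card) := by
  have h := ZFSet.lift_card_iUnion_le_sum_card.{u, u} (α := Shrink.{u} x)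
    (f := fun i => f ((equivShrink x).symm i))
  rw [Cardinal.lift_id] at h
  refine le_trans (le_of_eq ?_) h
  congr 1
  ext y
  simp only [mem_bUnion, ZFSet.mem_iUnion]
  constructor
  · rintro ⟨z, hz, hy⟩
    exact ⟨equivShrink x ⟨z, hz⟩, by simpa using hy⟩
  · rintro ⟨i, hi⟩
    exact ⟨_, ((equivShrink x).symm i).2, hi⟩

lemma card_bUnion_lt {θ : Cardinal.{u}} (hθ : θ.IsRegular) {x : ZFSet.{u}}
    {f : ZFSet.{u} → ZFSet.{u}} (hx : x.card < θ) (hf : ∀ z ∈ x, (f z).card < θ) :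
    (bUnion x f).card < θ :=
  (card_bUnion_le_sum x f).trans_lt (sum_lt_of_isRegular hθ hx fun i =>
    hf _ ((equivShrink x).symm i).2)

lemma card_bUnion_le {μ : Cardinal.{u}} (hμ : ℵ₀ ≤ μ) {x : ZFSet.{u}}
    {f : ZFSet.{u} → ZFSet.{u}} (hx : x.card ≤ μ) (hf : ∀ z ∈ x, (f z).card ≤ μ) :
    (bUnion x f).card ≤ μ := by
  refine (card_bUnion_le_sum x f).trans ((Cardinal.sum_le_sum _ (fun _ => μ) fun i =>
    hf _ ((equivShrink x).symm i).2).trans ?_)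
  rw [Cardinal.sum_const, Cardinal.lift_id, Cardinal.lift_id]
  exact (mul_le_mul_left hx μ).trans (Cardinal.mul_eq_self hμ).le

/-! ### The sets `H θ` -/

lemma transClass_H (θ : Cardinal.{u}) : TransClass (H θ) := by
  rintro y ⟨t, ht, hy, hc⟩ x hx
  exact ⟨t, ht, ht x (hy hx), hc⟩

lemma card_lt_of_mem_H {θ : Cardinal.{u}} {x : ZFSet.{u}} (h : x ∈ H θ) : x.card < θ := by
  obtain ⟨t, _, hx, hc⟩ := h
  exact (ZFSet.card_mono hx).trans_lt hc

lemma mem_H_of_subset {θ : Cardinal.{u}} {x y : ZFSet.{u}} (h : x ∈ H θ) (hy : y ⊆ x) : y ∈ H θ := by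
  obtain ⟨t, ht, hx, hc⟩ := h
  exact ⟨t, ht, fun z hz => hx (hy hz), hc⟩

/-- Adding to `x` a transitive cover of each of its elements gives a transitive set, whose size
stays below θ by regularity. Replacement and collection in H(θ) rest on this. -/
lemma mem_H_of_forall {θ : Cardinal.{u}} (hθ : θ.IsRegular) {x : ZFSet.{u}} (hx : x.card < θ)
    (h : ∀ y ∈ x, y ∈ H θ) : x ∈ H θ := by
  classical
  have h' : ∀ y, ∃ t : ZFSet.{u}, t.IsTransitive ∧ t.card < θ ∧ (y ∈ x → y ⊆ t) := fun y => by
    by_cases hy : y ∈ x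
    · obtain ⟨t, ht, hx, hc⟩ := h y hy
      exact ⟨t, ht, hc, fun _ => hx⟩
    · exact ⟨∅, by simp, by simpa using hθ.pos, fun h => absurd h hy⟩
  choose t ht hc hs using h'
  refine ⟨x ∪ bUnion x t, ?_, fun z hz => by simp [hz], ?_⟩
  · intro y hy z hz
    rw [ZFSet.mem_union, mem_bUnion] at hy ⊢
    rcases hy with hy | ⟨w, hw, hy⟩
    · exact Or.inr ⟨y, hy, hs y hy hz⟩
    · exact Or.inr ⟨w, hw, ht w y hy hz⟩
  · exact ZFSet.card_union_le.trans_lt (Cardinal.add_lt_of_lt hθ.aleph0_le hx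
      (card_bUnion_lt hθ hx fun z _ => hc z))

lemma pairSet_mem_H {θ : Cardinal.{u}} (hθ : θ.IsRegular) {x y : ZFSet.{u}} (hx : x ∈ H θ)
    (hy : y ∈ H θ) : ({x, y} : ZFSet.{u}) ∈ H θ := by
  refine mem_H_of_forall hθ ?_ fun z hz => ?_
  · refine ZFSet.card_insert_le.trans_lt ?_
    rw [ZFSet.card_singleton, one_add_one_eq_two]
    exact hθ.nat_lt 2
  · rcases ZFSet.mem_pair.1 hz with rfl | rfl <;> assumption

lemma pair_mem_H {θ : Cardinal.{u}} (hθ : θ.IsRegular) {x y : ZFSet.{u}} (hx : x ∈ H θ)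
    (hy : y ∈ H θ) : ZFSet.pair x y ∈ H θ := by
  have := pairSet_mem_H hθ (pairSet_mem_H hθ hx hx) (pairSet_mem_H hθ hx hy)
  rwa [ZFSet.pair_eq_singleton] at this

lemma of_pair_mem {T : Set ZFSet.{u}} (hT : TransClass T) {x y : ZFSet.{u}}
    (h : ZFSet.pair x y ∈ T) : x ∈ T ∧ y ∈ T := by
  have h1 : ({x, y} : ZFSet.{u}) ∈ T := hT _ h _ (by simp [ZFSet.pair])
  exact ⟨hT _ h1 _ (by simp), hT _ h1 _ (by simp)⟩

lemma of_pair_mem_mem {T : Set ZFSet.{u}} (hT : TransClass T) {x y f : ZFSet.{u}} (hf : f ∈ T)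
    (h : ZFSet.pair x y ∈ f) : x ∈ T ∧ y ∈ T :=
  of_pair_mem hT (hT f hf _ h)

lemma graph_mem_H {θ : Cardinal.{u}} (hθ : θ.IsRegular) {x : ZFSet.{u}}
    {f : ZFSet.{u} → ZFSet.{u}} (hx : x ∈ H θ) (hf : ∀ z ∈ x, f z ∈ H θ) : graph x f ∈ H θ := by
  refine mem_H_of_forall hθ ((card_img_le _ _).trans_lt (card_lt_of_mem_H hx)) fun p hp => ?_
  obtain ⟨z, hz, rfl⟩ := mem_graph.1 hp
  exact pair_mem_H hθ (transClass_H θ x hx z hz) (hf z hz)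

lemma img_mem_H {θ : Cardinal.{u}} (hθ : θ.IsRegular) {x : ZFSet.{u}}
    {f : ZFSet.{u} → ZFSet.{u}} (hx : x ∈ H θ) (hf : ∀ z ∈ x, f z ∈ H θ) : img f x ∈ H θ := by
  refine mem_H_of_forall hθ ((card_img_le _ _).trans_lt (card_lt_of_mem_H hx)) fun p hp => ?_
  obtain ⟨z, hz, rfl⟩ := mem_img.1 hp
  exact hf z hz

lemma sUnion_mem_H {θ : Cardinal.{u}} {x : ZFSet.{u}} (hx : x ∈ H θ) :
    (ZFSet.sUnion x) ∈ H θ := by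
  obtain ⟨t, ht, hx, hc⟩ := hx
  refine ⟨t, ht, fun z hz => ?_, hc⟩
  obtain ⟨y, hy, hz⟩ := ZFSet.mem_sUnion.1 hz
  exact ht y (hx hy) hz

lemma prod_mem_H {θ : Cardinal.{u}} (hθ : θ.IsRegular) {x y : ZFSet.{u}} (hx : x ∈ H θ)
    (hy : y ∈ H θ) : ZFSet.prod x y ∈ H θ := by
  have : ZFSet.prod x y = bUnion x fun a => img (fun b => ZFSet.pair a b) y := by
    ext p
    simp only [ZFSet.mem_prod, mem_bUnion, mem_img, eq_comm]
  rw [this]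
  exact sUnion_mem_H (img_mem_H hθ hx fun a ha => img_mem_H hθ hy fun b hb =>
    pair_mem_H hθ (transClass_H θ x hx a ha) (transClass_H θ y hy b hb))

lemma ordinal_mem_H {θ : Cardinal.{u}} {o : Ordinal.{u}} (h : o.card < θ) : o.toZFSet ∈ H θ :=
  ⟨o.toZFSet, (ZFSet.isOrdinal_toZFSet o).isTransitive, fun _ hx => hx, by
    rwa [Ordinal.card_toZFSet]⟩

lemma card_cardSet (κ : Cardinal.{u}) : (cardSet κ).card = κ := by simp [cardSet]

lemma cardSet_mem_H {κ θ : Cardinal.{u}} (h : κ < θ) : cardSet κ ∈ H θ :=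
  ordinal_mem_H (by simpa using h)

/-! ### Enumerations -/

/-- `e` enumerates `x` along `k`. -/
def Enum (k e x : ZFSet.{u}) : Prop :=
  (∀ γ, γ ∈ k → ∀ y, y ∈ x → ∀ z, z ∈ x → ZFSet.pair γ y ∈ e → ZFSet.pair γ z ∈ e → y = z) ∧
  ∀ y, y ∈ x → ∃ γ, γ ∈ k ∧ ZFSet.pair γ y ∈ e

instance Def.enum {Γ : Type (u + 1)} [Ctx Γ] (r s t : Γ → ZFSet.{u}) [IsProj r] [IsProj s]
    [IsProj t] : Def (fun _ g => Enum (r g) (s g) (t g)) := by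
  have : Def (fun _ (g : ZFSet.{u} × ZFSet.{u} × ZFSet.{u}) => Enum g.1 g.2.1 g.2.2) := by
    unfold Enum
    infer_instance
  exact this.subst₃ r s t

lemma Enum.card_le {k e x : ZFSet.{u}} (h : Enum k e x) : x.card ≤ k.card := by
  choose! f hf using h.2
  refine card_le_of_injOn (f := f) (fun z hz => (hf z hz).1) fun z hz w hw e => ?_
  exact h.1 _ (hf z hz).1 z hz w hw (hf z hz).2 (e ▸ (hf w hw).2)

lemma exists_enum {θ : Cardinal.{u}} (hθ : θ.IsRegular) {k x : ZFSet.{u}} (hk : k ∈ H θ)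
    (hx : x ∈ H θ) (h : x.card ≤ k.card) : ∃ e, e ∈ H θ ∧ Enum k e x := by
  obtain ⟨f, hf, hinj⟩ := exists_img_eq h
  refine ⟨img (fun y => ZFSet.pair (f y) y) x, img_mem_H hθ hx fun z hz =>
    pair_mem_H hθ (transClass_H θ k hk _ (hf z hz)) (transClass_H θ x hx _ hz), ?_, ?_⟩
  · intro γ _ y hy z hz h1 h2
    obtain ⟨a, _, ha⟩ := mem_img.1 h1
    obtain ⟨b, _, hb⟩ := mem_img.1 h2
    obtain ⟨ha1, rfl⟩ := ZFSet.pair_inj.1 ha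
    obtain ⟨hb1, rfl⟩ := ZFSet.pair_inj.1 hb
    exact hinj _ hy _ hz (ha1.trans hb1.symm)
  · exact fun y hy => ⟨f y, hf y hy, mem_img.2 ⟨y, hy, rfl⟩⟩

/-! ### Elementary substructures of `H θ` -/

section

variable {M : ZFSet.{u}} {T : Set ZFSet.{u}} {Γ : Type (u + 1)} [Ctx Γ]

/-- Elements definable from parameters in `M` belong to `M`. Most closure properties of elementary
substructures below are instances. -/
lemma ElemSub.mem_of_unique (h : ElemSub M T) (hT : TransClass T)
    (P : Set ZFSet.{u} → Γ → ZFSet.{u} → Prop) [Def (fun T (p : Γ × ZFSet.{u}) => P T p.1 p.2)]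
    {g : Γ} (hg : AllIn (M : Set ZFSet.{u}) g) {x : ZFSet.{u}} (hx : x ∈ T) (hP : P T g x)
    (huniq : ∀ y ∈ T, P T g y → y = x) : x ∈ M := by
  obtain ⟨y, hy, hPy⟩ := h.exists_mem hT P hg ⟨x, hx, hP⟩
  rwa [← huniq y (h.subset hy) hPy]

/-- `M` need not be transitive, but an element on which `x` and `y` differ reflects into `M`. -/
lemma ElemSub.ext (h : ElemSub M T) (hT : TransClass T) {x y : ZFSet.{u}} (hx : x ∈ M)
    (hy : y ∈ M) (hxy : ∀ z ∈ M, z ∈ x ↔ z ∈ y) : x = y := by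
  by_contra hne
  have : ∃ z, z ∈ T ∧ ((z ∈ x ∧ z ∉ y) ∨ (z ∈ y ∧ z ∉ x)) := by
    by_contra hcon
    push Not at hcon
    refine hne (ZFSet.ext fun z => ⟨fun hz => ?_, fun hz => ?_⟩)
    · exact (hcon z (hT x (h.subset hx) z hz)).1 hz
    · exact (hcon z (hT y (h.subset hy) z hz)).2 hz
  obtain ⟨z, hz, hz'⟩ := h.exists_mem hT
    (fun _ (g : ZFSet.{u} × ZFSet.{u}) z => (z ∈ g.1 ∧ z ∉ g.2) ∨ (z ∈ g.2 ∧ z ∉ g.1))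
    (g := (x, y)) (by simp [hx, hy]) this
  have := hxy z hz
  tauto

lemma ElemSub.snd_mem (h : ElemSub M T) (hT : TransClass T) {a b f : ZFSet.{u}} (hf : f ∈ M)
    (ha : a ∈ M) (hab : ZFSet.pair a b ∈ f) (huniq : ∀ c, ZFSet.pair a c ∈ f → c = b) : b ∈ M :=
  h.mem_of_unique hT (fun _ (g : ZFSet.{u} × ZFSet.{u}) b => ZFSet.pair g.1 b ∈ g.2)
    (g := (a, f)) (by simp [ha, hf]) (of_pair_mem_mem hT (h.subset hf) hab).2 hab
    fun c _ hc => huniq c hc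

lemma ElemSub.app_mem (h : ElemSub M T) (hT : TransClass T) {x y a f : ZFSet.{u}} (hf : f ∈ M)
    (hfun : ZFSet.IsFunc x y f) (hax : a ∈ x) (ha : a ∈ M) : app f a ∈ M :=
  h.snd_mem hT hf ha (app_spec hfun hax) fun c hc => ((pair_mem_iff hfun).1 hc).2

end

/-! ### Closure properties of elementary substructures, and `ZFC⁻` -/

section

variable {M : ZFSet.{u}} {θ : Cardinal.{u}} {Γ : Type (u + 1)} [Ctx Γ]

lemma ElemSub.pairSet_mem (hθ : θ.IsRegular) (h : ElemSub M (H θ)) {a b : ZFSet.{u}} (ha : a ∈ M)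
    (hb : b ∈ M) : ({a, b} : ZFSet.{u}) ∈ M :=
  h.mem_of_unique (transClass_H θ) (fun _ (g : ZFSet.{u} × ZFSet.{u}) b => b = {g.1, g.2})
    (g := (a, b)) (by simp [ha, hb]) (pairSet_mem_H hθ (h.subset ha) (h.subset hb)) rfl
    fun c _ hc => hc

lemma ElemSub.singleton_mem (hθ : θ.IsRegular) (h : ElemSub M (H θ)) {a : ZFSet.{u}} (ha : a ∈ M) :
    ({a} : ZFSet.{u}) ∈ M := by
  simpa using h.pairSet_mem hθ ha ha

lemma ElemSub.pair_mem (hθ : θ.IsRegular) (h : ElemSub M (H θ)) {a b : ZFSet.{u}} (ha : a ∈ M)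
    (hb : b ∈ M) : ZFSet.pair a b ∈ M :=
  h.mem_of_unique (transClass_H θ) (fun _ (g : ZFSet.{u} × ZFSet.{u}) b => b = ZFSet.pair g.1 g.2)
    (g := (a, b)) (by simp [ha, hb]) (pair_mem_H hθ (h.subset ha) (h.subset hb)) rfl
    fun c _ hc => hc

lemma ElemSub.sep_mem (h : ElemSub M (H θ))
    (P : Set ZFSet.{u} → Γ → ZFSet.{u} → Prop) [hP : Def (fun T (p : Γ × ZFSet.{u}) => P T p.1 p.2)]
    {g : Γ} (hg : AllIn (M : Set ZFSet.{u}) g) {a : ZFSet.{u}} (ha : a ∈ M) :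
    ZFSet.sep (fun x => P (H θ) g x) a ∈ M := by
  -- `P` is regarded as a predicate of the longer tuple of variables that is in scope where it
  -- occurs below. The similar steps in later proofs have the same purpose.
  have hD : Def (fun T (p : ((Γ × ZFSet.{u}) × ZFSet.{u}) × ZFSet.{u}) => P T p.1.1.1 p.2) :=
    hP.subst₂ (fun p : ((Γ × ZFSet.{u}) × ZFSet.{u}) × ZFSet.{u} => p.1.1.1) (fun p => p.2)
  refine h.mem_of_unique (transClass_H θ)
    (fun T (g : Γ × ZFSet.{u}) b => b ⊆ g.2 ∧ ∀ x, x ∈ g.2 → (x ∈ b ↔ P T g.1 x))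
    (g := (g, a)) (by simp [ha, hg]) (mem_H_of_subset (h.subset ha) (ZFSet.sep_subset))
    ⟨ZFSet.sep_subset, fun x hx => by simp [ZFSet.mem_sep, hx]⟩ fun c _ hc => ?_
  ext x
  rw [ZFSet.mem_sep]
  exact ⟨fun hx => ⟨hc.1 hx, (hc.2 x (hc.1 hx)).1 hx⟩, fun hx => (hc.2 x hx.1).2 hx.2⟩

lemma ElemSub.inter_mem (h : ElemSub M (H θ)) {a b : ZFSet.{u}} (ha : a ∈ M) (hb : b ∈ M) :
    a ∩ b ∈ M := by
  have := h.sep_mem (fun _ (g : ZFSet.{u}) x => x ∈ g) (g := b) (by simpa using hb) ha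
  simpa using this

lemma ElemSub.sdiff_mem (h : ElemSub M (H θ)) {a b : ZFSet.{u}} (ha : a ∈ M) (hb : b ∈ M) :
    a \ b ∈ M := by
  have := h.sep_mem (fun _ (g : ZFSet.{u}) x => x ∉ g) (g := b) (by simpa using hb) ha
  simpa using this

lemma ElemSub.graph_mem (hθ : θ.IsRegular) (h : ElemSub M (H θ))
    (P : Set ZFSet.{u} → Γ → ZFSet.{u} → ZFSet.{u} → Prop)
    [hP : Def (fun T (p : (Γ × ZFSet.{u}) × ZFSet.{u}) => P T p.1.1 p.1.2 p.2)]
    {g : Γ} (hg : AllIn (M : Set ZFSet.{u}) g) {a : ZFSet.{u}} (ha : a ∈ M) {f : ZFSet.{u} → ZFSet.{u}}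
    (hf : ∀ z ∈ a, f z ∈ H θ ∧ ∀ w ∈ H θ, P (H θ) g z w ↔ w = f z) : graph a f ∈ M := by
  have hD : Def (fun T (p : ((((Γ × ZFSet.{u}) × ZFSet.{u}) × ZFSet.{u}) × ZFSet.{u}) × ZFSet.{u}) =>
      P T p.1.1.1.1.1 p.1.2 p.2) :=
    have h1 : IsProj
      (fun p : ((((Γ × ZFSet.{u}) × ZFSet.{u}) × ZFSet.{u}) × ZFSet.{u}) × ZFSet.{u} =>
        (p.1.1.1.1.1, p.1.2)) := .prodMk _ _
    hP.subst₂ (fun p : ((((Γ × ZFSet.{u}) × ZFSet.{u}) × ZFSet.{u}) × ZFSet.{u}) × ZFSet.{u} =>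
      (p.1.1.1.1.1, p.1.2)) (fun p => p.2)
  refine h.mem_of_unique (transClass_H θ)
    (fun T (g : Γ × ZFSet.{u}) b => ∀ p, p ∈ T → (p ∈ b ↔ ∃ z, z ∈ g.2 ∧ ∃ w, w ∈ T ∧
      (P T g.1 z w ∧ p = ZFSet.pair z w)))
    (g := (g, a)) (by simp [ha, hg]) (graph_mem_H hθ (h.subset ha) fun z hz => (hf z hz).1)
    (fun p _ => ?_) fun c hc1 hc => ?_
  · rw [mem_graph]
    constructor
    · rintro ⟨z, hz, rfl⟩
      exact ⟨z, hz, f z, (hf z hz).1, ((hf z hz).2 _ (hf z hz).1).2 rfl, rfl⟩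
    · rintro ⟨z, hz, w, hw, hPw, rfl⟩
      exact ⟨z, hz, by rw [((hf z hz).2 w hw).1 hPw]⟩
  · ext p
    rw [mem_graph]
    constructor
    · intro hp
      obtain ⟨z, hz, w, hw, hPw, rfl⟩ := (hc p (transClass_H θ c hc1 p hp)).1 hp
      exact ⟨z, hz, by rw [((hf z hz).2 w hw).1 hPw]⟩
    · rintro ⟨z, hz, rfl⟩
      refine (hc _ ?_).2 ⟨z, hz, f z, (hf z hz).1, ((hf z hz).2 _ (hf z hz).1).2 rfl, rfl⟩
      exact pair_mem_H hθ (transClass_H θ a (h.subset ha) z hz) (hf z hz).1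

/-- By elementarity `M` contains an enumeration of `x` along `k`, and each element of `x` is
definable from this enumeration and its index, which lies in `k ⊆ M`. -/
lemma ElemSub.subset_of_card_le (hθ : θ.IsRegular) (h : ElemSub M (H θ)) {k x : ZFSet.{u}}
    (hk : k ∈ M) (hkM : k ⊆ M) (hx : x ∈ M) (hc : x.card ≤ k.card) : x ⊆ M := by
  obtain ⟨e, heM, he⟩ := h.exists_mem (transClass_H θ)
    (fun _ (g : ZFSet.{u} × ZFSet.{u}) e => Enum g.1 e g.2) (g := (k, x)) (by simp [hk, hx])
    (exists_enum hθ (h.subset hk) (h.subset hx) hc)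
  intro y hy
  obtain ⟨γ, hγ, hγy⟩ := he.2 y hy
  refine h.mem_of_unique (transClass_H θ)
    (fun _ (g : ZFSet.{u} × ZFSet.{u} × ZFSet.{u}) y => y ∈ g.1 ∧ ZFSet.pair g.2.1 y ∈ g.2.2)
    (g := (x, γ, e)) (by simp [hx, heM, hkM hγ]) (transClass_H θ x (h.subset hx) y hy) ⟨hy, hγy⟩ ?_
  exact fun z _ hz => he.1 γ hγ z hz.1 y hy hz.2 hγy

lemma sat_cons_iff {T : Set ZFSet.{u}} (h : ElemSub M T) {n : ℕ} (φ : setLang.Formula (Fin n))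
    (v : Fin n → {x // x ∈ M}) : Sat φ T (fun i => (v i).1) ↔ φ.Realize v := by
  obtain ⟨j, hj⟩ := id h
  rw [← j.map_formula]
  have : (j ∘ v) = fun i => ⟨(v i).1, h.subset (v i).2⟩ := funext fun i => Subtype.ext (hj _)
  rw [this]
  exact ⟨fun h => h.2, fun h' => ⟨_, h'⟩⟩

lemma val_cons {n : ℕ} (x : {x // x ∈ M}) (q : Fin n → {x // x ∈ M}) :
    (fun i => ((Fin.cons x q : Fin (n + 1) → {x // x ∈ M}) i).1) =
      (Fin.cons x.1 (fun i => (q i).1) : Fin (n + 1) → ZFSet.{u}) := by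
  funext i
  refine Fin.cases rfl (fun i => rfl) i

lemma E_iff (x y : {x // x ∈ M}) : E x y ↔ x.1 ∈ y.1 := Iff.rfl

lemma isPair_iff (hθ : θ.IsRegular) (h : ElemSub M (H θ)) (a b p : {x // x ∈ M}) :
    IsPair a b p ↔ p.1 = ZFSet.pair a.1 b.1 := by
  have h1 : ∀ z : {x // x ∈ M}, (∀ w, E w z ↔ w = a) ↔ z.1 = {a.1} := fun z => by
    constructor
    · intro hz
      refine h.ext (transClass_H θ) z.2 (h.singleton_mem hθ a.2) fun w hw => ?_
      rw [ZFSet.mem_singleton]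
      exact (hz ⟨w, hw⟩).trans Subtype.ext_iff
    · intro hz w
      rw [E_iff, hz, ZFSet.mem_singleton, Subtype.ext_iff]
  have h2 : ∀ z : {x // x ∈ M}, (∀ w, E w z ↔ w = a ∨ w = b) ↔ z.1 = {a.1, b.1} := fun z => by
    constructor
    · intro hz
      refine h.ext (transClass_H θ) z.2 (h.pairSet_mem hθ a.2 b.2) fun w hw => ?_
      rw [ZFSet.mem_pair]
      exact (hz ⟨w, hw⟩).trans (or_congr Subtype.ext_iff Subtype.ext_iff)
    · intro hz w
      rw [E_iff, hz, ZFSet.mem_pair, Subtype.ext_iff, Subtype.ext_iff]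
  unfold IsPair
  simp only [h1, h2]
  constructor
  · intro hp
    refine h.ext (transClass_H θ) p.2 (h.pair_mem hθ a.2 b.2) fun z hz => ?_
    rw [ZFSet.pair, ZFSet.mem_pair]
    exact hp ⟨z, hz⟩
  · intro hp z
    rw [E_iff, hp, ZFSet.pair, ZFSet.mem_pair]

/-- `H θ` contains a well-order of each of its elements. -/
lemma exists_wellOrder_mem_H (hθ : θ.IsRegular) {a : ZFSet.{u}} (ha : a ∈ H θ) :
    ∃ r, r ∈ H θ ∧ ((∀ x, x ∈ a → ¬ ZFSet.pair x x ∈ r) ∧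
      (∀ x, x ∈ a → ∀ y, y ∈ a → ∀ z, z ∈ a → ZFSet.pair x y ∈ r → ZFSet.pair y z ∈ r →
        ZFSet.pair x z ∈ r) ∧
      (∀ x, x ∈ a → ∀ y, y ∈ a → ¬ x = y → ZFSet.pair x y ∈ r ∨ ZFSet.pair y x ∈ r) ∧
      ∀ b, b ∈ H θ → b ⊆ a → (∃ x, x ∈ b ∧ x ∈ b) → ∃ m, m ∈ b ∧ ∀ x, x ∈ b →
        ¬ ZFSet.pair x m ∈ r) := by
  obtain ⟨f, hf, hinj⟩ := exists_img_eq (x := a) (y := cardSet a.card) (by rw [card_cardSet])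
  have hord : ∀ x ∈ a, (f x).IsOrdinal := fun x hx =>
    (ZFSet.isOrdinal_toZFSet _).mem (hf x hx)
  let r := ZFSet.sep (fun p => ∃ x y, p = ZFSet.pair x y ∧ f x ∈ f y) (ZFSet.prod a a)
  have hr : ∀ x ∈ a, ∀ y ∈ a, ZFSet.pair x y ∈ r ↔ f x ∈ f y := fun x hx y hy => by
    rw [ZFSet.mem_sep, ZFSet.pair_mem_prod]
    constructor
    · rintro ⟨_, x', y', h, h'⟩
      obtain ⟨rfl, rfl⟩ := ZFSet.pair_inj.1 h
      exact h'
    · exact fun h => ⟨⟨hx, hy⟩, x, y, rfl, h⟩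
  refine ⟨r, mem_H_of_subset (prod_mem_H hθ ha ha) ZFSet.sep_subset, fun x hx => ?_,
    fun x hx y hy z hz => ?_, fun x hx y hy hne => ?_, fun b _ hba hb => ?_⟩
  · rw [hr x hx x hx]
    exact ZFSet.mem_irrefl _
  · rw [hr x hx y hy, hr y hy z hz, hr x hx z hz]
    exact (hord z hz).mem_trans
  · rw [hr x hx y hy, hr y hy x hx]
    rcases (hord x hx).mem_trichotomous (hord y hy) with h | h | h
    · exact Or.inl h
    · exact absurd (hinj x hx y hy h) hne
    · exact Or.inr h
  · obtain ⟨x, hx, _⟩ := hb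
    obtain ⟨m, hm, hmin⟩ := (InvImage.wf f ZFSet.mem_wf).has_min {x | x ∈ b} ⟨x, hx⟩
    exact ⟨m, hm, fun x hx => by
      rw [hr x (hba hx) m (hba hm)]
      exact hmin x hx⟩

/-- For each axiom the required set is found in H(θ), using the regularity of θ, and then reflected
into `M`. The ordinals up to ω are assumed in `M` so that ω itself can witness infinity. -/
lemma ElemSub.modelsZFCMinus (hθ : θ.IsRegular) (h : ElemSub M (H θ))
    (hω : ∀ o ≤ Ordinal.omega0.{u}, o.toZFSet ∈ M) : ModelsZFCMinus {x // x ∈ M} where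
  extensionality x y hxy := Subtype.ext <|
    h.ext (transClass_H θ) x.2 y.2 fun z hz => hxy ⟨z, hz⟩
  foundation x := by
    rintro ⟨y, hy⟩
    have : ∃ y, y ∈ H θ ∧ (y ∈ x.1 ∧ ∀ z, z ∈ y → ¬ z ∈ x.1) := by
      obtain ⟨m, hm, hmin⟩ := ZFSet.mem_wf.has_min {z | z ∈ x.1} ⟨y.1, hy⟩
      exact ⟨m, transClass_H θ _ (h.subset x.2) _ hm, hm, fun z hz hzx => hmin z hzx hz⟩
    obtain ⟨m, hm, hm1, hm2⟩ := h.exists_mem (transClass_H θ)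
      (fun _ (x : ZFSet.{u}) y => y ∈ x ∧ ∀ z, z ∈ y → ¬ z ∈ x) (g := x.1) (by simp) this
    exact ⟨⟨m, hm⟩, hm1, fun z hz => hm2 z.1 hz⟩
  pairing a b := ⟨⟨_, h.pairSet_mem hθ a.2 b.2⟩, fun z => by
    rw [E_iff, ZFSet.mem_pair, Subtype.ext_iff, Subtype.ext_iff]⟩
  union a := by
    have hU : ZFSet.sUnion a.1 ∈ M := by
      refine h.mem_of_unique (transClass_H θ) (fun _ (a : ZFSet.{u}) b =>
        (∀ x, x ∈ b → ∃ y, y ∈ a ∧ x ∈ y) ∧ ∀ y, y ∈ a → ∀ x, x ∈ y → x ∈ b)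
        (g := a.1) (by simp) (sUnion_mem_H (h.subset a.2)) ⟨fun x hx => ZFSet.mem_sUnion.1 hx,
          fun y hy x hx => ZFSet.mem_sUnion.2 ⟨y, hy, hx⟩⟩ fun c _ hc => ?_
      ext x
      rw [ZFSet.mem_sUnion]
      exact ⟨hc.1 x, fun ⟨y, hy, hx⟩ => hc.2 y hy x hx⟩
    refine ⟨⟨_, hU⟩, fun z => ?_⟩
    rw [E_iff, ZFSet.mem_sUnion]
    constructor
    · intro hz
      have : ∃ y, y ∈ H θ ∧ (y ∈ a.1 ∧ z.1 ∈ y) := by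
        obtain ⟨y, hy, hzy⟩ := hz
        exact ⟨y, transClass_H θ _ (h.subset a.2) _ hy, hy, hzy⟩
      obtain ⟨y, hy, hy'⟩ := h.exists_mem (transClass_H θ)
        (fun _ (g : ZFSet.{u} × ZFSet.{u}) y => y ∈ g.1 ∧ g.2 ∈ y) (g := (a.1, z.1)) (by simp) this
      exact ⟨⟨y, hy⟩, hy'⟩
    · rintro ⟨y, hy⟩
      exact ⟨y.1, hy⟩
  infinity := by
    refine ⟨⟨_, hω _ le_rfl⟩, ⟨⟨_, hω 0 (zero_le)⟩, ?_, fun z => ?_⟩, fun y hy => ?_⟩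
    · rw [E_iff]
      exact Ordinal.toZFSet_mem_toZFSet_iff.2 Ordinal.omega0_pos
    · change ¬ z.1 ∈ Ordinal.toZFSet 0
      simp
    · obtain ⟨o, ho, hoy⟩ := Ordinal.mem_toZFSet_iff.1 hy
      have ho' := (Ordinal.isSuccLimit_omega0).add_one_lt ho
      refine ⟨⟨_, hω (o + 1) ho'.le⟩, Ordinal.toZFSet_mem_toZFSet_iff.2 ho', fun z => ?_⟩
      change z.1 ∈ Ordinal.toZFSet (o + 1) ↔ z.1 ∈ y.1 ∨ z = y
      have hoy' : o.toZFSet = y.1 := hoy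
      rw [Ordinal.toZFSet_add_one, ZFSet.mem_insert_iff, hoy', Subtype.ext_iff]
      exact or_comm
  separation n φ q a := by
    have hM := h.sep_mem (fun T (q : Fin n → ZFSet.{u}) x => Sat φ T (Fin.cons x q))
      (g := fun i => (q i).1) (by simp) a.2
    refine ⟨⟨_, hM⟩, fun x => ?_⟩
    rw [E_iff, ZFSet.mem_sep, E_iff, ← sat_cons_iff h, val_cons]
  collection n φ q a hex := by
    -- The hypothesis only concerns those elements of `a` that lie in `M`; an element of `a` without
    -- a witness in H(θ) would reflect to one in `M`.
    have key : ∀ x, x ∈ a.1 → ∃ y, y ∈ H θ ∧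
        Sat φ (H θ) (Fin.cons x (Fin.cons y fun i => (q i).1 : Fin (n + 1) → ZFSet.{u})) := by
      by_contra hcon
      push Not at hcon
      obtain ⟨x, hx, hno⟩ := hcon
      obtain ⟨x, hxM, hx, hno⟩ := h.exists_mem (transClass_H θ)
        (fun T (g : ZFSet.{u} × (Fin n → ZFSet.{u})) x => x ∈ g.1 ∧ ∀ y, y ∈ T →
          ¬ Sat φ T (Fin.cons x (Fin.cons y g.2 : Fin (n + 1) → ZFSet.{u})))
        (g := (a.1, fun i => (q i).1)) (by simp)
        ⟨x, transClass_H θ _ (h.subset a.2) _ hx, hx, hno⟩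
      obtain ⟨y, hy⟩ := hex ⟨x, hxM⟩ hx
      refine hno y.1 (h.subset y.2) ?_
      rw [← sat_cons_iff h, val_cons, val_cons] at hy
      exact hy
    choose! f hf using key
    obtain ⟨c, hcM, hc⟩ := h.exists_mem (transClass_H θ)
      (fun T (g : ZFSet.{u} × (Fin n → ZFSet.{u})) c => ∀ x, x ∈ g.1 → ∃ y, y ∈ c ∧
        Sat φ T (Fin.cons x (Fin.cons y g.2 : Fin (n + 1) → ZFSet.{u})))
      (g := (a.1, fun i => (q i).1)) (by simp)
      ⟨img f a.1, img_mem_H hθ (h.subset a.2) fun z hz => (hf z hz).1,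
        fun x hx => ⟨f x, mem_img.2 ⟨x, hx, rfl⟩, (hf x hx).2⟩⟩
    refine ⟨⟨c, hcM⟩, fun x hx => ?_⟩
    have : ∃ y, y ∈ H θ ∧ (y ∈ c ∧
        Sat φ (H θ) (Fin.cons x.1 (Fin.cons y fun i => (q i).1 : Fin (n + 1) → ZFSet.{u}))) := by
      obtain ⟨y, hy, hy'⟩ := hc x.1 hx
      exact ⟨y, transClass_H θ _ (h.subset hcM) _ hy, hy, hy'⟩
    obtain ⟨y, hyM, hy, hy'⟩ := h.exists_mem (transClass_H θ)
      (fun T (g : (ZFSet.{u} × ZFSet.{u}) × (Fin n → ZFSet.{u})) y => y ∈ g.1.1 ∧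
        Sat φ T (Fin.cons g.1.2 (Fin.cons y g.2 : Fin (n + 1) → ZFSet.{u})))
      (g := ((c, x.1), fun i => (q i).1)) (by simp [hcM]) this
    refine ⟨⟨y, hyM⟩, hy, ?_⟩
    rw [← sat_cons_iff h, val_cons, val_cons]
    exact hy'
  wellOrdering a := by
    obtain ⟨r, hrM, hr1, hr2, hr3, hr4⟩ := h.exists_mem (transClass_H θ)
      (fun T (a : ZFSet.{u}) r => (∀ x, x ∈ a → ¬ ZFSet.pair x x ∈ r) ∧
        (∀ x, x ∈ a → ∀ y, y ∈ a → ∀ z, z ∈ a → ZFSet.pair x y ∈ r → ZFSet.pair y z ∈ r →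
          ZFSet.pair x z ∈ r) ∧
        (∀ x, x ∈ a → ∀ y, y ∈ a → ¬ x = y → ZFSet.pair x y ∈ r ∨ ZFSet.pair y x ∈ r) ∧
        -- The repeated `x ∈ b` expresses nonemptiness in the form of a bounded quantifier, which is
        -- visibly definable.
        ∀ b, b ∈ T → b ⊆ a → (∃ x, x ∈ b ∧ x ∈ b) → ∃ m, m ∈ b ∧ ∀ x, x ∈ b →
          ¬ ZFSet.pair x m ∈ r) (g := a.1) (by simp)
      (exists_wellOrder_mem_H hθ (h.subset a.2))
    have hpair : ∀ x y : {x // x ∈ M},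
        (∃ p, IsPair x y p ∧ E p ⟨r, hrM⟩) ↔ ZFSet.pair x.1 y.1 ∈ r := fun x y => by
      constructor
      · rintro ⟨p, hp, hpr⟩
        rw [isPair_iff hθ h] at hp
        rwa [← hp]
      · exact fun hp => ⟨⟨_, h.pair_mem hθ x.2 y.2⟩, (isPair_iff hθ h _ _ _).2 rfl, hp⟩
    refine ⟨⟨r, hrM⟩, ?_⟩
    simp only [hpair]
    refine ⟨fun x hx => hr1 _ hx, fun x y z hx hy hz => hr2 _ hx _ hy _ hz,
      fun x y hx hy hne => hr3 _ hx _ hy fun h => hne (Subtype.ext h), fun b hb hba => ?_⟩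
    -- In `M` the inclusion is only known for elements of `M`; an element of the difference would
    -- reflect.
    have hba' : b.1 ⊆ a.1 := by
      by_contra hcon
      rw [ZFSet.subset_def] at hcon
      push Not at hcon
      obtain ⟨z, hz1, hz2⟩ := hcon
      obtain ⟨z, hzM, hz1, hz2⟩ := h.exists_mem (transClass_H θ)
        (fun _ (g : ZFSet.{u} × ZFSet.{u}) z => z ∈ g.1 ∧ ¬ z ∈ g.2) (g := (b.1, a.1)) (by simp)
        ⟨z, transClass_H θ _ (h.subset b.2) _ hz1, hz1, hz2⟩
      exact hz2 (hba ⟨z, hzM⟩ hz1)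
    obtain ⟨x, hx⟩ := hb
    have : ∃ m, m ∈ H θ ∧ (m ∈ b.1 ∧ ∀ x, x ∈ b.1 → ¬ ZFSet.pair x m ∈ r) := by
      obtain ⟨m, hm, hm'⟩ := hr4 b.1 (h.subset b.2) hba' ⟨x.1, hx, hx⟩
      exact ⟨m, transClass_H θ _ (h.subset b.2) _ hm, hm, hm'⟩
    obtain ⟨m, hmM, hm, hm'⟩ := h.exists_mem (transClass_H θ)
      (fun _ (g : ZFSet.{u} × ZFSet.{u}) m => m ∈ g.1 ∧ ∀ x, x ∈ g.1 → ¬ ZFSet.pair x m ∈ g.2)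
      (g := (b.1, r)) (by simp [hrM]) this
    exact ⟨⟨m, hmM⟩, hm, fun x hx => hm' x.1 hx⟩

end

/-! ### Filter sequences inside a structure -/

/-- The conditions on the members of a filter sequence for the structure `(h, f)`. -/
def GoodModel (T : Set ZFSet.{u}) (k h f m : ZFSet.{u}) : Prop :=
  m ⊆ h ∧ (∃ e, e ∈ T ∧ Enum k e m) ∧ k ⊆ m ∧ k ∈ m ∧
  (∀ x, x ∈ m → ∀ y, y ∈ h → ZFSet.pair x y ∈ f → y ∈ m) ∧
  ∀ s, s ∈ T → s ⊆ m → (∃ β, β ∈ k ∧ ∃ e, e ∈ T ∧ Enum β e s) → s ∈ m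

instance Def.goodModel : Def (fun T (g : ZFSet.{u} × ZFSet.{u} × ZFSet.{u} × ZFSet.{u}) =>
    GoodModel T g.1 g.2.1 g.2.2.1 g.2.2.2) := by
  unfold GoodModel
  infer_instance

instance Def.goodModel' {Γ : Type (u + 1)} [Ctx Γ] (q r s t : Γ → ZFSet.{u}) [IsProj q] [IsProj r]
    [IsProj s] [IsProj t] : Def (fun T g => GoodModel T (q g) (r g) (s g) (t g)) :=
  have := IsProj.prodMk s t
  Def.goodModel.subst₃ q r (fun g => (s g, t g))

/-- `F` contains the set of `β ∈ k` with `g β ∈ g' β`. -/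
def UMem (k F g g' : ZFSet.{u}) : Prop :=
  ∃ Z, Z ∈ F ∧ ∀ β, β ∈ k →
    (β ∈ Z ↔ ∃ a b, ZFSet.pair β a ∈ g ∧ ZFSet.pair β b ∈ g' ∧ a ∈ b)

instance Def.uMem {Γ : Type (u + 1)} [Ctx Γ] (q r s t : Γ → ZFSet.{u}) [IsProj q] [IsProj r]
    [IsProj s] [IsProj t] : Def (fun _ g => UMem (q g) (r g) (s g) (t g)) := by
  have : Def (fun _ (g : ZFSet.{u} × ZFSet.{u} × ZFSet.{u} × ZFSet.{u}) =>
      UMem g.1 g.2.1 g.2.2.1 g.2.2.2) := by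
    refine Def.congr (P := fun T g => ∃ Z, Z ∈ g.2.1 ∧ ∀ β, β ∈ g.1 →
      (β ∈ Z ↔ ∃ a, a ∈ T ∧ ∃ b, b ∈ T ∧ (ZFSet.pair β a ∈ g.2.2.1 ∧ ZFSet.pair β b ∈ g.2.2.2 ∧
        a ∈ b))) inferInstance fun T hT g hg => ?_
    unfold UMem
    simp only [allIn_prod, allIn_set] at hg
    have : ∀ β, (∃ a, a ∈ T ∧ ∃ b, b ∈ T ∧ (ZFSet.pair β a ∈ g.2.2.1 ∧ ZFSet.pair β b ∈ g.2.2.2 ∧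
        a ∈ b)) ↔ ∃ a b, ZFSet.pair β a ∈ g.2.2.1 ∧ ZFSet.pair β b ∈ g.2.2.2 ∧ a ∈ b := fun β => by
      constructor
      · rintro ⟨a, _, b, _, h⟩
        exact ⟨a, b, h⟩
      · rintro ⟨a, b, h1, h2, h3⟩
        exact ⟨a, (of_pair_mem_mem hT hg.2.2.1 h1).2, b, (of_pair_mem_mem hT hg.2.2.2 h2).2,
          h1, h2, h3⟩
    simp only [this]
  have h2 := IsProj.prodMk s t
  exact this.subst₃ q r (fun g => (s g, t g))

/-- The conditions on the filter of a filter sequence that concern the element `m` of the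
sequence. -/
def GoodMeasure (k F m : ZFSet.{u}) : Prop :=
  (∀ A, A ∈ m → A ⊆ k → A ∈ F ∨ ∃ B, B ∈ F ∧ ∀ β, β ∈ k → (β ∈ B ↔ ¬ β ∈ A)) ∧
  ∀ X, X ∈ m → ZFSet.IsFunc k F X → ∃ D, D ∈ F ∧ ∀ β, β ∈ k →
    (β ∈ D ↔ ∀ γ, γ ∈ β → ∃ A, A ∈ F ∧ (ZFSet.pair γ A ∈ X ∧ β ∈ A))

instance Def.goodMeasure {Γ : Type (u + 1)} [Ctx Γ] (r s t : Γ → ZFSet.{u}) [IsProj r]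
    [IsProj s] [IsProj t] : Def (fun _ g => GoodMeasure (r g) (s g) (t g)) := by
  have : Def (fun _ (g : ZFSet.{u} × ZFSet.{u} × ZFSet.{u}) => GoodMeasure g.1 g.2.1 g.2.2) := by
    unfold GoodMeasure
    infer_instance
  exact this.subst₃ r s t

/-- The ultrapower of the union of the sequence `W` by `F` is well-founded. -/
def GoodWF (T : Set ZFSet.{u}) (a k h W F : ZFSet.{u}) : Prop :=
  ∀ B, B ∈ T → (∀ g, g ∈ B → ∃ i, i ∈ a ∧ ∃ m, m ∈ h ∧ (ZFSet.pair i m ∈ W ∧ g ∈ m ∧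
    ∃ y, y ∈ T ∧ ZFSet.IsFunc k y g)) →
    (∃ g, g ∈ B ∧ g ∈ B) → ∃ g, g ∈ B ∧ ∀ g', g' ∈ B → ¬ UMem k F g' g

/-- `W` and `F` are a filter sequence of length `a` for the structure `(h, f)`. -/
def GoodSeq (T : Set ZFSet.{u}) (a k h f W F : ZFSet.{u}) : Prop :=
  (ZFSet.IsFunc a h W ∧ ∀ i, i ∈ a → ∀ m, m ∈ h → ZFSet.pair i m ∈ W → GoodModel T k h f m) ∧
  (∀ i, i ∈ a → ∀ j, j ∈ i → ∀ m, m ∈ h → ∀ m', m' ∈ h → ZFSet.pair j m' ∈ W →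
    ZFSet.pair i m ∈ W → m' ∈ m ∧ m' ⊆ m ∧
    ∃ z, z ∈ m ∧ ((∀ x, x ∈ z → x ∈ F ∧ x ∈ m') ∧ ∀ x, x ∈ m' → x ∈ F → x ∈ z)) ∧
  (∀ A, A ∈ F → A ⊆ k ∧ ∀ γ, γ ∈ k → ∃ β, β ∈ A ∧ γ ∈ β) ∧
  (∀ A, A ∈ F → ∀ B, B ∈ F → ∃ C, C ∈ F ∧ (C ⊆ A ∧ C ⊆ B)) ∧
  (∀ i, i ∈ a → ∀ m, m ∈ h → ZFSet.pair i m ∈ W → GoodMeasure k F m) ∧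
  GoodWF T a k h W F

instance Def.goodWF : Def (fun T (g : (ZFSet.{u} × ZFSet.{u} × ZFSet.{u} × ZFSet.{u}) ×
    ZFSet.{u} × ZFSet.{u}) => GoodWF T g.1.1 g.1.2.1 g.1.2.2.1 g.2.1 g.2.2) := by
  unfold GoodWF
  infer_instance

instance Def.goodSeq : Def (fun T (g : (ZFSet.{u} × ZFSet.{u} × ZFSet.{u} × ZFSet.{u}) ×
    ZFSet.{u} × ZFSet.{u}) => GoodSeq T g.1.1 g.1.2.1 g.1.2.2.1 g.1.2.2.2 g.2.1 g.2.2) := by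
  have h6 := Def.goodWF.{u}
  unfold GoodSeq
  infer_instance

/-- `h` contains all of its subsets of cardinality at most `k`. -/
def SubClosed (T : Set ZFSet.{u}) (k h : ZFSet.{u}) : Prop :=
  ∀ x, x ∈ T → x ⊆ h → (∃ e, e ∈ T ∧ Enum k e x) → x ∈ h

/-- The structure `(h, f)` has no filter sequence. -/
def Bad (T : Set ZFSet.{u}) (a k h f : ZFSet.{u}) : Prop :=
  SubClosed T k h ∧ ZFSet.IsFunc h h f ∧
    ¬ ∃ W, W ∈ T ∧ ∃ F, F ∈ T ∧ GoodSeq T a k h f W F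

instance Def.bad : Def (fun T (g : ZFSet.{u} × ZFSet.{u} × ZFSet.{u} × ZFSet.{u}) =>
    Bad T g.1 g.2.1 g.2.2.1 g.2.2.2) := by
  have h1 : Def (fun T (g : ZFSet.{u} × ZFSet.{u} × ZFSet.{u} × ZFSet.{u}) =>
      ∃ d : ZFSet.{u} × ZFSet.{u}, AllIn T d ∧
        GoodSeq T g.1 g.2.1 g.2.2.1 g.2.2.2 d.1 d.2) := Def.exTuple _
  have h2 : Def (fun T (g : ZFSet.{u} × ZFSet.{u} × ZFSet.{u} × ZFSet.{u}) =>
      ∃ W, W ∈ T ∧ ∃ F, F ∈ T ∧ GoodSeq T g.1 g.2.1 g.2.2.1 g.2.2.2 W F) :=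
    h1.congr fun T _ g _ => by
      constructor
      · rintro ⟨⟨W, F⟩, h, h'⟩
        rw [allIn_prod, allIn_set, allIn_set] at h
        exact ⟨W, h.1, F, h.2, h'⟩
      · rintro ⟨W, hW, F, hF, h'⟩
        exact ⟨(W, F), by simp [hW, hF], h'⟩
  unfold Bad SubClosed
  infer_instance

/-- Every structure in `H θ` has a filter sequence. -/
def AllGood (α κ θ : Cardinal.{u}) : Prop :=
  ∀ h, h ∈ H θ → ∀ f, f ∈ H θ → ¬ Bad (H θ) (cardSet α) (cardSet κ) h f

/-- The existence of a bad pair is a first-order statement over H(θ) about α and κ, so it reflects.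
Proofs of `AllGood` thus need to treat only the pairs in a given `M`. -/
lemma ElemSub.exists_bad {M : ZFSet.{u}} {α κ θ : Cardinal.{u}} (h : ElemSub M (H θ))
    (hα : cardSet α ∈ M) (hκ : cardSet κ ∈ M) (hbad : ¬ AllGood α κ θ) :
    ∃ hh ∈ M, ∃ f ∈ M, Bad (H θ) (cardSet α) (cardSet κ) hh f := by
  unfold AllGood at hbad
  push Not at hbad
  obtain ⟨hh, hhH, f, hf, hb⟩ := hbad
  have hD : Def (fun T (p : (ZFSet.{u} × ZFSet.{u}) × (ZFSet.{u} × ZFSet.{u})) =>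
      Bad T p.1.1 p.1.2 p.2.1 p.2.2) := by
    have := IsProj.prodMk (fun p : (ZFSet.{u} × ZFSet.{u}) × (ZFSet.{u} × ZFSet.{u}) => p.2.1)
      (fun p => p.2.2)
    exact Def.bad.subst₃
      (fun p : (ZFSet.{u} × ZFSet.{u}) × (ZFSet.{u} × ZFSet.{u}) => p.1.1) (fun p => p.1.2)
      (fun p => (p.2.1, p.2.2))
  obtain ⟨d, hd, hd'⟩ := h.exists_mem_tuple (transClass_H θ)
    (fun T (g : ZFSet.{u} × ZFSet.{u}) (d : ZFSet.{u} × ZFSet.{u}) => Bad T g.1 g.2 d.1 d.2)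
    (g := (cardSet α, cardSet κ)) (by simp [hα, hκ]) ⟨(hh, f), by simp [hhH, hf], hb⟩
  simp only [allIn_prod, allIn_set, SetLike.mem_coe] at hd
  exact ⟨d.1, hd.1, d.2, hd.2, hd'⟩

/-! ### The Tarski–Vaught test and unions of chains -/

/-- The Tarski–Vaught criterion, with the witness as the first variable of the formula. -/
lemma elemSub_of_exists {M : ZFSet.{u}} {T : Set ZFSet.{u}} (hMT : ∀ x ∈ M, x ∈ T)
    (htv : ∀ (n : ℕ) (φ : setLang.Formula (Fin (n + 1))) (v : Fin n → ZFSet.{u}),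
      (∀ i, v i ∈ M) → (∃ x, x ∈ T ∧ Sat φ T (Fin.cons x v)) →
        ∃ x, x ∈ M ∧ Sat φ T (Fin.cons x v)) : ElemSub M T := by
  let f : {x // x ∈ M} ↪[setLang] {x // x ∈ T} :=
    { toFun := fun x => ⟨x.1, hMT x.1 x.2⟩
      inj' := fun x y h => Subtype.ext (congrArg (fun z : {x // x ∈ T} => z.1) h)
      map_fun' := fun g => Empty.elim g
      map_rel' := fun r v => by
        cases r
        exact Iff.rfl }
  refine ⟨f.toElementaryEmbedding fun n φ x a ha => ?_, fun x => rfl⟩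
  -- The last bound variable of `φ` becomes variable `0` and the others are shifted up, which
  -- replaces `Fin.snoc` by `Fin.cons`.
  let ψ : setLang.Formula (Fin (n + 1)) := φ.toFormula.relabel
    (Sum.elim Empty.elim (Fin.snoc (α := fun _ => Fin (n + 1)) Fin.succ 0))
  have key : ∀ b : {x // x ∈ T}, ψ.Realize (Fin.cons b (f ∘ x) : Fin (n + 1) → {x // x ∈ T}) ↔
      φ.Realize default (Fin.snoc (f ∘ x) b : _ → {x // x ∈ T}) := fun b => by
    rw [Language.Formula.realize_relabel, Language.BoundedFormula.realize_toFormula]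
    have h1 : ((Fin.cons b (f ∘ x) : Fin (n + 1) → {x // x ∈ T}) ∘
        (Sum.elim Empty.elim (Fin.snoc (α := fun _ => Fin (n + 1)) Fin.succ 0))) ∘ Sum.inr =
        (Fin.snoc (f ∘ x) b : _ → {x // x ∈ T}) := by
      funext i
      refine Fin.lastCases ?_ (fun i => ?_) i
      · simp
      · simp
    rw [h1]
    exact iff_of_eq (congrArg₂ _ (funext fun e => Empty.elim e) rfl)
  have hval : ∀ b : {x // x ∈ T}, (fun i => ((Fin.cons b (f ∘ x) :
      Fin (n + 1) → {x // x ∈ T}) i).1) = Fin.cons b.1 fun i => (x i).1 := fun b => by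
    funext i
    exact Fin.cases rfl (fun i => rfl) i
  have hsat : ∀ b : {x // x ∈ T}, Sat ψ T (Fin.cons b.1 fun i => (x i).1) ↔
      φ.Realize default (Fin.snoc (f ∘ x) b : _ → {x // x ∈ T}) := fun b => by
    rw [← key, ← hval]
    exact ⟨fun h => h.2, fun h => ⟨fun i => Subtype.prop _, h⟩⟩
  obtain ⟨b, hb, hb'⟩ := htv n ψ (fun i => (x i).1) (fun i => (x i).2) ⟨a.1, a.2, (hsat a).2 ha⟩
  exact ⟨⟨b, hb⟩, (hsat ⟨b, hMT b hb⟩).1 hb'⟩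

@[simp] lemma mem_seqUnion {α : Ordinal.{u}} {M : Ordinal.{u} → ZFSet.{u}} {x : ZFSet.{u}} :
    x ∈ seqUnion α M ↔ ∃ i < α, x ∈ M i := by
  simp [seqUnion]

section

variable {α : Ordinal.{u}} {M : Ordinal.{u} → ZFSet.{u}} {T : Set ZFSet.{u}}

lemma subset_of_le (hsub : ∀ i j, i < j → j < α → M i ⊆ M j) {i j : Ordinal.{u}} (hij : i ≤ j)
    (hj : j < α) : M i ⊆ M j := by
  rcases hij.eq_or_lt with rfl | h
  · exact fun _ hx => hx
  · exact hsub i j h hj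

lemma exists_forall_mem (hα : 0 < α) (hsub : ∀ i j, i < j → j < α → M i ⊆ M j) {n : ℕ}
    (v : Fin n → ZFSet.{u}) (hv : ∀ i, v i ∈ seqUnion α M) : ∃ j < α, ∀ i, v i ∈ M j := by
  simp only [mem_seqUnion] at hv
  choose s hs hv using hv
  rcases Nat.eq_zero_or_pos n with rfl | hn
  · exact ⟨0, hα, fun i => i.elim0⟩
  · have : Nonempty (Fin n) := ⟨⟨0, hn⟩⟩
    obtain ⟨i, hi⟩ := Finite.exists_max s
    exact ⟨s i, hs i, fun j => subset_of_le hsub (hi j) (hs i) (hv j)⟩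

/-- Finitely many parameters already lie in one member of the chain, and the witness can be taken
there. -/
lemma elemSub_seqUnion (hT : TransClass T) (hα : 0 < α)
    (hsub : ∀ i j, i < j → j < α → M i ⊆ M j)
    (h : ∀ i < α, ElemSub (M i) T) : ElemSub (seqUnion α M) T := by
  refine elemSub_of_exists (fun x hx => ?_) fun n φ v hv hex => ?_
  · obtain ⟨i, hi, hx⟩ := mem_seqUnion.1 hx
    exact (h i hi).subset hx
  · obtain ⟨j, hj, hv⟩ := exists_forall_mem hα hsub v hv
    obtain ⟨x, hx, hx'⟩ := (h j hj).exists_mem hT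
      (fun T (v : Fin n → ZFSet.{u}) x => Sat φ T (Fin.cons x v)) (g := v) (by simpa using hv) hex
    exact ⟨x, mem_seqUnion.2 ⟨j, hj, hx⟩, hx'⟩

end

/-! ### Closure under sequences and under small subsets -/

/-- A small subset is the range of a short sequence; the sequence belongs to `M` by closure, and its
range is definable from it. -/
lemma ClosedUnderLT.mem_of_subset {M : ZFSet.{u}} {θ γ : Cardinal.{u}} (h : ElemSub M (H θ))
    (hθ : θ.IsRegular) (hγ : 0 < γ) (hc : ClosedUnderLT M γ.ord) {s : ZFSet.{u}} (hs : s ⊆ M)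
    (hcard : s.card < γ) : s ∈ M := by
  classical
  rcases ZFSet.eq_empty_or_nonempty s with rfl | ⟨x₀, hx₀⟩
  · refine hc 0 (by simpa using Cardinal.ord_pos.2 hγ) ∅ ⟨ZFSet.empty_subset _, fun z hz => ?_⟩
    simp at hz
  have hx₀ : x₀ ∈ s := hx₀
  obtain ⟨f, hf, hinj⟩ := exists_img_eq (x := s) (y := cardSet s.card) (by rw [card_cardSet])
  let g : ZFSet.{u} → ZFSet.{u} := fun γ => if h : ∃ x ∈ s, f x = γ then h.choose else x₀
  have hgs : ∀ γ, g γ ∈ s := fun γ => by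
    by_cases h : ∃ x ∈ s, f x = γ
    · simp only [g, dif_pos h]
      exact h.choose_spec.1
    · simp only [g, dif_neg h]
      exact hx₀
  have hgf : ∀ x ∈ s, g (f x) = x := fun x hx => by
    have h : ∃ y ∈ s, f y = f x := ⟨x, hx, rfl⟩
    simp only [g, dif_pos h]
    exact hinj _ h.choose_spec.1 _ hx h.choose_spec.2
  have hG : graph (cardSet s.card) g ∈ M :=
    hc s.card.ord (Cardinal.ord_lt_ord.2 hcard) _ (isFunc_graph fun z _ => hs (hgs z))
  have hGH := h.subset hG
  have hmem : ∀ x, x ∈ s ↔ ∃ p ∈ graph (cardSet s.card) g, ∃ b, b ∈ H θ ∧ p = ZFSet.pair b x := by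
    intro x
    constructor
    · intro hx
      have hp : ZFSet.pair (f x) x ∈ graph (cardSet s.card) g := by
        rw [pair_mem_graph]
        exact ⟨hf x hx, (hgf x hx).symm⟩
      exact ⟨_, hp, f x, (of_pair_mem_mem (transClass_H θ) hGH hp).1, rfl⟩
    · rintro ⟨p, hp, b, _, rfl⟩
      rw [(pair_mem_graph.1 hp).2]
      exact hgs b
  have hsH : ∀ x ∈ s, x ∈ H θ := fun x hx => h.subset (hs hx)
  -- No relation between `γ` and θ is assumed; the bound comes from the sequence, which is an
  -- element of H(θ).
  have hsc : s.card < θ := by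
    refine lt_of_le_of_lt ?_ (card_lt_of_mem_H hGH)
    refine card_le_of_injOn (f := fun x => ZFSet.pair (f x) x) (fun x hx => ?_)
      fun x _ y _ hxy => (ZFSet.pair_inj.1 hxy).2
    rw [pair_mem_graph]
    exact ⟨hf x hx, (hgf x hx).symm⟩
  refine h.mem_of_unique (transClass_H θ) (fun T (G : ZFSet.{u}) s => ∀ x, x ∈ T →
    (x ∈ s ↔ ∃ p, p ∈ G ∧ ∃ b, b ∈ T ∧ p = ZFSet.pair b x)) (g := graph (cardSet s.card) g)
    (by simpa using hG) (mem_H_of_forall hθ hsc hsH) (fun x _ => hmem x) fun c hc1 hc2 => ?_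
  ext x
  constructor
  · intro hx
    exact (hmem x).2 ((hc2 x (transClass_H θ c hc1 x hx)).1 hx)
  · intro hx
    exact (hc2 x (hsH x hx)).2 ((hmem x).1 hx)

/-! ### Normal filters -/

section

variable {κ θ : Cardinal.{u}} {U F : ZFSet.{u}}

lemma IsFilter.card_inter (hF : IsFilter κ F) {A B : ZFSet.{u}} (hA : A ∈ F) (hB : B ∈ F) :
    (A ∩ B).card = κ := by
  classical
  have := hF.2 {A, B} (by simp [hA, hB])
  rw [← this]
  congr 1
  ext x
  simp only [ZFSet.mem_inter, ZFSet.mem_sep, Finset.mem_insert, Finset.mem_singleton,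
    forall_eq_or_imp, forall_eq]
  exact ⟨fun h => ⟨hF.1 A hA h.1, h⟩, fun h => h.2⟩

lemma IsFilter.inter_nonempty (hκ : κ ≠ 0) (hF : IsFilter κ F) {A B : ZFSet.{u}} (hA : A ∈ F)
    (hB : B ∈ F) : ∃ x, x ∈ A ∧ x ∈ B := by
  by_contra hcon
  push Not at hcon
  have h := hF.card_inter hA hB
  have : A ∩ B = ∅ := by
    ext x
    simpa using hcon x
  rw [this, ZFSet.card_empty] at h
  exact hκ h.symm

lemma IsFilter.unbounded (hκ : κ.IsRegular) (hF : IsFilter κ F) {A γ : ZFSet.{u}} (hA : A ∈ F)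
    (hγ : γ ∈ cardSet κ) : ∃ β, β ∈ A ∧ γ ∈ β := by
  by_contra hcon
  push Not at hcon
  have h := hF.card_inter hA hA
  have hγo := (ZFSet.isOrdinal_toZFSet κ.ord).mem hγ
  have hsub : A ∩ A ⊆ insert γ γ := fun β hβ => by
    rw [ZFSet.mem_inter] at hβ
    have hβo := (ZFSet.isOrdinal_toZFSet κ.ord).mem (hF.1 A hA hβ.1)
    rcases hγo.mem_trichotomous hβo with h | h | h
    · exact absurd h (hcon β hβ.1)
    · simp [h]
    · simp [h]
  have hlt : γ.card < κ := by
    obtain ⟨o, ho, rfl⟩ := Ordinal.mem_toZFSet_iff.1 hγ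
    rw [Ordinal.card_toZFSet]
    exact Cardinal.lt_ord.1 ho
  have := (ZFSet.card_mono hsub).trans ZFSet.card_insert_le
  rw [h] at this
  exact absurd this (not_le.2 (Cardinal.add_lt_of_lt hκ.aleph0_le hlt
    (one_lt_aleph0.trans_le hκ.aleph0_le)))

/-- Upward closure is not part of the definition of a filter. It holds for sets in `U`, since
otherwise the complement of `B` would be in `F` and disjoint from `A`. -/
lemma IsNormalFilter.superset (hκ : κ ≠ 0) (hF : IsNormalFilter κ U F) {A B : ZFSet.{u}}
    (hA : A ∈ F) (hB : B ∈ U) (hBk : B ⊆ cardSet κ) (hAB : A ⊆ B) : B ∈ F := by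
  rcases hF.measures B hB hBk with h | h
  · exact h
  · obtain ⟨x, hx, hx'⟩ := hF.filter.inter_nonempty hκ hA h
    exact absurd (hAB hx) (ZFSet.mem_sdiff.1 hx').2

lemma IsNormalFilter.inter_mem (hκ : κ.IsRegular) (h : ElemSub U (H θ)) (hF : IsNormalFilter κ U F)
    {A B : ZFSet.{u}} (hA : A ∈ F) (hB : B ∈ F) (hAU : A ∈ U) (hBU : B ∈ U) : A ∩ B ∈ F := by
  classical
  rcases hF.measures _ (h.inter_mem hAU hBU) fun x hx => hF.filter.1 A hA (ZFSet.mem_inter.1 hx).1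
    with h | h
  · exact h
  · have h3 := hF.filter.2 {A, B, cardSet κ \ (A ∩ B)} (by simp [hA, hB, h])
    have : ZFSet.sep (fun β => ∀ C ∈ ({A, B, cardSet κ \ (A ∩ B)} : Finset ZFSet.{u}), β ∈ C)
        (cardSet κ) = ∅ := by
      ext x
      simp
      tauto
    rw [this, ZFSet.card_empty] at h3
    exact absurd h3.symm hκ.ne_zero

lemma IsNormalFilter.compl_mem (hF : IsNormalFilter κ U F) {A : ZFSet.{u}} (hA : A ∈ U)
    (hAk : A ⊆ cardSet κ) (h : A ∉ F) : cardSet κ \ A ∈ F :=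
  (hF.measures A hA hAk).resolve_left h

lemma IsNormalFilter.tail_mem (hκ : κ.IsRegular) (h : ElemSub U (H θ)) (hk : cardSet κ ∈ U)
    (hkU : cardSet κ ⊆ U)
    (hF : IsNormalFilter κ U F) {γ : ZFSet.{u}} (hγ : γ ∈ cardSet κ) :
    ZFSet.sep (fun β => γ ∈ β) (cardSet κ) ∈ F := by
  have hU := h.sep_mem (fun _ (g : ZFSet.{u}) β => g ∈ β) (g := γ) (by simpa using hkU hγ) hk
  by_contra hcon
  obtain ⟨β, hβ, hγβ⟩ := hF.filter.unbounded hκ (hF.compl_mem hU ZFSet.sep_subset hcon) hγ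
  rw [ZFSet.mem_sdiff, ZFSet.mem_sep] at hβ
  exact hβ.2 ⟨hβ.1, hγβ⟩

/-- Fodor's argument: otherwise `F` contains all the sets where `g` differs from δ, and hence their
diagonal intersection; this must meet the set where `g` is regressive, which is absurd. -/
lemma IsNormalFilter.exists_const (hκ : κ.IsRegular) (hθ : θ.IsRegular) (h : ElemSub U (H θ))
    (hk : cardSet κ ∈ U) (hkU : cardSet κ ⊆ U) (hF : IsNormalFilter κ U F) {g y : ZFSet.{u}}
    (hg : g ∈ U) (hgf : ZFSet.IsFunc (cardSet κ) y g)
    (hreg : ZFSet.sep (fun β => app g β ∈ β) (cardSet κ) ∈ F) :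
    ∃ δ ∈ cardSet κ, ZFSet.sep (fun β => app g β = δ) (cardSet κ) ∈ F := by
  by_contra hcon
  push Not at hcon
  have hkH := h.subset hk
  have hsep : ∀ δ, ZFSet.sep (fun β => ¬ ZFSet.pair β δ ∈ g) (cardSet κ) =
      cardSet κ \ ZFSet.sep (fun β => app g β = δ) (cardSet κ) := fun δ => by
    ext β
    simp only [ZFSet.mem_sep, ZFSet.mem_sdiff, pair_mem_iff hgf]
    tauto
  have hX : graph (cardSet κ) (fun δ => ZFSet.sep (fun β => ¬ ZFSet.pair β δ ∈ g) (cardSet κ))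
      ∈ U := by
    refine h.graph_mem hθ (fun _ (q : ZFSet.{u} × ZFSet.{u}) δ Z => Z ⊆ q.1 ∧
      ∀ β, β ∈ q.1 → (β ∈ Z ↔ ¬ ZFSet.pair β δ ∈ q.2)) (g := (cardSet κ, g)) (by simp [hk, hg]) hk
      fun δ _ => ⟨mem_H_of_subset hkH ZFSet.sep_subset, fun Z _ => ?_⟩
    constructor
    · rintro ⟨h1, h2⟩
      ext β
      rw [ZFSet.mem_sep]
      exact ⟨fun hβ => ⟨h1 hβ, (h2 β (h1 hβ)).1 hβ⟩, fun hβ => (h2 β hβ.1).2 hβ.2⟩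
    · rintro rfl
      exact ⟨ZFSet.sep_subset, fun β hβ => by simp [ZFSet.mem_sep, hβ]⟩
  have hXF : ∀ δ ∈ cardSet κ, ZFSet.sep (fun β => ¬ ZFSet.pair β δ ∈ g) (cardSet κ) ∈ F :=
    fun δ hδ => by
      rw [hsep]
      refine hF.compl_mem ?_ ZFSet.sep_subset (hcon δ hδ)
      have := h.sep_mem (fun _ (q : ZFSet.{u} × ZFSet.{u}) β => ZFSet.pair β q.1 ∈ q.2)
        (g := (δ, g)) (by simp [hg, hkU hδ]) hk
      convert this using 1
      ext β
      simp only [ZFSet.mem_sep, pair_mem_iff hgf]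
      exact ⟨fun hh => ⟨hh.1, hh.1, hh.2.symm⟩, fun hh => ⟨hh.1, hh.2.2.symm⟩⟩
  obtain ⟨β, hβ1, hβ2⟩ := hF.filter.inter_nonempty hκ.ne_zero hreg
    (hF.diag_mem _ hX (isFunc_graph hXF))
  rw [ZFSet.mem_sep] at hβ1
  rw [diagInter, ZFSet.mem_sep] at hβ2
  obtain ⟨A, hA, hβA⟩ := hβ2.2 _ hβ1.2
  rw [pair_mem_graph] at hA
  rw [hA.2, ZFSet.mem_sep] at hβA
  exact hβA.2 ((pair_mem_iff hgf).2 ⟨hβ1.1, rfl⟩)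

end

/-! ### Filter sequences of elementary substructures -/

section

variable {α κ θ : Cardinal.{u}} {M : Ordinal.{u} → ZFSet.{u}} {F : ZFSet.{u}}

lemma IsWeakModel.card_mem {N : ZFSet.{u}} (h : IsWeakModel κ N) : cardSet κ ∈ N :=
  h.ordinals _ le_rfl

lemma IsWeakModel.card_subset {N : ZFSet.{u}} (h : IsWeakModel κ N) : cardSet κ ⊆ N := fun x hx => by
  obtain ⟨o, ho, rfl⟩ := Ordinal.mem_toZFSet_iff.1 hx
  exact h.ordinals o ho.le

lemma IsFilterSequence.subset_seqUnion {α : Ordinal.{u}} {i : Ordinal.{u}} (hi : i < α) :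
    M i ⊆ seqUnion α M := fun x hx => mem_seqUnion.2 ⟨i, hi, hx⟩

lemma IsFilterSequence.card_mem (hα : α.IsRegular) (hs : IsFilterSequence α.ord κ M F) :
    cardSet κ ∈ seqUnion α.ord M :=
  IsFilterSequence.subset_seqUnion hα.ord_pos (hs.model 0 hα.ord_pos).card_mem

lemma IsFilterSequence.card_subset (hα : α.IsRegular) (hs : IsFilterSequence α.ord κ M F) :
    cardSet κ ⊆ seqUnion α.ord M := fun x hx =>
  IsFilterSequence.subset_seqUnion hα.ord_pos ((hs.model 0 hα.ord_pos).card_subset hx)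

lemma IsFilterSequence.elemSub (hα : α.IsRegular) (hs : IsFilterSequence α.ord κ M F)
    (hel : ∀ i < α.ord, ElemSub (M i) (H θ)) : ElemSub (seqUnion α.ord M) (H θ) :=
  elemSub_seqUnion (transClass_H θ) hα.ord_pos hs.subset hel

lemma add_one_lt_ord (hα : α.IsRegular) {i : Ordinal.{u}} (hi : i < α.ord) : i + 1 < α.ord :=
  (Cardinal.isSuccLimit_ord hα.aleph0_le).add_one_lt hi

lemma IsFilterSequence.inter_mem (hα : α.IsRegular) (hs : IsFilterSequence α.ord κ M F)
    {i j : Ordinal.{u}} (hij : i < j) (hj : j < α.ord) : F ∩ M i ∈ M j :=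
  subset_of_le hs.subset (Order.add_one_le_of_lt hij) hj
    (hs.amenable i (add_one_lt_ord hα (hij.trans hj)))

lemma diagInter_mem {U X : ZFSet.{u}} (h : ElemSub U (H θ)) (hk : cardSet κ ∈ U) (hX : X ∈ U) :
    diagInter κ X ∈ U := by
  have := h.sep_mem (fun T (X : ZFSet.{u}) β => ∀ γ, γ ∈ β → ∃ A, A ∈ T ∧ (ZFSet.pair γ A ∈ X ∧ β ∈ A))
    (g := X) (by simpa using hX) hk
  convert this using 1
  unfold diagInter
  congr 1
  funext β
  refine forall_congr fun γ => forall_congr fun hγ => eq_iff_iff.2 (exists_congr fun A => ?_)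
  exact ⟨fun hA => ⟨(of_pair_mem_mem (transClass_H θ) (h.subset hX) hA.1).2, hA⟩, fun hA => hA.2⟩

/-- A structure closed under subsets of cardinality at most `κ` contains all sets hereditarily of
cardinality at most `κ`, in particular the ordinals up to `κ`. -/
lemma SubClosed.mem_of_transitive (hθ : θ.IsRegular) (hκθ : κ < θ) {h x : ZFSet.{u}}
    (hh : SubClosed (H θ) (cardSet κ) h) (hx : x ∈ H θ)
    (hc : ∀ t : ZFSet.{u}, (∀ P : ZFSet.{u} → Prop, P x → (∀ y, P y → ∀ z ∈ y, P z) → P t) →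
      t.card ≤ κ) : x ∈ h := by
  -- The assumption on `t` in `hc` says, impredicatively, that `t` is `x` or lies in the transitive
  -- closure of `x`; it passes to elements of `x`.
  induction x using ZFSet.inductionOn with
  | _ x ih =>
    refine hh x hx (fun y hy => ih y hy (transClass_H θ x hx y hy) fun t ht => hc t fun P hP hP' =>
      ht P (hP' x hP y hy) hP') (exists_enum hθ (cardSet_mem_H hκθ) hx ?_)
    rw [card_cardSet]
    exact hc x fun P hP _ => hP

lemma SubClosed.ordinal_mem (hθ : θ.IsRegular) (hκθ : κ < θ) {h : ZFSet.{u}}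
    (hh : SubClosed (H θ) (cardSet κ) h) {o : Ordinal.{u}} (ho : o ≤ κ.ord) : o.toZFSet ∈ h := by
  have hoc : ∀ o' ≤ o, o'.card ≤ κ := fun o' ho' => by
    simpa using Ordinal.card_le_card (ho'.trans ho)
  refine hh.mem_of_transitive hθ hκθ (ordinal_mem_H ((hoc o le_rfl).trans_lt hκθ)) fun t ht => ?_
  obtain ⟨o', ho', rfl⟩ := ht (fun t => ∃ o' ≤ o, o'.toZFSet = t) ⟨o, le_rfl, rfl⟩ (by
    rintro y ⟨a, ha, rfl⟩ z hz
    obtain ⟨b, hb, rfl⟩ := Ordinal.mem_toZFSet_iff.1 hz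
    exact ⟨b, hb.le.trans ha, rfl⟩)
  rw [Ordinal.card_toZFSet]
  exact hoc o' ho'

/-- Closure under `f` holds because `f ∈ N`. A subset of size less than κ lies in `N` by closure
under sequences and in `h` by `SubClosed`. -/
lemma goodModel_inter (hκ : κ.IsRegular) (hθ : θ.IsRegular) (hκθ : κ < θ) {h f N : ZFSet.{u}}
    (hhH : h ∈ H θ)
    (hh : SubClosed (H θ) (cardSet κ) h) (hf : ZFSet.IsFunc h h f) (hN : IsModel κ N)
    (hel : ElemSub N (H θ)) (hfN : f ∈ N) : GoodModel (H θ) (cardSet κ) h f (N ∩ h) := by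
  have hsub : N ∩ h ⊆ h := fun x hx => (ZFSet.mem_inter.1 hx).2
  have hsubN : N ∩ h ⊆ N := fun x hx => (ZFSet.mem_inter.1 hx).1
  have hNc : (N ∩ h).card ≤ (cardSet κ).card := by
    rw [card_cardSet, ← hN.card_eq]
    exact ZFSet.card_mono hsubN
  refine ⟨hsub, exists_enum hθ (cardSet_mem_H hκθ) (mem_H_of_subset hhH hsub) hNc, fun γ hγ => ?_,
    ?_, fun x hx y hy hxy => ?_, fun s hsH hs => ?_⟩
  · refine ZFSet.mem_inter.2 ⟨hN.card_subset hγ, ?_⟩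
    obtain ⟨o, ho, rfl⟩ := Ordinal.mem_toZFSet_iff.1 hγ
    exact hh.ordinal_mem hθ hκθ ho.le
  · exact ZFSet.mem_inter.2 ⟨hN.card_mem, hh.ordinal_mem hθ hκθ le_rfl⟩
  · rw [ZFSet.mem_inter] at hx ⊢
    refine ⟨hel.snd_mem (transClass_H θ) hfN hx.1 hxy fun c hc => ?_, hy⟩
    exact (hf.2 x hx.2).unique hc hxy
  · rintro ⟨β, hβ, e, _, he⟩
    have hsc : s.card < κ := by
      refine he.card_le.trans_lt ?_
      obtain ⟨o, ho, rfl⟩ := Ordinal.mem_toZFSet_iff.1 hβ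
      rw [Ordinal.card_toZFSet]
      exact Cardinal.lt_ord.1 ho
    refine ZFSet.mem_inter.2 ⟨hN.closed.mem_of_subset hel hθ hκ.pos (fun x hx => hsubN (hs hx)) hsc,
      hh s hsH (fun x hx => hsub (hs hx)) (exists_enum hθ (cardSet_mem_H hκθ) hsH ?_)⟩
    rw [card_cardSet]
    exact hsc.le

/-- A bad pair reflects into `M 0` and hence lies in every `M i`. The traces `M i ∩ h` with the
filter `F ∩ U` then form a good sequence for it, a contradiction. The filter is cut down to `U`
because its elements outside `U` are not controlled, for instance under intersections. -/
lemma allGood_of_isFilterSequence (hα : α.IsRegular) (hκ : κ.IsRegular) (hακ : α ≤ κ)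
    (hθ : θ.IsRegular) (hκθ : 2 ^ κ < θ) (hs : IsFilterSequence α.ord κ M F)
    (hwf : WellFoundedUltrapower κ (seqUnion α.ord M) F)
    (hel : ∀ i < α.ord, ElemSub (M i) (H θ)) : AllGood α κ θ := by
  have hκθ' : κ < θ := (Cardinal.cantor κ).trans hκθ
  have h0 := hα.ord_pos
  by_contra hbad
  obtain ⟨h, hh0, f, hf0, hsc, hf, hno⟩ := (hel 0 h0).exists_bad
    ((hs.model 0 h0).ordinals _ (Cardinal.ord_le_ord.2 hακ)) (hs.model 0 h0).card_mem hbad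
  refine hno ?_
  have hU := hs.elemSub hα hel
  set U := seqUnion α.ord M with hUdef
  have hMU : ∀ i < α.ord, M i ⊆ U := fun i hi => IsFilterSequence.subset_seqUnion hi
  have hkU : cardSet κ ∈ U := hs.card_mem hα
  have hhM : ∀ i < α.ord, h ∈ M i := fun i hi => subset_of_le hs.subset zero_le hi hh0
  have hfM : ∀ i < α.ord, f ∈ M i := fun i hi => subset_of_le hs.subset zero_le hi hf0
  have hhH : h ∈ H θ := (hel 0 h0).subset hh0
  have hkH := cardSet_mem_H hκθ'
  -- Inside H(θ) the indices are von Neumann ordinals; the rank recovers the ordinal.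
  let N : ZFSet.{u} → ZFSet.{u} := fun i => M i.rank ∩ h
  have hNh : ∀ i, N i ⊆ h := fun i x hx => (ZFSet.mem_inter.1 hx).2
  have hNM : ∀ i, N i ⊆ M i.rank := fun i x hx => (ZFSet.mem_inter.1 hx).1
  have hrank : ∀ i ∈ cardSet α, i.rank < α.ord := fun i hi => by
    obtain ⟨o, ho, rfl⟩ := Ordinal.mem_toZFSet_iff.1 hi
    simpa using ho
  have hsmall : ∀ x, x ⊆ h → x.card ≤ κ → x ∈ h := fun x hx hc =>
    hsc x (mem_H_of_subset hhH hx) hx (exists_enum hθ hkH (mem_H_of_subset hhH hx)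
      (by rwa [card_cardSet]))
  have hNc : ∀ i ∈ cardSet α, ∀ x, x ⊆ N i → x ∈ h := fun i hi x hx =>
    hsmall x (fun y hy => hNh i (hx hy)) ((ZFSet.card_mono fun y hy => hNM i (hx hy)).trans
      (hs.model _ (hrank i hi)).card_eq.le)
  have hNmem : ∀ i ∈ cardSet α, N i ∈ h := fun i hi => hNc i hi _ fun _ hx => hx
  have hNH : ∀ i, N i ∈ H θ := fun i => mem_H_of_subset hhH (hNh i)
  let W := graph (cardSet α) N
  have hWmem : ∀ i m, ZFSet.pair i m ∈ W ↔ i ∈ cardSet α ∧ m = N i := fun i m => pair_mem_graph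
  have hFk : ∀ A ∈ F, A ⊆ cardSet κ := hs.normal.filter.1
  have hF'U : ∀ A, A ∈ F ∩ U ↔ A ∈ F ∧ A ∈ U := fun A => ZFSet.mem_inter
  refine ⟨W, graph_mem_H hθ (cardSet_mem_H (hακ.trans_lt hκθ')) fun i _ => hNH i, F ∩ U, ?_,
    ⟨isFunc_graph hNmem, fun i hi m _ him => ?_⟩, fun i hi j hj m _ m' _ hjm him => ?_,
    fun A hA => ?_, fun A hA B hB => ?_, fun i hi m _ him => ?_, fun B _ hB hBne => ?_⟩
  -- This is where 2^κ < θ is needed: a set of subsets of κ belongs to H(θ).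
  · have hsubP : F ∩ U ⊆ ZFSet.powerset (cardSet κ) := fun A hA =>
      ZFSet.mem_powerset.2 (hFk A ((hF'U A).1 hA).1)
    refine mem_H_of_forall hθ ((ZFSet.card_mono hsubP).trans_lt ?_) fun A hA =>
      mem_H_of_subset hkH (hFk A ((hF'U A).1 hA).1)
    rwa [ZFSet.card_powerset, card_cardSet]
  · rw [((hWmem i m).1 him).2]
    exact goodModel_inter hκ hθ hκθ' hhH hsc hf (hs.model _ (hrank i hi)) (hel _ (hrank i hi))
      (hfM _ (hrank i hi))
  · obtain ⟨hjα, rfl⟩ := (hWmem j m').1 hjm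
    obtain ⟨_, rfl⟩ := (hWmem i m).1 him
    have hji := ZFSet.rank_lt_of_mem hj
    have hri := hrank i hi
    refine ⟨ZFSet.mem_inter.2 ⟨(hel _ hri).inter_mem (hs.mem _ _ hji hri) (hhM _ hri),
      hNmem j hjα⟩, fun x hx => ?_, (F ∩ U) ∩ N j, ZFSet.mem_inter.2 ⟨?_, ?_⟩, ?_, ?_⟩
    · rw [ZFSet.mem_inter] at hx ⊢
      exact ⟨hs.subset _ _ hji hri hx.1, hx.2⟩
    -- This form shows that amenability of the given sequence passes to the traces on `h`.
    · have : (F ∩ U) ∩ N j = (F ∩ M j.rank) ∩ h := by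
        ext x
        simp only [N, ZFSet.mem_inter]
        exact ⟨fun hx => ⟨⟨hx.1.1, hx.2.1⟩, hx.2.2⟩,
          fun hx => ⟨⟨hx.1.1, hMU _ (hrank j hjα) hx.1.2⟩, hx.1.2, hx.2⟩⟩
      rw [this]
      exact (hel _ hri).inter_mem (hs.inter_mem hα hji hri) (hhM _ hri)
    · exact hNc j hjα _ fun x hx => (ZFSet.mem_inter.1 hx).2
    · exact fun x hx => ZFSet.mem_inter.1 hx
    · exact fun x hx hxF => ZFSet.mem_inter.2 ⟨hxF, hx⟩
  · rw [hF'U] at hA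
    exact ⟨hFk A hA.1, fun γ hγ => hs.normal.filter.unbounded hκ hA.1 hγ⟩
  · rw [hF'U] at hA hB
    exact ⟨A ∩ B, (hF'U _).2 ⟨hs.normal.inter_mem hκ hU hA.1 hB.1 hA.2 hB.2,
      hU.inter_mem hA.2 hB.2⟩, fun x hx => (ZFSet.mem_inter.1 hx).1,
      fun x hx => (ZFSet.mem_inter.1 hx).2⟩
  · obtain ⟨_, rfl⟩ := (hWmem i m).1 him
    refine ⟨fun A hA hAk => ?_, fun X hX hXF => ?_⟩
    · have hAU := hMU _ (hrank i hi) (hNM i hA)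
      rcases hs.normal.measures A hAU hAk with h1 | h1
      · exact Or.inl ((hF'U A).2 ⟨h1, hAU⟩)
      · exact Or.inr ⟨_, (hF'U _).2 ⟨h1, hU.sdiff_mem hkU hAU⟩, fun β hβ => by simp [hβ]⟩
    · have hXU := hMU _ (hrank i hi) (hNM i hX)
      have hXapp : ∀ γ ∈ cardSet κ, app X γ ∈ F ∩ U := fun γ hγ => app_mem hXF hγ
      refine ⟨diagInter κ X, (hF'U _).2 ⟨hs.normal.diag_mem X hXU
        (isFunc_app hXF fun γ hγ => ((hF'U _).1 (hXapp γ hγ)).1), diagInter_mem hU hkU hXU⟩,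
        fun β hβ => ?_⟩
      rw [diagInter, ZFSet.mem_sep, and_iff_right hβ]
      refine forall_congr' fun γ => forall_congr' fun hγ => exists_congr fun A => ?_
      rw [iff_and_self]
      intro hA
      obtain ⟨h1, rfl⟩ := (pair_mem_iff hXF).1 hA.1
      exact hXapp γ h1
  -- The elements of `B` represent elements of the ultrapower of `U`, whose well-foundedness
  -- provides a minimal one.
  · have hBU : ∀ g ∈ B, g ∈ U ∧ ∃ y, ZFSet.IsFunc (cardSet κ) y g := fun g hg => by
      obtain ⟨i, hi, m, _, him, hgm, y, _, hy⟩ := hB g hg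
      obtain ⟨_, rfl⟩ := (hWmem i m).1 him
      exact ⟨hMU _ (hrank i hi) (hNM i hgm), y, hy⟩
    obtain ⟨g, hg, _⟩ := hBne
    obtain ⟨⟨g, hgU⟩, hg, hmin⟩ := WellFounded.has_min hwf {x : UltraFun κ U | x.1 ∈ B}
      ⟨⟨g, hBU g hg⟩, hg⟩
    refine ⟨g, hg, fun g' hg' hlt => hmin ⟨g', hBU g' hg'⟩ hg' ?_⟩
    obtain ⟨Z, hZ, hZ'⟩ := hlt
    have hZF := ((hF'U Z).1 hZ).1
    have : Z = ZFSet.sep (fun β => ∃ a b, ZFSet.pair β a ∈ g' ∧ ZFSet.pair β b ∈ g ∧ a ∈ b)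
        (cardSet κ) := by
      ext β
      rw [ZFSet.mem_sep]
      exact ⟨fun hβ => ⟨hFk Z hZF hβ, (hZ' β (hFk Z hZF hβ)).1 hβ⟩, fun hβ => (hZ' β hβ.1).2 hβ.2⟩
    rw [this] at hZF
    exact hZF

lemma exists_bound (hα : α.IsRegular) {x : ZFSet.{u}} (hx : x.card < α) {f : ZFSet.{u} → Ordinal.{u}}
    (hf : ∀ z ∈ x, f z < α.ord) : ∃ j < α.ord, ∀ z ∈ x, f z ≤ j := by
  let g : Shrink.{u} x → Ordinal.{u} := fun i => f ((equivShrink x).symm i)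
  refine ⟨iSup g, Ordinal.iSup_lt_of_lt_cof (by rwa [hα.cof_ord])
    fun i => hf _ ((equivShrink x).symm i).2, fun z hz => ?_⟩
  have := Ordinal.le_iSup g (equivShrink x ⟨z, hz⟩)
  simpa [g] using this

/-- Filter sequences of length of uncountable cofinality are well-founded. -/
lemma IsFilterSequence.wellFounded (hα : α.IsRegular) (hκ : κ.IsRegular) (hακ : α ≤ κ)
    (hα0 : ℵ₀ < α) (hθ : θ.IsRegular) (hs : IsFilterSequence α.ord κ M F)
    (hel : ∀ i < α.ord, ElemSub (M i) (H θ)) :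
    WellFoundedUltrapower κ (seqUnion α.ord M) F := by
  classical
  have hU := hs.elemSub hα hel
  have hkU := hs.card_mem hα
  have hksub := hs.card_subset hα
  set U := seqUnion α.ord M with hUdef
  rw [WellFoundedUltrapower, wellFounded_iff_isEmpty_descending_chain]
  refine ⟨fun ⟨g, hg⟩ => ?_⟩
  have hgM : ∀ n, ∃ i < α.ord, (g n).1 ∈ M i := fun n => mem_seqUnion.1 (g n).2.1
  choose i hi hgi using hgM
  let num : ZFSet.{u} → ℕ := fun z => if h : ∃ n : ℕ, (n : Ordinal.{u}).toZFSet = z then h.choose else 0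
  have hnum : ∀ n : ℕ, num (n : Ordinal.{u}).toZFSet = n := fun n => by
    have h : ∃ m : ℕ, (m : Ordinal.{u}).toZFSet = (n : Ordinal.{u}).toZFSet := ⟨n, rfl⟩
    simp only [num, dif_pos h]
    have := Ordinal.toZFSet_injective h.choose_spec
    exact_mod_cast this
  let w : ZFSet.{u} := Ordinal.omega0.toZFSet
  have hwmem : ∀ n : ℕ, (n : Ordinal.{u}).toZFSet ∈ w := fun n =>
    Ordinal.toZFSet_mem_toZFSet_iff.2 (Ordinal.natCast_lt_omega0 n)
  have hw : ∀ z ∈ w, ∃ n : ℕ, (n : Ordinal.{u}).toZFSet = z := fun z hz => by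
    obtain ⟨o, ho, rfl⟩ := Ordinal.mem_toZFSet_iff.1 hz
    obtain ⟨n, rfl⟩ := Ordinal.lt_omega0.1 ho
    exact ⟨n, rfl⟩
  have hwc : w.card = ℵ₀ := by simp [w]
  -- As α is regular and uncountable, the whole descending sequence of functions is contained in a
  -- single `M j`.
  obtain ⟨j, hj, hjb⟩ := exists_bound hα (x := w) (by rwa [hwc]) (f := fun z => i (num z))
    fun z _ => hi _
  have hgj : ∀ n, (g n).1 ∈ M j := fun n => by
    have := hjb _ (hwmem n)
    rw [hnum] at this
    exact subset_of_le hs.subset this hj (hgi n)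
  let A : ℕ → ZFSet.{u} := fun n => ZFSet.sep (fun β => ∃ a b, ZFSet.pair β a ∈ (g (n + 1)).1 ∧
    ZFSet.pair β b ∈ (g n).1 ∧ a ∈ b) (cardSet κ)
  have hAF : ∀ n, A n ∈ F := hg
  have hkj : cardSet κ ∈ M j := (hs.model j hj).card_mem
  have hAj : ∀ n, A n ∈ M j := fun n => by
    have := (hel j hj).sep_mem (fun T (q : ZFSet.{u} × ZFSet.{u}) β => ∃ a, a ∈ T ∧ ∃ b, b ∈ T ∧
      (ZFSet.pair β a ∈ q.1 ∧ ZFSet.pair β b ∈ q.2 ∧ a ∈ b)) (g := ((g (n + 1)).1, (g n).1))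
      (by simp [hgj]) hkj
    convert this using 1
    ext β
    simp only [A, ZFSet.mem_sep]
    refine and_congr_right fun _ => ⟨?_, ?_⟩
    · rintro ⟨a, b, h1, h2, h3⟩
      exact ⟨a, (of_pair_mem_mem (transClass_H θ) ((hel j hj).subset (hgj _)) h1).2, b,
        (of_pair_mem_mem (transClass_H θ) ((hel j hj).subset (hgj _)) h2).2, h1, h2, h3⟩
    · rintro ⟨a, _, b, _, h⟩
      exact ⟨a, b, h⟩
  have hκ0 : ℵ₀ < κ := hα0.trans_le hακ
  have hωκ : Ordinal.omega0 < κ.ord := by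
    rw [← Cardinal.ord_aleph0]
    exact Cardinal.ord_lt_ord.2 hκ0
  have hnj : ∀ n : ℕ, (n : Ordinal.{u}).toZFSet ∈ M j := fun n =>
    (hs.model j hj).ordinals _ ((Ordinal.natCast_lt_omega0 n).trans hωκ).le
  let S := graph w fun z => A (num z)
  -- The sets `A n` witnessing the descent lie in `M j`, and so does their sequence, because `M j`
  -- is closed under ω-sequences.
  have hSj : S ∈ M j := by
    refine (hs.model j hj).closed.mem_of_subset (hel j hj) hθ hκ.pos (fun p hp => ?_) ?_
    · obtain ⟨z, hz, rfl⟩ := mem_graph.1 hp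
      obtain ⟨n, rfl⟩ := hw z hz
      exact (hel j hj).pair_mem hθ (hnj n) (hAj _)
    · exact (card_img_le _ _).trans_lt (by rwa [hwc])
  have hSU : S ∈ U := IsFilterSequence.subset_seqUnion hj hSj
  -- Normality refers to sequences of length κ, so the ω-sequence is continued by the trivial value
  -- κ.
  let X := graph (cardSet κ) fun z => if z ∈ w then A (num z) else cardSet κ
  have hkF : cardSet κ ∈ F := by
    by_contra hcon
    have h0 := hs.normal.compl_mem hkU (fun _ hx => hx) hcon
    obtain ⟨x, hx, _⟩ := hs.normal.filter.inter_nonempty hκ.ne_zero h0 h0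
    simp at hx
  have hX : X ∈ U := by
    refine hU.graph_mem hθ (fun T (q : ZFSet.{u} × ZFSet.{u}) z B =>
      ZFSet.pair z B ∈ q.2 ∨ (B = q.1 ∧ ¬ ∃ C, C ∈ T ∧ ZFSet.pair z C ∈ q.2))
      (g := (cardSet κ, S)) (by simp [hkU, hSU]) hkU fun z hz => ?_
    by_cases hzw : z ∈ w
    · simp only [hzw, if_true]
      refine ⟨hU.subset (IsFilterSequence.subset_seqUnion hj (hAj _)), fun B hB => ?_⟩
      simp only [S, pair_mem_graph, hzw, true_and]
      refine ⟨?_, fun h => Or.inl h⟩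
      rintro (h | ⟨_, h⟩)
      · exact h
      · exact absurd ⟨_, hU.subset (IsFilterSequence.subset_seqUnion hj (hAj _)), rfl⟩ h
    · simp only [hzw, if_false]
      refine ⟨hU.subset hkU, fun B hB => ?_⟩
      simp [S, pair_mem_graph, hzw]
  have hXF : ZFSet.IsFunc (cardSet κ) F X := isFunc_graph fun z _ => by
    by_cases hzw : z ∈ w
    · simpa only [hzw, if_true] using hAF _
    · simpa only [hzw, if_false] using hkF
  have hωk : w ∈ cardSet κ := Ordinal.toZFSet_mem_toZFSet_iff.2 hωκ
  -- A point of the diagonal intersection beyond ω lies in every `A n`, so the values of the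
  -- functions there form a descending ∈-chain.
  obtain ⟨β, hβ1, hβ2⟩ := hs.normal.filter.inter_nonempty hκ.ne_zero
    (hs.normal.diag_mem X hX hXF) (hs.normal.tail_mem hκ hU hkU hksub hωk)
  rw [diagInter, ZFSet.mem_sep] at hβ1
  rw [ZFSet.mem_sep] at hβ2
  have hβo := (ZFSet.isOrdinal_toZFSet κ.ord).mem hβ2.1
  have hβA : ∀ n, β ∈ A n := fun n => by
    obtain ⟨B, hB, hβB⟩ := hβ1.2 _ (hβo.mem_trans (hwmem n) hβ2.2)
    rw [pair_mem_graph] at hB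
    have := hB.2
    rw [if_pos (hwmem n), hnum] at this
    rwa [← this]
  have hdesc : ∀ n, app (g (n + 1)).1 β ∈ app (g n).1 β := fun n => by
    obtain ⟨_, a, b, ha, hb, hab⟩ := ZFSet.mem_sep.1 (hβA n)
    obtain ⟨y, hy⟩ := (g (n + 1)).2.2
    obtain ⟨y', hy'⟩ := (g n).2.2
    rw [← ((pair_mem_iff hy).1 ha).2, ← ((pair_mem_iff hy').1 hb).2]
    exact hab
  exact (wellFounded_iff_isEmpty_descending_chain.1 ZFSet.mem_wf).false
    ⟨fun n => app (g n).1 β, hdesc⟩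

end

/-! ### The ultrapower -/

instance Def.forallFin {Γ : Type (u + 1)} [Ctx Γ] {n : ℕ}
    (P : Fin n → Set ZFSet.{u} → Γ → Prop) [hP : ∀ i, Def (P i)] :
    Def (fun T g => ∀ i, P i T g) := by
  choose φ hφ using fun i => (hP i).out
  refine ⟨Language.BoundedFormula.iInf φ, fun T hT g hg => ?_⟩
  have := Language.BoundedFormula.realize_iInf (f := φ) (v := val g hg) (v' := default)
  refine this.trans (forall_congr' fun i => hφ i T hT g hg)

instance (κ : Cardinal.{u}) (U : ZFSet.{u}) : Small.{u} (UltraFun κ U) :=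
  small_of_injective (β := {x // x ∈ U}) (f := fun g => ⟨g.1, g.2.1⟩)
    fun g g' h => Subtype.ext (congrArg (fun z : {x // x ∈ U} => z.1) h)

instance (κ : Cardinal.{u}) (U : ZFSet.{u}) (p : UltraFun κ U → Prop) : Small.{u} {g // p g} :=
  small_subtype _ _

/-- The transitive collapse of a well-founded ultrapower. -/
noncomputable def ultraCollapse {κ : Cardinal.{u}} {U F : ZFSet.{u}}
    (hwf : WellFoundedUltrapower κ U F) : UltraFun κ U → ZFSet.{u} :=
  WellFounded.fix (r := ultraMem κ U F) hwf fun f ih => ZFSet.range fun g : {g // ultraMem κ U F g f} => ih g.1 g.2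

section

variable {κ θ : Cardinal.{u}} {U F : ZFSet.{u}}

lemma mem_ultraCollapse (hwf : WellFoundedUltrapower κ U F) {f : UltraFun κ U} {z : ZFSet.{u}} :
    z ∈ ultraCollapse hwf f ↔ ∃ g, ultraMem κ U F g f ∧ ultraCollapse hwf g = z := by
  have : ultraCollapse hwf f = ZFSet.range fun g : {g // ultraMem κ U F g f} =>
      ultraCollapse hwf g.1 := WellFounded.fix_eq (r := ultraMem κ U F) hwf _ f
  rw [this, ZFSet.mem_range]
  simp

lemma ultraMem_iff {f g : UltraFun κ U} : ultraMem κ U F f g ↔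
    ZFSet.sep (fun β => app f.1 β ∈ app g.1 β) (cardSet κ) ∈ F := by
  obtain ⟨f, hf, y, hy⟩ := f
  obtain ⟨g, hg, y', hy'⟩ := g
  unfold ultraMem
  have : ZFSet.sep (fun β => ∃ a b, ZFSet.pair β a ∈ f ∧ ZFSet.pair β b ∈ g ∧ a ∈ b) (cardSet κ) =
      ZFSet.sep (fun β => app f β ∈ app g β) (cardSet κ) := by
    ext β
    simp only [ZFSet.mem_sep]
    refine and_congr_right fun hβ => ⟨?_, fun h => ⟨_, _, app_spec hy hβ, app_spec hy' hβ, h⟩⟩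
    rintro ⟨a, b, ha, hb, hab⟩
    rw [← ((pair_mem_iff hy).1 ha).2, ← ((pair_mem_iff hy').1 hb).2]
    exact hab
  rw [this]

/-- The hypotheses under which the ultrapower is formed. -/
structure UltraSetup (κ θ : Cardinal.{u}) (U F : ZFSet.{u}) : Prop where
  regular : κ.IsRegular
  regular' : θ.IsRegular
  elem : ElemSub U (H θ)
  card_mem : cardSet κ ∈ U
  card_subset : cardSet κ ⊆ U
  normal : IsNormalFilter κ U F
  wf : WellFoundedUltrapower κ U F

namespace UltraSetup

lemma app_mem (S : UltraSetup κ θ U F) (f : UltraFun κ U) {β : ZFSet.{u}} (hβ : β ∈ cardSet κ) : app f.1 β ∈ U := by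
  obtain ⟨f, hf, y, hy⟩ := f
  exact S.elem.app_mem (transClass_H θ) hf hy hβ (S.card_subset hβ)

lemma univ_mem (S : UltraSetup κ θ U F) : cardSet κ ∈ F := by
  by_contra hcon
  have h0 := S.normal.compl_mem S.card_mem (fun _ hx => hx) hcon
  obtain ⟨x, hx, _⟩ := S.normal.filter.inter_nonempty S.regular.ne_zero h0 h0
  simp at hx

lemma mono (S : UltraSetup κ θ U F) {p q : ZFSet.{u} → Prop} (hp : ZFSet.sep p (cardSet κ) ∈ F)
    (hq : ZFSet.sep q (cardSet κ) ∈ U) (h : ∀ β ∈ cardSet κ, p β → q β) :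
    ZFSet.sep q (cardSet κ) ∈ F :=
  S.normal.superset S.regular.ne_zero hp hq ZFSet.sep_subset fun β hβ => by
    rw [ZFSet.mem_sep] at hβ ⊢
    exact ⟨hβ.1, h β hβ.1 hβ.2⟩

/-- If two sets are in the filter, then so is every set in `U` containing their intersection. -/
lemma mono₂ (S : UltraSetup κ θ U F) {p q r : ZFSet.{u} → Prop} (hp : ZFSet.sep p (cardSet κ) ∈ F)
    (hq : ZFSet.sep q (cardSet κ) ∈ F) (hr : ZFSet.sep r (cardSet κ) ∈ U)
    (h : ∀ β ∈ cardSet κ, p β → q β → r β) : ZFSet.sep r (cardSet κ) ∈ F := by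
  classical
  rcases S.normal.measures _ hr ZFSet.sep_subset with h1 | h1
  · exact h1
  · have h3 := S.normal.filter.2 {ZFSet.sep p (cardSet κ), ZFSet.sep q (cardSet κ),
      cardSet κ \ ZFSet.sep r (cardSet κ)} (by simp [hp, hq, h1])
    have : ZFSet.sep (fun β => ∀ C ∈ ({ZFSet.sep p (cardSet κ), ZFSet.sep q (cardSet κ),
        cardSet κ \ ZFSet.sep r (cardSet κ)} : Finset ZFSet.{u}), β ∈ C) (cardSet κ) = ∅ := by
      rw [ZFSet.eq_empty]
      intro x hx
      simp only [ZFSet.mem_sep, Finset.mem_insert, Finset.mem_singleton, forall_eq_or_imp,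
        forall_eq, ZFSet.mem_sdiff] at hx
      have := h x hx.1
      tauto
    rw [this, ZFSet.card_empty] at h3
    exact absurd h3.symm S.regular.ne_zero

lemma exists_of_mem₂ (S : UltraSetup κ θ U F) {p q : ZFSet.{u} → Prop} (hp : ZFSet.sep p (cardSet κ) ∈ F)
    (hq : ZFSet.sep q (cardSet κ) ∈ F) : ∃ β ∈ cardSet κ, p β ∧ q β := by
  obtain ⟨β, h1, h2⟩ := S.normal.filter.inter_nonempty S.regular.ne_zero hp hq
  rw [ZFSet.mem_sep] at h1 h2
  exact ⟨β, h1.1, h1.2, h2.2⟩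

lemma not_mem (S : UltraSetup κ θ U F) {p : ZFSet.{u} → Prop} (hp : ZFSet.sep p (cardSet κ) ∈ U)
    (h : ZFSet.sep p (cardSet κ) ∉ F) : ZFSet.sep (fun β => ¬ p β) (cardSet κ) ∈ F := by
  have := S.normal.compl_mem hp ZFSet.sep_subset h
  convert this using 1
  ext β
  simp only [ZFSet.mem_sep, ZFSet.mem_sdiff]
  tauto

/-- Sets defined from the values of functions in the ultrapower. -/
lemma sep_app_mem (S : UltraSetup κ θ U F) {n : ℕ} (P : Set ZFSet.{u} → ZFSet.{u} → (Fin n → ZFSet.{u}) → Prop)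
    [hP : Def (fun T (p : ZFSet.{u} × (Fin n → ZFSet.{u})) => P T p.1 p.2)] (v : Fin n → UltraFun κ U) :
    ZFSet.sep (fun β => P (H θ) β fun i => app (v i).1 β) (cardSet κ) ∈ U := by
  have hD : Def (fun T (p : ((Fin n → ZFSet.{u}) × ZFSet.{u}) × (Fin n → ZFSet.{u})) =>
      P T p.1.2 p.2) :=
    hP.subst₂ (fun p : ((Fin n → ZFSet.{u}) × ZFSet.{u}) × (Fin n → ZFSet.{u}) => p.1.2)
      (fun p => p.2)
  have hD2 : Def (fun T (p : (Fin n → ZFSet.{u}) × ZFSet.{u}) => ∃ w : Fin n → ZFSet.{u},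
      AllIn T w ∧ ((∀ i, ZFSet.pair p.2 (w i) ∈ p.1 i) ∧ P T p.2 w)) :=
    Def.exTuple (fun T (p : (Fin n → ZFSet.{u}) × ZFSet.{u}) (w : Fin n → ZFSet.{u}) =>
      (∀ i, ZFSet.pair p.2 (w i) ∈ p.1 i) ∧ P T p.2 w)
  have := S.elem.sep_mem (fun T (f : Fin n → ZFSet.{u}) β => ∃ w : Fin n → ZFSet.{u},
      AllIn T w ∧ ((∀ i, ZFSet.pair β (w i) ∈ f i) ∧ P T β w)) (g := fun i => (v i).1)
      (by intro i; exact (v i).2.1) S.card_mem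
  convert this using 1
  ext β
  simp only [ZFSet.mem_sep]
  refine and_congr_right fun hβ => ⟨fun h => ⟨_, fun i => S.elem.subset (S.app_mem (v i) hβ),
    fun i => ?_, h⟩, ?_⟩
  · obtain ⟨y, hy⟩ := (v i).2.2
    exact app_spec hy hβ
  · rintro ⟨w, _, hw, h⟩
    have : w = fun i => app (v i).1 β := funext fun i => by
      obtain ⟨y, hy⟩ := (v i).2.2
      exact ((pair_mem_iff hy).1 (hw i)).2
    rwa [← this]

lemma sep_app₁ (S : UltraSetup κ θ U F) (P : Set ZFSet.{u} → ZFSet.{u} → ZFSet.{u} → Prop)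
    [hP : Def (fun T (p : ZFSet.{u} × ZFSet.{u}) => P T p.1 p.2)] (f : UltraFun κ U) :
    ZFSet.sep (fun β => P (H θ) β (app f.1 β)) (cardSet κ) ∈ U :=
  have : Def (fun T (p : ZFSet.{u} × (Fin 1 → ZFSet.{u})) => P T p.1 (p.2 0)) :=
    hP.subst₂ (fun p : ZFSet.{u} × (Fin 1 → ZFSet.{u}) => p.1) (fun p => p.2 0)
  S.sep_app_mem (fun T β (w : Fin 1 → ZFSet.{u}) => P T β (w 0)) ![f]

lemma sep_app₂ (S : UltraSetup κ θ U F) (P : Set ZFSet.{u} → ZFSet.{u} → ZFSet.{u} → Prop)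
    [hP : Def (fun T (p : ZFSet.{u} × ZFSet.{u}) => P T p.1 p.2)] (f g : UltraFun κ U) :
    ZFSet.sep (fun β => P (H θ) (app f.1 β) (app g.1 β)) (cardSet κ) ∈ U :=
  have : Def (fun T (p : ZFSet.{u} × (Fin 2 → ZFSet.{u})) => P T (p.2 0) (p.2 1)) :=
    hP.subst₂ (fun p : ZFSet.{u} × (Fin 2 → ZFSet.{u}) => p.2 0) (fun p => p.2 1)
  S.sep_app_mem (fun T β (w : Fin 2 → ZFSet.{u}) => P T (w 0) (w 1)) ![f, g]

/-- Choice of functions representing elements of the ultrapower. -/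
lemma exists_ultraFun (S : UltraSetup κ θ U F) {n : ℕ} (P : Set ZFSet.{u} → (Fin n → ZFSet.{u}) → ZFSet.{u} → Prop)
    [hP : Def (fun T (p : (Fin n → ZFSet.{u}) × ZFSet.{u}) => P T p.1 p.2)]
    (v : Fin n → UltraFun κ U) : ∃ f : UltraFun κ U, ∀ β ∈ cardSet κ,
      (∃ w ∈ H θ, P (H θ) (fun i => app (v i).1 β) w) →
        P (H θ) (fun i => app (v i).1 β) (app f.1 β) := by
  classical
  have hkH := S.elem.subset S.card_mem
  -- `G` is chosen outside `U`. By regularity of θ its restriction to κ is in H(θ), so the existence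
  -- of such a function is a true statement there, and elementarity yields a possibly different one
  -- in `U`.
  let G : ZFSet.{u} → ZFSet.{u} := fun β =>
    if h : ∃ w ∈ H θ, P (H θ) (fun i => app (v i).1 β) w then h.choose else cardSet κ
  have hG : ∀ β, G β ∈ H θ := fun β => by
    by_cases h : ∃ w ∈ H θ, P (H θ) (fun i => app (v i).1 β) w
    · simp only [G, dif_pos h]
      exact h.choose_spec.1
    · simp only [G, dif_neg h]
      exact hkH
  have hGP : ∀ β, (∃ w ∈ H θ, P (H θ) (fun i => app (v i).1 β) w) →
      P (H θ) (fun i => app (v i).1 β) (G β) := fun β h => by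
    simp only [G, dif_pos h]
    exact h.choose_spec.2
  have hD : Def (fun T (p : (((((ZFSet.{u} × (Fin n → ZFSet.{u})) × ZFSet.{u}) × ZFSet.{u}) ×
      ZFSet.{u}) × ZFSet.{u}) × (Fin n → ZFSet.{u})) => P T p.2 p.1.2) :=
    hP.subst₂ (fun p : (((((ZFSet.{u} × (Fin n → ZFSet.{u})) × ZFSet.{u}) × ZFSet.{u}) ×
      ZFSet.{u}) × ZFSet.{u}) × (Fin n → ZFSet.{u}) => p.2) (fun p => p.1.2)
  have hD2 : Def (fun T (p : ((((ZFSet.{u} × (Fin n → ZFSet.{u})) × ZFSet.{u}) × ZFSet.{u}) ×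
      ZFSet.{u}) × ZFSet.{u}) => ∃ w : Fin n → ZFSet.{u}, AllIn T w ∧
        ((∀ i, ZFSet.pair p.1.2 (w i) ∈ p.1.1.1.1.2 i) ∧ P T w p.2)) :=
    Def.exTuple (fun T (p : ((((ZFSet.{u} × (Fin n → ZFSet.{u})) × ZFSet.{u}) × ZFSet.{u}) ×
      ZFSet.{u}) × ZFSet.{u}) (w : Fin n → ZFSet.{u}) =>
        (∀ i, ZFSet.pair p.1.2 (w i) ∈ p.1.1.1.1.2 i) ∧ P T w p.2)
  have happ : ∀ β ∈ cardSet κ, ∀ w : Fin n → ZFSet.{u}, (∀ i, ZFSet.pair β (w i) ∈ (v i).1) ↔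
      w = fun i => app (v i).1 β := fun β hβ w => by
    rw [funext_iff]
    refine forall_congr' fun i => ?_
    obtain ⟨y, hy⟩ := (v i).2.2
    rw [pair_mem_iff hy, and_iff_right hβ]
  have hHapp : ∀ β ∈ cardSet κ, ∀ i, app (v i).1 β ∈ H θ := fun β hβ i =>
    S.elem.subset (S.app_mem (v i) hβ)
  obtain ⟨f, hfU, y, hy, hfy, hf⟩ := S.elem.exists_mem (transClass_H θ)
    (fun T (g : ZFSet.{u} × (Fin n → ZFSet.{u})) f => ∃ y, y ∈ T ∧ (ZFSet.IsFunc g.1 y f ∧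
      ∀ β, β ∈ g.1 → (∃ x, x ∈ T ∧ ∃ w : Fin n → ZFSet.{u}, AllIn T w ∧
        ((∀ i, ZFSet.pair β (w i) ∈ g.2 i) ∧ P T w x)) → ∃ x, x ∈ T ∧ (ZFSet.pair β x ∈ f ∧
          ∃ w : Fin n → ZFSet.{u}, AllIn T w ∧ ((∀ i, ZFSet.pair β (w i) ∈ g.2 i) ∧ P T w x))))
    (g := (cardSet κ, fun i => (v i).1))
    (by rw [allIn_prod, allIn_set]; exact ⟨S.card_mem, fun i => (v i).2.1⟩)
    ⟨graph (cardSet κ) G, graph_mem_H S.regular' hkH fun z _ => hG z, img G (cardSet κ),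
      img_mem_H S.regular' hkH fun z _ => hG z, isFunc_graph fun z hz => mem_img.2 ⟨z, hz, rfl⟩, by
        rintro β hβ ⟨x, hx, w, _, hw, hPx⟩
        refine ⟨G β, hG β, pair_mem_graph.2 ⟨hβ, rfl⟩, _, hHapp β hβ, (happ β hβ _).2 rfl,
          hGP β ⟨x, hx, ?_⟩⟩
        rwa [← (happ β hβ w).1 hw]⟩
  refine ⟨⟨f, hfU, y, hfy⟩, fun β hβ => ?_⟩
  rintro ⟨x, hx, hPx⟩
  obtain ⟨x', _, hx', w, _, hw, hPx'⟩ := hf β hβ ⟨x, hx, _, hHapp β hβ, (happ β hβ _).2 rfl, hPx⟩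
  rw [(happ β hβ w).1 hw] at hPx'
  change P (H θ) _ (app f β)
  rwa [← ((pair_mem_iff hfy).1 hx').2]

lemma ultraCollapse_eq_of_eq (S : UltraSetup κ θ U F) {f g : UltraFun κ U}
    (h : ZFSet.sep (fun β => app f.1 β = app g.1 β) (cardSet κ) ∈ F) :
    ultraCollapse S.wf f = ultraCollapse S.wf g := by
  ext z
  rw [mem_ultraCollapse, mem_ultraCollapse]
  refine exists_congr fun e => and_congr_left fun _ => ?_
  rw [ultraMem_iff, ultraMem_iff]
  exact ⟨fun h' => S.mono₂ h h' (S.sep_app₂ (fun _ a b => a ∈ b) e g) fun β _ h1 h2 => h1 ▸ h2,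
    fun h' => S.mono₂ h h' (S.sep_app₂ (fun _ a b => a ∈ b) e f) fun β _ h1 h2 => h1 ▸ h2⟩

/-- The ultrapower is extensional: if `f` and `g` differ on a set in `F`, some `e` in `U` selects an
element of the symmetric difference of their values. Whichever of the two `e` belongs to modulo `F`,
equality of the collapses and the induction hypothesis put it into the other as well. -/
lemma eq_of_ultraCollapse_eq (S : UltraSetup κ θ U F) (f : UltraFun κ U) : ∀ g : UltraFun κ U,
    ultraCollapse S.wf f = ultraCollapse S.wf g →
      ZFSet.sep (fun β => app f.1 β = app g.1 β) (cardSet κ) ∈ F := by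
  induction f using S.wf.induction with
  | _ f ih =>
    intro g hfg
    by_contra hcon
    have hne := S.not_mem (S.sep_app₂ (fun _ a b => a = b) f g) hcon
    obtain ⟨e, he⟩ := S.exists_ultraFun (fun _ (v : Fin 2 → ZFSet.{u}) x =>
      (x ∈ v 0 ∧ ¬ x ∈ v 1) ∨ (x ∈ v 1 ∧ ¬ x ∈ v 0)) ![f, g]
    have he' : ∀ β ∈ cardSet κ, ¬ app f.1 β = app g.1 β →
        (app e.1 β ∈ app f.1 β ∧ ¬ app e.1 β ∈ app g.1 β) ∨
        (app e.1 β ∈ app g.1 β ∧ ¬ app e.1 β ∈ app f.1 β) := fun β hβ hne => by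
      refine he β hβ ?_
      by_contra hno
      push Not at hno
      refine hne (ZFSet.ext fun x => ⟨fun hx => ?_, fun hx => ?_⟩)
      · exact (hno x (transClass_H θ _ (S.elem.subset (S.app_mem f hβ)) x hx)).1 hx
      · exact (hno x (transClass_H θ _ (S.elem.subset (S.app_mem g hβ)) x hx)).2 hx
    have hef := S.sep_app₂ (fun _ a b => a ∈ b) e f
    have heg := S.sep_app₂ (fun _ a b => a ∈ b) e g
    by_cases hc : ultraMem κ U F e f
    · have h1 : ultraCollapse S.wf e ∈ ultraCollapse S.wf g := by
        rw [← hfg, mem_ultraCollapse]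
        exact ⟨e, hc, rfl⟩
      obtain ⟨e', he'g, hee'⟩ := (mem_ultraCollapse S.wf).1 h1
      have h2 := ih e hc e' hee'.symm
      rw [ultraMem_iff] at hc he'g
      have h3 := S.mono₂ h2 he'g heg fun β _ a b => a ▸ b
      have h4 := S.mono₂ h3 hc (S.sep_app_mem (fun _ _ (v : Fin 3 → ZFSet.{u}) => v 0 ∈ v 1 ∧
        v 0 ∈ v 2) ![e, g, f]) fun β _ a b => ⟨a, b⟩
      obtain ⟨β, hβ, h5, h6⟩ := S.exists_of_mem₂ h4 hne
      have h7 := he' β hβ h6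
      have h8 : app e.1 β ∈ app g.1 β ∧ app e.1 β ∈ app f.1 β := h5
      tauto
    · have h0 := S.not_mem hef (by rwa [ultraMem_iff] at hc)
      have h1 := S.mono₂ hne h0 heg fun β hβ a b => by
        have := he' β hβ a
        tauto
      have h2 : ultraCollapse S.wf e ∈ ultraCollapse S.wf f := by
        rw [hfg, mem_ultraCollapse]
        exact ⟨e, ultraMem_iff.2 h1, rfl⟩
      obtain ⟨e', he'f, hee'⟩ := (mem_ultraCollapse S.wf).1 h2
      have h3 := ih e' he'f e hee'
      rw [ultraMem_iff] at he'f
      have h4 := S.mono₂ h3 he'f hef fun β _ a b => a ▸ b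
      obtain ⟨β, _, h5, h6⟩ := S.exists_of_mem₂ h4 h0
      exact h6 h5

lemma ultraCollapse_eq_iff (S : UltraSetup κ θ U F) {f g : UltraFun κ U} : ultraCollapse S.wf f = ultraCollapse S.wf g ↔
    ZFSet.sep (fun β => app f.1 β = app g.1 β) (cardSet κ) ∈ F :=
  ⟨S.eq_of_ultraCollapse_eq f g, S.ultraCollapse_eq_of_eq⟩

lemma ultraCollapse_mem_iff (S : UltraSetup κ θ U F) {f g : UltraFun κ U} : ultraCollapse S.wf f ∈ ultraCollapse S.wf g ↔
    ZFSet.sep (fun β => app f.1 β ∈ app g.1 β) (cardSet κ) ∈ F := by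
  rw [← ultraMem_iff, mem_ultraCollapse]
  constructor
  · rintro ⟨e, he, hef⟩
    rw [S.ultraCollapse_eq_iff] at hef
    rw [ultraMem_iff] at he ⊢
    exact S.mono₂ hef he (S.sep_app₂ (fun _ a b => a ∈ b) f g) fun β _ a b => a ▸ b
  · exact fun h => ⟨f, h, rfl⟩

end UltraSetup

end

/-! ### Łoś's theorem and the embedding into the ultrapower -/

instance {Γ : Type (u + 1)} [Ctx Γ] (n : ℕ) (s : Γ → (Fin n → ZFSet.{u})) (t : Γ → ZFSet.{u})
    [hs : IsProj s] [ht : IsProj t] :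
    IsProj (fun g => (Fin.snoc (s g) (t g) : Fin (n + 1) → ZFSet.{u})) := by
  obtain ⟨σ, hσ⟩ := hs.out
  obtain ⟨τ, hτ⟩ := ht.out
  exact ⟨Fin.snoc (α := fun _ => Ctx.ι Γ) σ (τ ()), fun g i => by
    refine Fin.lastCases ?_ (fun i => ?_) i
    · have := hτ g ()
      simpa [Ctx.var] using this
    · have := hσ g i
      simpa [Ctx.var] using this⟩

/-- `Sat` for bounded formulas without free variables. -/
def BSat {n : ℕ} (φ : setLang.BoundedFormula Empty n) (T : Set ZFSet.{u}) (v : Fin n → ZFSet.{u}) :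
    Prop :=
  Sat (φ.toFormula.relabel (Sum.elim Empty.elim id)) T v

instance Def.bsat {Γ : Type (u + 1)} [Ctx Γ] {n : ℕ} (φ : setLang.BoundedFormula Empty n)
    (t : Γ → (Fin n → ZFSet.{u})) [IsProj t] : Def (fun T g => BSat φ T (t g)) :=
  Def.sat _ t

lemma bsat_iff {n : ℕ} (φ : setLang.BoundedFormula Empty n) {T : Set ZFSet.{u}}
    {v : Fin n → ZFSet.{u}} (h : ∀ i, v i ∈ T) :
    BSat φ T v ↔ φ.Realize default (fun i => (⟨v i, h i⟩ : {x // x ∈ T})) := by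
  have : BSat φ T v ↔ (φ.toFormula.relabel (Sum.elim Empty.elim id)).Realize
      (fun i => (⟨v i, h i⟩ : {x // x ∈ T})) := ⟨fun h => h.2, fun h' => ⟨h, h'⟩⟩
  rw [this, Language.Formula.realize_relabel, Language.BoundedFormula.realize_toFormula]
  exact iff_of_eq (congrArg₂ _ (funext fun e => Empty.elim e) rfl)

lemma term_eq_var {n : ℕ} (t : setLang.Term (Empty ⊕ Fin n)) :
    ∃ i, t = Language.Term.var (Sum.inr i) := by
  rcases t with (e | i) | ⟨f, _⟩
  · exact Empty.elim e
  · exact ⟨i, rfl⟩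
  · exact Empty.elim f

section

variable {κ θ : Cardinal.{u}} {U F : ZFSet.{u}}

/-- The transitive collapse of the ultrapower of `U` by `F`. -/
noncomputable def ultrapower (hwf : WellFoundedUltrapower κ U F) : ZFSet.{u} :=
  ZFSet.range (ultraCollapse hwf)

lemma ultraCollapse_mem_ultrapower (hwf : WellFoundedUltrapower κ U F) (f : UltraFun κ U) :
    ultraCollapse hwf f ∈ ultrapower hwf := ZFSet.mem_range_self f

lemma isTransitive_ultrapower (hwf : WellFoundedUltrapower κ U F) :
    (ultrapower hwf).IsTransitive := by
  intro y hy z hz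
  obtain ⟨f, rfl⟩ := ZFSet.mem_range.1 hy
  obtain ⟨g, _, rfl⟩ := (mem_ultraCollapse hwf).1 hz
  exact ultraCollapse_mem_ultrapower hwf g

namespace UltraSetup

lemma empty_notMem (S : UltraSetup κ θ U F) : ∅ ∉ F := fun h => by
  obtain ⟨x, hx, _⟩ := S.normal.filter.inter_nonempty S.regular.ne_zero h h
  simp at hx

lemma sep_const_mem_iff (S : UltraSetup κ θ U F) {p : Prop} :
    ZFSet.sep (fun _ => p) (cardSet κ) ∈ F ↔ p := by
  by_cases h : p
  · have : ZFSet.sep (fun _ => p) (cardSet κ) = cardSet κ := by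
      ext x
      simp [h]
    rw [this]
    simp [h, S.univ_mem]
  · have : ZFSet.sep (fun _ => p) (cardSet κ) = ∅ := by
      rw [ZFSet.eq_empty]
      intro x
      simp [h]
    rw [this]
    simp [h, S.empty_notMem]

lemma mem_congr {p q : ZFSet.{u} → Prop} (h : ∀ β ∈ cardSet κ, p β ↔ q β) :
    ZFSet.sep p (cardSet κ) ∈ F ↔ ZFSet.sep q (cardSet κ) ∈ F := by
  have : ZFSet.sep p (cardSet κ) = ZFSet.sep q (cardSet κ) := by
    ext x
    rw [ZFSet.mem_sep, ZFSet.mem_sep]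
    exact and_congr_right fun hx => h x hx
  rw [this]

/-- Łoś's theorem. -/
lemma realize_iff (S : UltraSetup κ θ U F) {n : ℕ} (φ : setLang.BoundedFormula Empty n) :
    ∀ v : Fin n → UltraFun κ U,
      φ.Realize default (fun i => (⟨ultraCollapse S.wf (v i), ultraCollapse_mem_ultrapower _ _⟩ :
        {x // x ∈ ultrapower S.wf})) ↔
      ZFSet.sep (fun β => BSat φ (H θ) fun i => app (v i).1 β) (cardSet κ) ∈ F := by
  have hH : ∀ (f : UltraFun κ U) β, β ∈ cardSet κ → app f.1 β ∈ H θ :=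
    fun f β hβ => S.elem.subset (S.app_mem f hβ)
  induction φ with
  | falsum =>
    intro v
    rw [mem_congr (q := fun _ => False) fun β hβ => by
      rw [bsat_iff _ fun i => hH (v i) β hβ]; rfl, S.sep_const_mem_iff]
    rfl
  | equal t₁ t₂ =>
    intro v
    obtain ⟨i, rfl⟩ := term_eq_var t₁
    obtain ⟨j, rfl⟩ := term_eq_var t₂
    rw [mem_congr (q := fun β => app (v i).1 β = app (v j).1 β) fun β hβ => by
      rw [bsat_iff _ fun i => hH (v i) β hβ]
      exact Subtype.ext_iff, ← S.ultraCollapse_eq_iff]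
    exact Subtype.ext_iff
  | rel R ts =>
    intro v
    cases R
    obtain ⟨i, hi⟩ := term_eq_var (ts 0)
    obtain ⟨j, hj⟩ := term_eq_var (ts 1)
    have key : ∀ {p : ZFSet.{u} → Prop} (w : _ → {x // p x}),
        (Language.BoundedFormula.rel (L := setLang) (α := Empty) MemRel.mem ts).Realize default w ↔
          (w i).1 ∈ (w j).1 := fun w => by
      change (Language.Term.realize (Sum.elim default w) (ts 0)).1 ∈
        (Language.Term.realize (Sum.elim default w) (ts 1)).1 ↔ _
      rw [hi, hj]
      exact Iff.rfl
    rw [mem_congr (q := fun β => app (v i).1 β ∈ app (v j).1 β) fun β hβ => by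
      rw [bsat_iff _ fun i => hH (v i) β hβ]
      exact key _, ← S.ultraCollapse_mem_iff]
    exact key _
  | imp φ ψ ih₁ ih₂ =>
    intro v
    rw [Language.BoundedFormula.realize_imp, ih₁, ih₂,
      mem_congr (p := fun β => BSat (φ.imp ψ) (H θ) fun i => app (v i).1 β)
      (q := fun β => BSat φ (H θ) (fun i => app (v i).1 β) →
        BSat ψ (H θ) fun i => app (v i).1 β) fun β hβ => by
        rw [bsat_iff _ fun i => hH (v i) β hβ, bsat_iff _ fun i => hH (v i) β hβ,
          bsat_iff _ fun i => hH (v i) β hβ]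
        exact Language.BoundedFormula.realize_imp]
    have h1 := S.sep_app_mem (fun T _ w => BSat φ T w) v
    have h2 := S.sep_app_mem (fun T _ w => BSat ψ T w) v
    have h3 := S.sep_app_mem (fun T _ w => BSat φ T w → BSat ψ T w) v
    constructor
    · intro h
      -- The set where `φ` holds is definable, hence in `U`, so it or its complement is in `F`.
      by_cases hφ : ZFSet.sep (fun β => BSat φ (H θ) fun i => app (v i).1 β) (cardSet κ) ∈ F
      · exact S.mono (h hφ) h3 fun β _ h _ => h
      · exact S.mono (S.not_mem h1 hφ) h3 fun β _ h h' => absurd h' h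
    · exact fun h hφ => S.mono₂ h hφ h2 fun β _ h h' => h h'
  | all φ ih =>
    intro v
    have hsnoc : ∀ (f : UltraFun κ U) β, (fun i => app (Fin.snoc (α := fun _ => UltraFun κ U)
        v f i).1 β) = Fin.snoc (α := fun _ => ZFSet.{u}) (fun i => app (v i).1 β) (app f.1 β) :=
      fun f β => by
        funext i
        refine Fin.lastCases ?_ (fun i => ?_) i <;> simp
    rw [mem_congr (p := fun β => BSat φ.all (H θ) fun i => app (v i).1 β)
      (q := fun β => ∀ x, x ∈ H θ → BSat φ (H θ)
        (Fin.snoc (α := fun _ => ZFSet.{u}) (fun i => app (v i).1 β) x)) fun β hβ => by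
        rw [bsat_iff _ fun i => hH (v i) β hβ, Language.BoundedFormula.realize_all]
        rw [Subtype.forall]
        refine forall₂_congr fun x hx => ?_
        rw [bsat_iff φ (v := Fin.snoc (α := fun _ => ZFSet.{u}) (fun i => app (v i).1 β) x)
          fun i => by
            refine Fin.lastCases ?_ (fun i => ?_) i
            · simpa using hx
            · simpa using hH (v i) β hβ]
        refine iff_of_eq (congrArg _ (funext fun i => Subtype.ext ?_))
        refine Fin.lastCases ?_ (fun i => ?_) i <;> simp]
    have hall : φ.all.Realize default (fun i => (⟨ultraCollapse S.wf (v i),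
        ultraCollapse_mem_ultrapower _ _⟩ : {x // x ∈ ultrapower S.wf})) ↔
        ∀ f : UltraFun κ U, ZFSet.sep (fun β => BSat φ (H θ)
          (Fin.snoc (α := fun _ => ZFSet.{u}) (fun i => app (v i).1 β) (app f.1 β)))
            (cardSet κ) ∈ F := by
      have : ∀ f : UltraFun κ U, (φ.Realize default (Fin.snoc (α := fun _ =>
          {x // x ∈ ultrapower S.wf}) (fun i => ⟨ultraCollapse S.wf (v i),
          ultraCollapse_mem_ultrapower _ _⟩)
            ⟨ultraCollapse S.wf f, ultraCollapse_mem_ultrapower _ _⟩) ↔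
          ZFSet.sep (fun β => BSat φ (H θ)
          (Fin.snoc (α := fun _ => ZFSet.{u}) (fun i => app (v i).1 β) (app f.1 β)))
            (cardSet κ) ∈ F) := fun f => by
        simp only [← hsnoc]
        rw [← ih]
        refine iff_of_eq (congrArg _ (funext fun i => Subtype.ext ?_))
        refine Fin.lastCases ?_ (fun i => ?_) i <;> simp
      rw [Language.BoundedFormula.realize_all]
      constructor
      · exact fun h f => (this f).1 (h _)
      · rintro h ⟨a, ha⟩
        obtain ⟨f, rfl⟩ := ZFSet.mem_range.1 ha
        exact (this f).2 (h f)
    rw [hall]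
    have hU := S.sep_app_mem (fun T _ w => ∀ x, x ∈ T → BSat φ T
      (Fin.snoc (α := fun _ => ZFSet.{u}) w x)) v
    constructor
    · intro h
      by_contra hcon
      have h1 := S.not_mem hU hcon
      -- If the universal statement fails on a set in `F`, counterexamples are chosen by a function
      -- in `U`, which contradicts `h` for that function.
      obtain ⟨f, hf⟩ := S.exists_ultraFun (fun T w x => ¬ BSat φ T
        (Fin.snoc (α := fun _ => ZFSet.{u}) w x)) v
      obtain ⟨β, hβ, h2, h3⟩ := S.exists_of_mem₂ h1 (h f)
      push Not at h2
      exact hf β hβ h2 h3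
    · intro h f
      have h4 := S.sep_app_mem (fun T _ w => BSat φ T w) (Fin.snoc (α := fun _ => UltraFun κ U) v f)
      simp only [hsnoc] at h4
      exact S.mono h h4 fun β hβ h5 => h5 _ (hH f β hβ)

/-- The constant function with a given value. -/
noncomputable def const (S : UltraSetup κ θ U F) (x : {x // x ∈ U}) : UltraFun κ U :=
  ⟨graph (cardSet κ) fun _ => x.1, S.elem.graph_mem S.regular' (fun _ (g : ZFSet.{u}) _ w => w = g)
    (g := x.1) (by simp) S.card_mem fun _ _ => ⟨S.elem.subset x.2, fun _ _ => Iff.rfl⟩,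
    {x.1}, isFunc_graph fun _ _ => by simp⟩

lemma app_const (S : UltraSetup κ θ U F) (x : {x // x ∈ U}) {β : ZFSet.{u}} (hβ : β ∈ cardSet κ) :
    app (S.const x).1 β = x.1 :=
  app_graph (f := fun _ => x.1) hβ

/-- The embedding into the ultrapower. -/
noncomputable def embedding (S : UltraSetup κ θ U F) :
    {x // x ∈ U} ↪ₑ[setLang] {x // x ∈ ultrapower S.wf} where
  toFun x := ⟨ultraCollapse S.wf (S.const x), ultraCollapse_mem_ultrapower _ _⟩
  map_formula' n φ x := by
    rw [← φ.realize_relabel_sumInr (v := default), ← φ.realize_relabel_sumInr (v := default)]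
    -- For constant functions the set in Łoś's theorem is κ or empty according to truth in H(θ),
    -- which agrees with truth in `U`.
    have h1 := S.realize_iff (n := n) (Language.BoundedFormula.relabel Sum.inr φ)
      (fun i => S.const (x i))
    refine h1.trans ?_
    rw [mem_congr (q := fun _ => BSat (n := n) (Language.BoundedFormula.relabel Sum.inr φ) (H θ)
      fun i => (x i).1) fun β hβ => by simp only [S.app_const _ hβ], S.sep_const_mem_iff]
    refine (sat_cons_iff S.elem _ x).trans ?_
    rw [Language.Formula.realize_relabel, Language.BoundedFormula.realize_toFormula]
    exact iff_of_eq (congrArg₂ _ (funext fun e => Empty.elim e) rfl)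

end UltraSetup

end

/-! ### Filter sequences give powerset preserving embeddings -/

section

variable {α κ θ : Cardinal.{u}} {U F : ZFSet.{u}}

lemma mem_of_mem_of_mem_cardSet {β x z : ZFSet.{u}} (hβ : β ∈ cardSet κ) (hx : x ∈ β)
    (hz : z ∈ x) : z ∈ β := by
  obtain ⟨o, _, rfl⟩ := Ordinal.mem_toZFSet_iff.1 hβ
  exact (ZFSet.isOrdinal_toZFSet o).isTransitive.mem_trans hz hx

lemma mem_cardSet_of_mem {β x : ZFSet.{u}} (hβ : β ∈ cardSet κ) (hx : x ∈ β) : x ∈ cardSet κ :=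
  (ZFSet.isOrdinal_toZFSet _).isTransitive.mem_trans hx hβ

namespace UltraSetup

lemma exists_const (S : UltraSetup κ θ U F) {g : UltraFun κ U}
    (h : ZFSet.sep (fun β => app g.1 β ∈ β) (cardSet κ) ∈ F) :
    ∃ δ ∈ cardSet κ, ZFSet.sep (fun β => app g.1 β = δ) (cardSet κ) ∈ F := by
  obtain ⟨g, hg, y, hy⟩ := g
  exact S.normal.exists_const S.regular S.regular' S.elem S.card_mem S.card_subset hg hy h

lemma tail_mem (S : UltraSetup κ θ U F) {γ : ZFSet.{u}} (hγ : γ ∈ cardSet κ) :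
    ZFSet.sep (fun β => γ ∈ β) (cardSet κ) ∈ F :=
  S.normal.tail_mem S.regular S.elem S.card_mem S.card_subset hγ

lemma ultraCollapse_eq_of_const (S : UltraSetup κ θ U F) {g : UltraFun κ U} {δ : {x // x ∈ U}}
    (h : ZFSet.sep (fun β => app g.1 β = δ.1) (cardSet κ) ∈ F) :
    ultraCollapse S.wf g = ultraCollapse S.wf (S.const δ) := by
  rw [S.ultraCollapse_eq_iff, mem_congr (q := fun β => app g.1 β = δ.1) fun β hβ => by
    rw [S.app_const _ hβ] ]
  exact h

lemma ultraCollapse_const_mem_iff (S : UltraSetup κ θ U F) (x y : {x // x ∈ U}) :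
    ultraCollapse S.wf (S.const x) ∈ ultraCollapse S.wf (S.const y) ↔ x.1 ∈ y.1 := by
  rw [S.ultraCollapse_mem_iff, mem_congr (q := fun _ => x.1 ∈ y.1) fun β hβ => by
    rw [S.app_const _ hβ, S.app_const _ hβ], S.sep_const_mem_iff]

/-- The embedding fixes ordinals below κ by ∈-induction: a function below the constant `x` is
regressive at every β > `x` on a set in `F`, so by normality it is constant modulo `F` with a value
in `x`. -/
lemma ultraCollapse_const (S : UltraSetup κ θ U F) (x : ZFSet.{u}) : ∀ hx : x ∈ cardSet κ,
    ultraCollapse S.wf (S.const ⟨x, S.card_subset hx⟩) = x := by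
  induction x using ZFSet.inductionOn with
  | _ x ih =>
    intro hx
    ext z
    constructor
    · intro hz
      obtain ⟨g, hg, rfl⟩ := (mem_ultraCollapse S.wf).1 hz
      rw [ultraMem_iff, mem_congr (q := fun β => app g.1 β ∈ x) fun β hβ => by
        rw [S.app_const _ hβ] ] at hg
      obtain ⟨δ, hδ, hgδ⟩ := S.exists_const (S.mono₂ hg (S.tail_mem hx)
        (S.sep_app₁ (fun _ a b => b ∈ a) g)
        fun β hβ h1 h2 => mem_of_mem_of_mem_cardSet hβ h2 h1)
      obtain ⟨β, hβ, h1, h2⟩ := S.exists_of_mem₂ hgδ hg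
      have hδx : δ ∈ x := h1 ▸ h2
      rw [S.ultraCollapse_eq_of_const (δ := ⟨δ, S.card_subset hδ⟩) hgδ, ih δ hδx hδ]
      exact hδx
    · intro hz
      have hzk := mem_cardSet_of_mem hx hz
      rw [← ih z hz hzk]
      exact (S.ultraCollapse_const_mem_iff _ _).2 hz

/-- The function `β ↦ B ∩ β`, which represents `B` in the ultrapower. -/
noncomputable def restrict (S : UltraSetup κ θ U F) (B : {x // x ∈ U}) : UltraFun κ U :=
  ⟨graph (cardSet κ) fun β => B.1 ∩ β,
    S.elem.graph_mem S.regular' (fun T (g : ZFSet.{u}) β w => ∀ x, x ∈ T →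
      (x ∈ w ↔ x ∈ g ∧ x ∈ β)) (g := B.1) (by simp) S.card_mem fun β hβ =>
      ⟨mem_H_of_subset (S.elem.subset B.2) fun x hx => (ZFSet.mem_inter.1 hx).1, fun w hw => by
        constructor
        · intro h
          ext x
          rw [ZFSet.mem_inter]
          exact ⟨fun hx => (h x (transClass_H θ w hw x hx)).1 hx, fun hx =>
            (h x (transClass_H θ _ (S.elem.subset B.2) x hx.1)).2 hx⟩
        · rintro rfl x _
          exact ZFSet.mem_inter⟩,
    ZFSet.powerset B.1, isFunc_graph fun β _ => by
      rw [ZFSet.mem_powerset]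
      exact fun x hx => (ZFSet.mem_inter.1 hx).1⟩

lemma app_restrict (S : UltraSetup κ θ U F) (B : {x // x ∈ U}) {β : ZFSet.{u}}
    (hβ : β ∈ cardSet κ) : app (S.restrict B).1 β = B.1 ∩ β :=
  app_graph (f := fun β => B.1 ∩ β) hβ

/-- A function with values in `B ∩ β` is regressive and hence constant modulo `F` with value in `B`;
conversely, each γ ∈ `B` lies in `B ∩ β` for all β > γ. Hence the ultrapower contains every subset
of κ in `U`. -/
lemma ultraCollapse_restrict (S : UltraSetup κ θ U F) (B : {x // x ∈ U}) (hB : B.1 ⊆ cardSet κ) :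
    ultraCollapse S.wf (S.restrict B) = B.1 := by
  ext z
  constructor
  · intro hz
    obtain ⟨g, hg, rfl⟩ := (mem_ultraCollapse S.wf).1 hz
    rw [ultraMem_iff, mem_congr (q := fun β => app g.1 β ∈ B.1 ∧ app g.1 β ∈ β) fun β hβ => by
      rw [S.app_restrict _ hβ, ZFSet.mem_inter] ] at hg
    obtain ⟨δ, hδ, hgδ⟩ := S.exists_const (S.mono hg
      (S.sep_app₁ (fun _ a b => b ∈ a) g) fun β hβ h => h.2)
    obtain ⟨β, hβ, h1, h2⟩ := S.exists_of_mem₂ hgδ hg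
    rw [S.ultraCollapse_eq_of_const (δ := ⟨δ, S.card_subset hδ⟩) hgδ, S.ultraCollapse_const δ hδ]
    exact h1 ▸ h2.1
  · intro hz
    have hzk := hB hz
    have h : ultraCollapse S.wf (S.const ⟨z, S.card_subset hzk⟩) ∈
        ultraCollapse S.wf (S.restrict B) := by
      rw [S.ultraCollapse_mem_iff, mem_congr (q := fun β => z ∈ β) fun β hβ => by
        rw [S.app_restrict _ hβ, S.app_const _ hβ, ZFSet.mem_inter, and_iff_right hz] ]
      exact S.tail_mem hzk
    rwa [S.ultraCollapse_const z hzk] at h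

/-- The function β ↦ κ ∩ β = β represents κ and is pointwise below the constant κ, so κ lies in its
own image. -/
lemma ultraCollapse_const_card_ne (S : UltraSetup κ θ U F) :
    ultraCollapse S.wf (S.const ⟨cardSet κ, S.card_mem⟩) ≠ cardSet κ := fun h => by
  have h1 : ultraCollapse S.wf (S.restrict ⟨cardSet κ, S.card_mem⟩) ∈
      ultraCollapse S.wf (S.const ⟨cardSet κ, S.card_mem⟩) := by
    rw [S.ultraCollapse_mem_iff, mem_congr (q := fun _ => True) fun β hβ => by
      rw [S.app_restrict _ hβ, S.app_const _ hβ, iff_true]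
      have : cardSet κ ∩ β = β := by
        ext x
        rw [ZFSet.mem_inter]
        exact and_iff_right_of_imp (mem_cardSet_of_mem hβ)
      rwa [this], S.sep_const_mem_iff]
    trivial
  rw [h, S.ultraCollapse_restrict _ fun _ hx => hx] at h1
  exact ZFSet.mem_irrefl _ h1

lemma mem_ultraCollapse_iff_of_mem (S : UltraSetup κ θ U F) (g : UltraFun κ U) {γ : ZFSet.{u}}
    (hγ : γ ∈ cardSet κ) : γ ∈ ultraCollapse S.wf g ↔
      ZFSet.sep (fun β => γ ∈ app g.1 β) (cardSet κ) ∈ F := by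
  have := S.ultraCollapse_mem_iff (f := S.const ⟨γ, S.card_subset hγ⟩) (g := g)
  rw [S.ultraCollapse_const γ hγ] at this
  rw [this]
  exact mem_congr fun β hβ => by rw [S.app_const _ hβ]

end UltraSetup

end

/-! ### The union of a filter sequence as a weak model -/

section

variable {α κ θ : Cardinal.{u}} {M : Ordinal.{u} → ZFSet.{u}} {F : ZFSet.{u}}

lemma IsFilterSequence.ultraSetup (hα : α.IsRegular) (hκ : κ.IsRegular) (hθ : θ.IsRegular)
    (hs : IsFilterSequence α.ord κ M F) (hwf : WellFoundedUltrapower κ (seqUnion α.ord M) F)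
    (hel : ∀ i < α.ord, ElemSub (M i) (H θ)) : UltraSetup κ θ (seqUnion α.ord M) F where
  regular := hκ
  regular' := hθ
  elem := hs.elemSub hα hel
  card_mem := hs.card_mem hα
  card_subset := hs.card_subset hα
  normal := hs.normal
  wf := hwf

/-- If `g` ∈ `M i` represents `B`, then γ ∈ `B` if and only if the set of β with γ ∈ g(β) is in `F`.
All of these sets lie in `M i`, so `B` is definable from `F ∩ M i`, which amenability puts into `M
(i + 1)`. -/
lemma IsFilterSequence.mem_of_mem_ultrapower (hα : α.IsRegular)
    (hs : IsFilterSequence α.ord κ M F) (hel : ∀ i < α.ord, ElemSub (M i) (H θ))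
    (S : UltraSetup κ θ (seqUnion α.ord M) F) {B : ZFSet.{u}} (hB : B ∈ ultrapower S.wf)
    (hBk : B ⊆ cardSet κ) : B ∈ seqUnion α.ord M := by
  obtain ⟨g, rfl⟩ := ZFSet.mem_range.1 hB
  obtain ⟨i, hi, hgi⟩ := mem_seqUnion.1 g.2.1
  obtain ⟨y, hy⟩ := g.2.2
  have hm := (hs.model i hi).toIsWeakModel
  have hi' := add_one_lt_ord hα hi
  have hii : i < i + 1 := lt_add_one i
  have hsep : ∀ γ, ZFSet.sep (fun β => γ ∈ app g.1 β) (cardSet κ) =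
      ZFSet.sep (fun β => ∃ w, w ∈ H θ ∧ (ZFSet.pair β w ∈ g.1 ∧ γ ∈ w)) (cardSet κ) := fun γ => by
    ext β
    simp only [ZFSet.mem_sep]
    refine and_congr_right fun hβ => ⟨fun h => ⟨_, S.elem.subset (S.app_mem g hβ),
      app_spec hy hβ, h⟩, ?_⟩
    rintro ⟨w, _, hw, hγ⟩
    rwa [← ((pair_mem_iff hy).1 hw).2]
  have hmem : ∀ γ ∈ cardSet κ, ZFSet.sep (fun β => γ ∈ app g.1 β) (cardSet κ) ∈ M i :=
    fun γ hγ => by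
      rw [hsep]
      exact (hel i hi).sep_mem (fun T (q : ZFSet.{u} × ZFSet.{u}) β => ∃ w, w ∈ T ∧
        (ZFSet.pair β w ∈ q.1 ∧ q.2 ∈ w)) (g := (g.1, γ)) (by simp [hgi, hm.card_subset hγ])
        hm.card_mem
  have := (hel _ hi').sep_mem (fun T (q : ZFSet.{u} × ZFSet.{u} × ZFSet.{u}) γ => ∃ Z, Z ∈ q.1 ∧
    ∀ β, β ∈ q.2.1 → (β ∈ Z ↔ ∃ w, w ∈ T ∧ (ZFSet.pair β w ∈ q.2.2 ∧ γ ∈ w)))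
    (g := (F ∩ M i, cardSet κ, g.1))
    (by simp [hs.amenable i hi', (hs.model _ hi').card_mem, hs.subset _ _ hii hi' hgi])
    (hs.model _ hi').card_mem
  refine mem_seqUnion.2 ⟨i + 1, hi', ?_⟩
  convert this using 1
  ext γ
  rw [ZFSet.mem_sep]
  constructor
  · intro hγ
    have hγk := hBk hγ
    rw [S.mem_ultraCollapse_iff_of_mem g hγk] at hγ
    refine ⟨hγk, _, ZFSet.mem_inter.2 ⟨hγ, hmem γ hγk⟩, fun β hβ => ?_⟩
    rw [hsep, ZFSet.mem_sep, and_iff_right hβ]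
  · rintro ⟨hγk, Z, hZ, hZ'⟩
    rw [S.mem_ultraCollapse_iff_of_mem g hγk, hsep]
    have hZF := (ZFSet.mem_inter.1 hZ).1
    convert hZF using 1
    ext β
    rw [ZFSet.mem_sep]
    exact ⟨fun h => (hZ' β h.1).2 h.2, fun h => ⟨hs.normal.filter.1 Z hZF h,
      (hZ' β (hs.normal.filter.1 Z hZF h)).1 h⟩⟩

lemma IsFilterSequence.card_seqUnion (hα : α.IsRegular) (hκ : κ.IsRegular) (hακ : α ≤ κ)
    (hs : IsFilterSequence α.ord κ M F) : (seqUnion α.ord M).card = κ := by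
  refine le_antisymm ?_ ?_
  · refine (ZFSet.card_mono (y := bUnion (cardSet α) fun z => M z.rank) fun x hx => ?_).trans
      (card_bUnion_le hκ.aleph0_le (by rwa [card_cardSet]) fun z hz => ?_)
    · obtain ⟨i, hi, hx⟩ := mem_seqUnion.1 hx
      rw [mem_bUnion]
      exact ⟨i.toZFSet, Ordinal.mem_toZFSet_iff.2 ⟨i, hi, rfl⟩, by simpa using hx⟩
    · obtain ⟨i, hi, rfl⟩ := Ordinal.mem_toZFSet_iff.1 hz
      simpa using (hs.model i hi).card_eq.le
  · rw [← (hs.model 0 hα.ord_pos).card_eq]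
    exact ZFSet.card_mono (IsFilterSequence.subset_seqUnion hα.ord_pos)

/-- By regularity of α the values of a shorter sequence lie in one `M j`, which is closed under
sequences of length less than κ. -/
lemma IsFilterSequence.closedUnderLT (hα : α.IsRegular) (hακ : α ≤ κ)
    (hs : IsFilterSequence α.ord κ M F) : ClosedUnderLT (seqUnion α.ord M) α.ord := by
  classical
  intro β hβ s hsf
  let r : ZFSet.{u} → Ordinal.{u} := fun z =>
    if h : ∃ i < α.ord, app s z ∈ M i then h.choose else 0
  have hr : ∀ z ∈ β.toZFSet, r z < α.ord ∧ app s z ∈ M (r z) := fun z hz => by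
    have h := mem_seqUnion.1 (app_mem hsf hz)
    simp only [r, dif_pos h]
    exact h.choose_spec
  obtain ⟨j, hj, hj'⟩ := exists_bound hα (x := β.toZFSet) (by simpa using Cardinal.lt_ord.1 hβ)
    fun z hz => (hr z hz).1
  refine mem_seqUnion.2 ⟨j, hj, (hs.model j hj).closed β
    (hβ.trans_le (Cardinal.ord_le_ord.2 hακ)) s (isFunc_app hsf fun z hz => ?_)⟩
  exact subset_of_le hs.subset (hj' z hz) hj (hr z hz).2

/-- A well-founded filter sequence yields a powerset preserving embedding. -/
theorem IsFilterSequence.exists_isPowersetPreserving (hα : α.IsRegular) (hκ : κ.IsRegular)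
    (hακ : α ≤ κ) (hθ : θ.IsRegular) (hs : IsFilterSequence α.ord κ M F)
    (hwf : WellFoundedUltrapower κ (seqUnion α.ord M) F)
    (hel : ∀ i < α.ord, ElemSub (M i) (H θ)) {A : ZFSet.{u}} (hA : A ∈ M 0) :
    ∃ U : ZFSet.{u}, A ∈ U ∧ IsWeakModel κ U ∧ ElemSubH U θ ∧ ClosedUnderLT U α.ord ∧
      ∃ N : ZFSet.{u}, N.IsTransitive ∧
        ∃ j : {x // x ∈ U} ↪ₑ[setLang] {x // x ∈ N}, IsPowersetPreserving κ U N j := by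
  have S := hs.ultraSetup hα hκ hθ hwf hel
  have hsub := IsFilterSequence.subset_seqUnion (M := M) hα.ord_pos
  have hord : ∀ β ≤ κ.ord, β.toZFSet ∈ seqUnion α.ord M := fun β hβ =>
    hsub ((hs.model 0 hα.ord_pos).ordinals β hβ)
  refine ⟨seqUnion α.ord M, hsub hA, ⟨hs.card_seqUnion hα hκ hακ, hord,
    S.elem.modelsZFCMinus hθ fun o ho => hord o (ho.trans ?_)⟩, S.elem,
    hs.closedUnderLT hα hακ, ultrapower S.wf, isTransitive_ultrapower _, S.embedding, ?_, ?_, ?_⟩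
  · rw [← Cardinal.ord_aleph0]
    exact Cardinal.ord_le_ord.2 hκ.aleph0_le
  · exact fun x hx => S.ultraCollapse_const x.1 hx
  · exact ⟨⟨_, S.card_mem⟩, rfl, S.ultraCollapse_const_card_ne⟩
  · intro B hB
    constructor
    · intro hBU
      have := ultraCollapse_mem_ultrapower S.wf (S.restrict ⟨B, hBU⟩)
      rwa [S.ultraCollapse_restrict ⟨B, hBU⟩ hB] at this
    · exact fun hBN => hs.mem_of_mem_ultrapower hα hel S hBN hB

end

/-! ### Hulls -/

lemma card_sep_card_le {x : ZFSet.{u}} {l ν : Cardinal.{u}} (hl : ℵ₀ ≤ l) (hx : x.card ≤ l) :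
    (ZFSet.sep (fun s => s.card ≤ ν) x.powerset).card ≤ l ^ ν := by
  refine le_trans ?_ ((mk_bounded_set_le (Shrink.{u} x) ν).trans
    (Cardinal.power_le_power_right (max_le (α := Cardinal.{u}) hx hl)))
  rw [← lift_le.{u + 1}, ← ZFSet.cardinalMk_coe_sort]
  let F : (ZFSet.sep (fun s => s.card ≤ ν) x.powerset : ZFSet.{u}) →
      {t : Set (Shrink.{u} x) // #t ≤ ν} := fun s => ⟨{i | ((equivShrink x).symm i).1 ∈ s.1}, by
    have hs := (ZFSet.mem_sep.1 s.2).2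
    refine le_trans ?_ hs
    rw [← lift_le.{u + 1}, ← ZFSet.cardinalMk_coe_sort, ← Cardinal.lift_id'.{u, u + 1} #s.1]
    refine lift_mk_le_lift_mk_of_injective
      (f := fun i => (⟨((equivShrink x).symm i.1).1, i.2⟩ : s.1)) fun i j h => ?_
    have := congrArg (fun z : s.1 => z.1) h
    exact Subtype.ext ((equivShrink x).symm.injective (Subtype.ext this))⟩
  have hF : Function.Injective F := fun s t h => by
    have hsx := ZFSet.mem_powerset.1 (ZFSet.mem_sep.1 s.2).1
    have htx := ZFSet.mem_powerset.1 (ZFSet.mem_sep.1 t.2).1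
    have h' : ∀ i, ((equivShrink x).symm i).1 ∈ s.1 ↔ ((equivShrink x).symm i).1 ∈ t.1 := fun i =>
      Set.ext_iff.1 (congrArg (fun z : {t : Set (Shrink.{u} x) // #t ≤ ν} => z.1) h) i
    have h'' : ∀ z ∈ x, z ∈ s.1 ↔ z ∈ t.1 := fun z hz => by
      have := h' (equivShrink x ⟨z, hz⟩)
      rwa [Equiv.symm_apply_apply] at this
    exact Subtype.ext (ZFSet.ext fun z => ⟨fun hz => (h'' z (hsx hz)).1 hz,
      fun hz => (h'' z (htx hz)).2 hz⟩)
  have := lift_mk_le_lift_mk_of_injective hF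
  rwa [Cardinal.lift_id'.{u, u + 1}] at this

lemma card_sep_card_lt {x : ZFSet.{u}} {l μ : Cardinal.{u}} (hl : ℵ₀ ≤ l) (hμ : μ ≤ l)
    (hpow : ∀ ν < μ, l ^ ν ≤ l) (hx : x.card ≤ l) :
    (ZFSet.sep (fun s => s.card < μ) x.powerset).card ≤ l := by
  refine (ZFSet.card_mono (y := bUnion (cardSet μ) fun β =>
    ZFSet.sep (fun s => s.card ≤ β.card) x.powerset) fun s hs => ?_).trans
      (card_bUnion_le hl (by rwa [card_cardSet]) fun β hβ => ?_)
  · rw [ZFSet.mem_sep] at hs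
    rw [mem_bUnion]
    refine ⟨cardSet s.card, Ordinal.mem_toZFSet_iff.2 ⟨_, Cardinal.ord_lt_ord.2 hs.2, rfl⟩, ?_⟩
    rw [ZFSet.mem_sep]
    exact ⟨hs.1, by rw [card_cardSet]⟩
  · obtain ⟨o, ho, rfl⟩ := Ordinal.mem_toZFSet_iff.1 hβ
    refine (card_sep_card_le hl hx).trans (hpow _ ?_)
    simpa using Cardinal.lt_ord.1 ho

/-- After injecting `x` into κ, a subset of size less than κ is bounded by regularity, so it is a
subset of one of κ many sets of size less than κ, each with at most κ subsets. -/
lemma card_sep_card_lt_of_isRegular {κ : Cardinal.{u}} (hκ : κ.IsRegular)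
    (hpow : ∀ ν < κ, 2 ^ ν ≤ κ) {x : ZFSet.{u}} (hx : x.card ≤ κ) :
    (ZFSet.sep (fun s => s.card < κ) x.powerset).card ≤ κ := by
  obtain ⟨f, hf, hinj⟩ := exists_img_eq (x := x) (y := cardSet κ) (by rwa [card_cardSet])
  refine (ZFSet.card_mono (y := bUnion (cardSet κ) fun β =>
    (ZFSet.sep (fun z => f z ∈ β) x).powerset) fun s hs => ?_).trans
      (card_bUnion_le hκ.aleph0_le (by rw [card_cardSet]) fun β hβ => ?_)
  · rw [ZFSet.mem_sep, ZFSet.mem_powerset] at hs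
    obtain ⟨j, hj, hj'⟩ := exists_bound hκ hs.2 (f := fun z => (f z).rank) fun z hz => by
      obtain ⟨o, ho, h⟩ := Ordinal.mem_toZFSet_iff.1 (hf z (hs.1 hz))
      simpa [← h] using ho
    rw [mem_bUnion]
    refine ⟨(j + 1).toZFSet, Ordinal.mem_toZFSet_iff.2 ⟨_, add_one_lt_ord hκ hj, rfl⟩,
      ZFSet.mem_powerset.2 fun z hz => ZFSet.mem_sep.2 ⟨hs.1 hz, ?_⟩⟩
    have h1 := hj' z hz
    obtain ⟨o, ho, h⟩ := Ordinal.mem_toZFSet_iff.1 (hf z (hs.1 hz))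
    rw [← h, Ordinal.rank_toZFSet] at h1
    rw [← h]
    exact Ordinal.mem_toZFSet_iff.2 ⟨o, Order.lt_add_one_iff.2 h1, rfl⟩
  · obtain ⟨o, ho, rfl⟩ := Ordinal.mem_toZFSet_iff.1 hβ
    rw [ZFSet.card_powerset]
    refine hpow _ ((card_le_of_injOn (y := o.toZFSet) (f := f) (fun z hz => (ZFSet.mem_sep.1 hz).2)
      fun z hz w hw h => hinj z (ZFSet.mem_sep.1 hz).1 w (ZFSet.mem_sep.1 hw).1 h).trans_lt ?_)
    simpa using Cardinal.lt_ord.1 ho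

/-- The sequence obtained by iterating a set operation. -/
noncomputable def iter (S : ZFSet.{u} → ZFSet.{u}) : Ordinal.{u} → ZFSet.{u} :=
  WellFounded.fix (r := (· < ·)) Ordinal.lt_wf fun i ih =>
    S (ZFSet.iUnion fun j : Set.Iio i => ih j.1 j.2)

lemma iter_eq (S : ZFSet.{u} → ZFSet.{u}) (i : Ordinal.{u}) :
    iter S i = S (ZFSet.iUnion fun j : Set.Iio i => iter S j.1) :=
  WellFounded.fix_eq (r := (· < ·)) Ordinal.lt_wf _ i

/-- Closure of a small set under a function and under small subsets. -/
lemma exists_hull {l μ : Cardinal.{u}} (hμ : μ.IsRegular) (hμl : μ ≤ l)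
    (hpow : ∀ x : ZFSet.{u}, x.card ≤ l → (ZFSet.sep (fun s => s.card < μ) x.powerset).card ≤ l)
    (C : Set ZFSet.{u}) (f : ZFSet.{u} → ZFSet.{u})
    (hf : ∀ x ∈ C, f x ∈ C) (hC : ∀ s : ZFSet.{u}, (∀ x ∈ s, x ∈ C) → s.card < μ → s ∈ C)
    {x₀ : ZFSet.{u}} (hx₀ : ∀ x ∈ x₀, x ∈ C) (hx₀l : x₀.card ≤ l) :
    ∃ X : ZFSet.{u}, x₀ ⊆ X ∧ (∀ x ∈ X, x ∈ C) ∧ X.card ≤ l ∧ (∀ x ∈ X, f x ∈ X) ∧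
      ∀ s : ZFSet.{u}, s ⊆ X → s.card < μ → s ∈ X := by
  classical
  have hl : ℵ₀ ≤ l := hμ.aleph0_le.trans hμl
  let S : ZFSet.{u} → ZFSet.{u} := fun y =>
    (x₀ ∪ y) ∪ (img f y ∪ ZFSet.sep (fun s => s.card < μ) y.powerset)
  have hS : ∀ y : ZFSet.{u}, y.card ≤ l → (S y).card ≤ l := fun y hy => by
    have h1 := hpow y hy
    have h2 := (card_img_le f y).trans hy
    have h3 := Cardinal.add_eq_self hl
    calc (S y).card ≤ (l + l) + (l + l) := ZFSet.card_union_le.trans (add_le_add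
          (ZFSet.card_union_le.trans (add_le_add hx₀l hy))
          (ZFSet.card_union_le.trans (add_le_add h2 h1)))
      _ = l := by rw [h3, h3]
  let Y : Ordinal.{u} → ZFSet.{u} := iter S
  let Z : Ordinal.{u} → ZFSet.{u} := fun i => ZFSet.iUnion fun j : Set.Iio i => Y j.1
  have hY : ∀ i, Y i = S (Z i) := iter_eq S
  have hZ : ∀ {i z}, z ∈ Z i ↔ ∃ j < i, z ∈ Y j := by
    intro i z
    simp [Z]
  have hYmem : ∀ {i z}, z ∈ Y i ↔ (z ∈ x₀ ∨ z ∈ Z i) ∨ ((∃ x ∈ Z i, f x = z) ∨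
      (z ⊆ Z i ∧ z.card < μ)) := by
    intro i z
    rw [hY]
    simp [S, ZFSet.mem_union, mem_img, ZFSet.mem_sep]
  have hmono : ∀ {i j : Ordinal.{u}} {z}, i ≤ j → z ∈ Y i → z ∈ Y j := fun {i j z} hij hz => by
    rcases hij.eq_or_lt with rfl | hij
    · exact hz
    · exact hYmem.2 (Or.inl (Or.inr (hZ.2 ⟨i, hij, hz⟩)))
  have hYC : ∀ i, ∀ x ∈ Y i, x ∈ C := fun i => by
    induction i using WellFoundedLT.induction with
    | _ i ih =>
      have hZC : ∀ x ∈ Z i, x ∈ C := fun x hx => by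
        obtain ⟨j, hj, hx⟩ := hZ.1 hx
        exact ih j hj x hx
      intro x hx
      rcases hYmem.1 hx with (h | h) | ⟨w, hw, rfl⟩ | ⟨h, h'⟩
      exacts [hx₀ x h, hZC x h, hf w (hZC w hw), hC x (fun z hz => hZC z (h hz)) h']
  have hYl : ∀ i < μ.ord, (Y i).card ≤ l := fun i => by
    induction i using WellFoundedLT.induction with
    | _ i ih =>
      intro hi
      rw [hY]
      refine hS _ ((ZFSet.card_mono (y := bUnion i.toZFSet fun z => Y z.rank) fun x hx => ?_).trans
        (card_bUnion_le hl ?_ fun z hz => ?_))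
      · obtain ⟨j, hj, hx⟩ := hZ.1 hx
        rw [mem_bUnion]
        exact ⟨j.toZFSet, Ordinal.mem_toZFSet_iff.2 ⟨j, hj, rfl⟩, by simpa using hx⟩
      · simpa using (Cardinal.lt_ord.1 hi).le.trans hμl
      · obtain ⟨j, hj, rfl⟩ := Ordinal.mem_toZFSet_iff.1 hz
        simpa using ih j hj (hj.trans hi)
  have hX : ∀ {z}, z ∈ bUnion (cardSet μ) (fun z => Y z.rank) ↔ ∃ i < μ.ord, z ∈ Y i := by
    intro z
    rw [mem_bUnion]
    constructor
    · rintro ⟨o, ho, hz⟩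
      obtain ⟨j, hj, rfl⟩ := Ordinal.mem_toZFSet_iff.1 ho
      exact ⟨j, hj, by simpa using hz⟩
    · rintro ⟨j, hj, hz⟩
      exact ⟨j.toZFSet, Ordinal.mem_toZFSet_iff.2 ⟨j, hj, rfl⟩, by simpa using hz⟩
  refine ⟨bUnion (cardSet μ) fun z => Y z.rank, fun x hx => hX.2 ⟨0, hμ.ord_pos,
    hYmem.2 (Or.inl (Or.inl hx))⟩, fun x hx => ?_, card_bUnion_le hl (by rwa [card_cardSet])
    fun z hz => ?_, fun x hx => ?_, fun s hs hsc => ?_⟩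
  · obtain ⟨i, _, hx⟩ := hX.1 hx
    exact hYC i x hx
  · obtain ⟨j, hj, rfl⟩ := Ordinal.mem_toZFSet_iff.1 hz
    simpa using hYl j hj
  · obtain ⟨i, hi, hx⟩ := hX.1 hx
    exact hX.2 ⟨i + 1, add_one_lt_ord hμ hi,
      hYmem.2 (Or.inr (Or.inl ⟨x, hZ.2 ⟨i, lt_add_one i, hx⟩, rfl⟩))⟩
  -- A subset of size less than μ is contained in one stage, because μ is regular, and is added at
  -- the next stage.
  · let r : ZFSet.{u} → Ordinal.{u} := fun z =>
      if h : ∃ i < μ.ord, z ∈ Y i then h.choose else 0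
    have hr : ∀ z ∈ s, r z < μ.ord ∧ z ∈ Y (r z) := fun z hz => by
      have h := hX.1 (hs hz)
      simp only [r, dif_pos h]
      exact h.choose_spec
    obtain ⟨j, hj, hj'⟩ := exists_bound hμ hsc fun z hz => (hr z hz).1
    exact hX.2 ⟨j + 1, add_one_lt_ord hμ hj, hYmem.2 (Or.inr (Or.inr
      ⟨fun z hz => hZ.2 ⟨j, lt_add_one j, hmono (hj' z hz) (hr z hz).2⟩, hsc⟩))⟩

/-! ### A Skolem function -/

/-- The codes of tuples of sets. -/
noncomputable def tupleCode : (n : ℕ) → (Fin n → ZFSet.{u}) → ZFSet.{u}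
  | 0, _ => ∅
  | n + 1, v => ZFSet.pair (v 0) (tupleCode n fun i => v i.succ)

lemma tupleCode_injective {n : ℕ} : Function.Injective (tupleCode.{u} n) := by
  induction n with
  | zero => exact fun v w _ => funext fun i => i.elim0
  | succ n ih =>
    intro v w h
    obtain ⟨h0, h1⟩ := ZFSet.pair_inj.1 h
    funext i
    exact Fin.cases h0 (fun i => congrFun (ih h1) i) i

instance (n : ℕ) : Countable (setLang.Functions n) := inferInstanceAs (Countable Empty)

instance (n : ℕ) : Countable (setLang.Relations n) :=
  have : Subsingleton (setLang.Relations n) := ⟨fun a b => by cases a; cases b; rfl⟩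
  inferInstance

lemma exists_formulaCode :
    ∃ c : (Σ n, setLang.Formula (Fin (n + 1))) → ℕ, Function.Injective c :=
  exists_injective_nat _

/-- A numbering of the formulas. -/
noncomputable def formulaCode : (Σ n, setLang.Formula (Fin (n + 1))) → ℕ :=
  exists_formulaCode.choose

lemma formulaCode_injective : Function.Injective formulaCode := exists_formulaCode.choose_spec

/-- The code of a formula together with a tuple of parameters. -/
noncomputable def skolemCode {n : ℕ} (φ : setLang.Formula (Fin (n + 1))) (v : Fin n → ZFSet.{u}) :
    ZFSet.{u} :=
  ZFSet.pair (formulaCode ⟨n, φ⟩ : Ordinal.{u}).toZFSet (tupleCode n v)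

/-- A code determines the formula and its parameters, so one unary function can serve as a Skolem
function for all formulas. -/
lemma skolemCode_inj {m n : ℕ} {φ : setLang.Formula (Fin (m + 1))}
    {ψ : setLang.Formula (Fin (n + 1))} {v : Fin m → ZFSet.{u}} {w : Fin n → ZFSet.{u}}
    (h : skolemCode φ v = skolemCode ψ w) :
    (⟨m, φ, v⟩ : Σ n, setLang.Formula (Fin (n + 1)) × (Fin n → ZFSet.{u})) = ⟨n, ψ, w⟩ := by
  obtain ⟨h1, h2⟩ := ZFSet.pair_inj.1 h
  have h3 := formulaCode_injective (Nat.cast_injective (R := Ordinal.{u})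
    (Ordinal.toZFSet_injective h1))
  cases h3
  rw [tupleCode_injective h2]

open Classical in
/-- A Skolem function for the class `T`. -/
noncomputable def skolem (T : Set ZFSet.{u}) (c : ZFSet.{u}) : ZFSet.{u} :=
  if h : ∃ x, x ∈ T ∧ ∃ (p : Σ n, setLang.Formula (Fin (n + 1)) × (Fin n → ZFSet.{u})),
    c = skolemCode p.2.1 p.2.2 ∧ Sat p.2.1 T (Fin.cons x p.2.2) then h.choose else ∅

lemma skolem_spec {T : Set ZFSet.{u}} {n : ℕ} {φ : setLang.Formula (Fin (n + 1))}
    {v : Fin n → ZFSet.{u}} (h : ∃ x, x ∈ T ∧ Sat φ T (Fin.cons x v)) :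
    Sat φ T (Fin.cons (skolem T (skolemCode φ v)) v) := by
  obtain ⟨x, hx, hφ⟩ := h
  have h : ∃ x, x ∈ T ∧ ∃ (p : Σ n, setLang.Formula (Fin (n + 1)) × (Fin n → ZFSet.{u})),
    skolemCode φ v = skolemCode p.2.1 p.2.2 ∧ Sat p.2.1 T (Fin.cons x p.2.2) :=
    ⟨x, hx, ⟨n, φ, v⟩, rfl, hφ⟩
  obtain ⟨⟨m, ψ, w⟩, h1, h2⟩ := h.choose_spec.2
  rw [skolem, dif_pos h]
  generalize h.choose = y at h2
  cases skolemCode_inj h1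
  exact h2

lemma skolem_mem {T : Set ZFSet.{u}} (h0 : ∅ ∈ T) (c : ZFSet.{u}) : skolem T c ∈ T := by
  unfold skolem
  split_ifs with h
  · exact h.choose_spec.1
  · exact h0

section

variable {X : ZFSet.{u}}

lemma pair_mem_of_closed (hfin : ∀ s : ZFSet.{u}, s ⊆ X → s.card < ℵ₀ → s ∈ X) {a b : ZFSet.{u}}
    (ha : a ∈ X) (hb : b ∈ X) : ZFSet.pair a b ∈ X := by
  have hpair : ∀ {a b : ZFSet.{u}}, a ∈ X → b ∈ X → ({a, b} : ZFSet.{u}) ∈ X :=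
    fun {a b} ha hb => hfin _ (fun z hz => by
      rcases ZFSet.mem_pair.1 hz with rfl | rfl <;> assumption)
      (ZFSet.card_insert_le.trans_lt (Cardinal.add_lt_aleph0
        (by simp) Cardinal.one_lt_aleph0))
  rw [ZFSet.pair]
  refine hpair ?_ (hpair ha hb)
  rw [← ZFSet.pair_eq_singleton]
  exact hpair ha ha

lemma nat_mem_of_closed (hfin : ∀ s : ZFSet.{u}, s ⊆ X → s.card < ℵ₀ → s ∈ X) (n : ℕ) :
    (n : Ordinal.{u}).toZFSet ∈ X := by
  induction n using Nat.strong_induction_on with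
  | _ n ih =>
    refine hfin _ (fun z hz => ?_) (by simp)
    obtain ⟨o, ho, rfl⟩ := Ordinal.mem_toZFSet_iff.1 hz
    obtain ⟨m, rfl⟩ := Ordinal.lt_omega0.1 (ho.trans (Ordinal.natCast_lt_omega0 n))
    exact ih m (by exact_mod_cast ho)

/-- A set closed under finite subsets and a Skolem function is an elementary substructure. -/
lemma elemSub_of_closed {T : Set ZFSet.{u}} (hX : ∀ x ∈ X, x ∈ T)
    (hfin : ∀ s : ZFSet.{u}, s ⊆ X → s.card < ℵ₀ → s ∈ X)
    (hf : ∀ a b, ZFSet.pair a b ∈ X → skolem T (ZFSet.pair a b) ∈ X) : ElemSub X T := by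
  refine elemSub_of_exists hX fun n φ v hv hex => ⟨skolem T (skolemCode φ v), hf _ _ ?_,
    skolem_spec hex⟩
  refine pair_mem_of_closed hfin (nat_mem_of_closed hfin _) ?_
  clear hex φ
  induction n with
  | zero => exact hfin _ (ZFSet.empty_subset _) (by
      rw [tupleCode, ZFSet.card_empty]
      exact Cardinal.aleph0_pos)
  | succ n ih => exact pair_mem_of_closed hfin (hv 0) (ih _ fun i => hv i.succ)

end

/-! ### The transitive collapse of an elementary substructure -/

/-- The transitive collapse of the set `X`. -/
noncomputable def collapse (X : ZFSet.{u}) : ZFSet.{u} → ZFSet.{u} :=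
  WellFounded.fix (r := (· ∈ ·)) ZFSet.mem_wf fun x ih =>
    ZFSet.range fun y : {y // y ∈ ZFSet.sep (· ∈ X) x} => ih y.1 (ZFSet.mem_sep.1 y.2).1

lemma mem_collapse {X x z : ZFSet.{u}} :
    z ∈ collapse X x ↔ ∃ y ∈ X, y ∈ x ∧ collapse X y = z := by
  have : collapse X x = ZFSet.range fun y : {y // y ∈ ZFSet.sep (· ∈ X) x} => collapse X y.1 :=
    WellFounded.fix_eq (r := (· ∈ ·)) ZFSet.mem_wf _ x
  rw [this, ZFSet.mem_range]
  constructor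
  · rintro ⟨⟨y, hy⟩, rfl⟩
    rw [ZFSet.mem_sep] at hy
    exact ⟨y, hy.2, hy.1, rfl⟩
  · rintro ⟨y, hy, hyx, rfl⟩
    exact ⟨⟨y, ZFSet.mem_sep.2 ⟨hyx, hy⟩⟩, rfl⟩

/-- An elementary substructure of `H θ` closed under subsets of size `κ`. -/
structure CollapseSetup (κ θ : Cardinal.{u}) (X : ZFSet.{u}) : Prop where
  regular : κ.IsRegular
  regular' : θ.IsRegular
  elem : ElemSub X (H θ)
  closed : ∀ s : ZFSet.{u}, s ⊆ X → s.card ≤ κ → s ∈ X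

namespace CollapseSetup

variable {κ θ : Cardinal.{u}} {X : ZFSet.{u}}

lemma injOn (S : CollapseSetup κ θ X) (x : ZFSet.{u}) : x ∈ X → ∀ y ∈ X,
    collapse X x = collapse X y → x = y := by
  induction x using ZFSet.inductionOn with
  | _ x ih =>
    intro hx y hy hxy
    refine S.elem.ext (transClass_H θ) hx hy fun z hz => ⟨fun hzx => ?_, fun hzy => ?_⟩
    · have : collapse X z ∈ collapse X y := hxy ▸ mem_collapse.2 ⟨z, hz, hzx, rfl⟩
      obtain ⟨w, hw, hwy, hwz⟩ := mem_collapse.1 this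
      rwa [ih z hzx hz w hw hwz.symm]
    · have : collapse X z ∈ collapse X x := hxy ▸ mem_collapse.2 ⟨z, hz, hzy, rfl⟩
      obtain ⟨w, hw, hwx, hwz⟩ := mem_collapse.1 this
      rwa [← ih w hwx hw z hz hwz]

lemma mem_iff (S : CollapseSetup κ θ X) {x y : ZFSet.{u}} (hx : x ∈ X) :
    collapse X x ∈ collapse X y ↔ x ∈ y := by
  rw [mem_collapse]
  constructor
  · rintro ⟨z, hz, hzy, h⟩
    rwa [← S.injOn z hz x hx h]
  · exact fun h => ⟨x, hx, h, rfl⟩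

/-- On a subset of `X` the collapse is the pointwise image, which determines it on models, filters
and functions of size κ. -/
lemma collapse_of_subset {s : ZFSet.{u}} (hs : s ⊆ X) : collapse X s = img (collapse X) s := by
  ext z
  rw [mem_collapse, mem_img]
  exact ⟨fun ⟨y, _, h, h'⟩ => ⟨y, h, h'⟩, fun ⟨y, h, h'⟩ => ⟨y, hs h, h, h'⟩⟩

lemma collapse_eq_self_of_forall {s : ZFSet.{u}} (hs : s ⊆ X) (h : ∀ y ∈ s, collapse X y = y) :
    collapse X s = s := by
  rw [collapse_of_subset hs]
  ext z
  rw [mem_img]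
  exact ⟨fun ⟨y, hy, hyz⟩ => by rwa [← hyz, h y hy], fun hz => ⟨z, hz, h z hz⟩⟩

lemma pairSet_mem (S : CollapseSetup κ θ X) {a b : ZFSet.{u}} (ha : a ∈ X) (hb : b ∈ X) :
    ({a, b} : ZFSet.{u}) ∈ X := S.elem.pairSet_mem S.regular' ha hb

lemma pair_mem (S : CollapseSetup κ θ X) {a b : ZFSet.{u}} (ha : a ∈ X) (hb : b ∈ X) :
    ZFSet.pair a b ∈ X := S.elem.pair_mem S.regular' ha hb

lemma collapse_pairSet {a b : ZFSet.{u}} (ha : a ∈ X) (hb : b ∈ X) :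
    collapse X {a, b} = {collapse X a, collapse X b} := by
  rw [collapse_of_subset fun z hz => by rcases ZFSet.mem_pair.1 hz with rfl | rfl <;> assumption]
  ext z
  simp only [mem_img, ZFSet.mem_pair, exists_eq_or_imp, exists_eq_left]
  tauto

lemma collapse_pair (S : CollapseSetup κ θ X) {a b : ZFSet.{u}} (ha : a ∈ X) (hb : b ∈ X) :
    collapse X (ZFSet.pair a b) = ZFSet.pair (collapse X a) (collapse X b) := by
  have h : ∀ a b : ZFSet.{u}, ZFSet.pair a b = {{a, a}, {a, b}} := fun a b => by
    rw [ZFSet.pair_eq_singleton]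
    rfl
  rw [h, h,
    collapse_pairSet (S.pairSet_mem ha ha) (S.pairSet_mem ha hb), collapse_pairSet ha ha,
    collapse_pairSet ha hb]

lemma ordinal_mem (S : CollapseSetup κ θ X) {o : Ordinal.{u}} (ho : o ≤ κ.ord) :
    o.toZFSet ∈ X ∧ collapse X o.toZFSet = o.toZFSet := by
  induction o using WellFoundedLT.induction with
  | _ o ih =>
    have h1 : ∀ z ∈ o.toZFSet, z ∈ X ∧ collapse X z = z := fun z hz => by
      obtain ⟨p, hp, rfl⟩ := Ordinal.mem_toZFSet_iff.1 hz
      exact ih p hp (hp.le.trans ho)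
    exact ⟨S.closed _ (fun z hz => (h1 z hz).1) (by
      rw [Ordinal.card_toZFSet]
      simpa using Ordinal.card_le_card ho),
      collapse_eq_self_of_forall (fun z hz => (h1 z hz).1) fun z hz => (h1 z hz).2⟩

lemma of_mem_card (S : CollapseSetup κ θ X) {x : ZFSet.{u}} (hx : x ∈ cardSet κ) :
    x ∈ X ∧ collapse X x = x := by
  obtain ⟨o, ho, rfl⟩ := Ordinal.mem_toZFSet_iff.1 hx
  exact S.ordinal_mem ho.le

/-- Every subset of κ is in `X` and is not moved, so a filter on κ has the same meaning before and
after the collapse. -/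
lemma of_subset_card (S : CollapseSetup κ θ X) {x : ZFSet.{u}} (hx : x ⊆ cardSet κ) :
    x ∈ X ∧ collapse X x = x :=
  ⟨S.closed x (fun z hz => (S.of_mem_card (hx hz)).1)
    ((ZFSet.card_mono hx).trans_eq (card_cardSet κ)),
    collapse_eq_self_of_forall (fun z hz => (S.of_mem_card (hx hz)).1)
      fun z hz => (S.of_mem_card (hx hz)).2⟩

/-- The collapse of `X`. -/
noncomputable def target (X : ZFSet.{u}) : ZFSet.{u} := img (collapse X) X

lemma mem_target {z : ZFSet.{u}} : z ∈ target X ↔ ∃ x ∈ X, collapse X x = z := mem_img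

lemma target_mem_H {θ₀ : Cardinal.{u}} (hX : X.card < θ₀) : target X ∈ H θ₀ := by
  refine ⟨target X, fun y hy z hz => ?_, fun _ h => h, (card_img_le _ _).trans_lt hX⟩
  obtain ⟨x, hx, rfl⟩ := mem_target.1 hy
  obtain ⟨w, hw, _, rfl⟩ := mem_collapse.1 hz
  exact mem_target.2 ⟨w, hw, rfl⟩

/-- The elements of `X` whose collapse lies in `w`. -/
noncomputable def pre (X w : ZFSet.{u}) : ZFSet.{u} := ZFSet.sep (fun x => collapse X x ∈ w) X

@[simp] lemma mem_pre {w x : ZFSet.{u}} : x ∈ pre X w ↔ x ∈ X ∧ collapse X x ∈ w :=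
  ZFSet.mem_sep

lemma pre_subset {w : ZFSet.{u}} : pre X w ⊆ X := ZFSet.sep_subset

lemma card_pre_le (S : CollapseSetup κ θ X) (w : ZFSet.{u}) : (pre X w).card ≤ w.card :=
  card_le_of_injOn (f := collapse X) (fun z hz => (mem_pre.1 hz).2) fun z hz y hy h =>
    S.injOn z (mem_pre.1 hz).1 y (mem_pre.1 hy).1 h

lemma collapse_pre {w : ZFSet.{u}} (hw : w ⊆ target X) : collapse X (pre X w) = w := by
  rw [collapse_of_subset pre_subset]
  ext z
  rw [mem_img]
  constructor
  · rintro ⟨y, hy, rfl⟩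
    exact (mem_pre.1 hy).2
  · intro hz
    obtain ⟨y, hy, rfl⟩ := mem_target.1 (hw hz)
    exact ⟨y, mem_pre.2 ⟨hy, hz⟩, rfl⟩

lemma subClosed (S : CollapseSetup κ θ X) (T : Set ZFSet.{u}) :
    SubClosed T (cardSet κ) (target X) := by
  rintro x _ hx ⟨e, _, he⟩
  have hc := he.card_le
  rw [card_cardSet] at hc
  exact mem_target.2 ⟨pre X x, S.closed _ pre_subset ((S.card_pre_le x).trans hc),
    collapse_pre hx⟩

/-- The function on the collapse that corresponds to the function `f` on `X`. -/
noncomputable def funTarget (X : ZFSet.{u}) (f : ZFSet.{u} → ZFSet.{u}) : ZFSet.{u} :=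
  img (fun x => ZFSet.pair (collapse X x) (collapse X (f x))) X

lemma pair_mem_funTarget (S : CollapseSetup κ θ X) {f : ZFSet.{u} → ZFSet.{u}} {x y : ZFSet.{u}}
    (hx : x ∈ X) : ZFSet.pair (collapse X x) y ∈ funTarget X f ↔ y = collapse X (f x) := by
  rw [funTarget, mem_img]
  constructor
  · rintro ⟨z, hz, h⟩
    obtain ⟨h1, h2⟩ := ZFSet.pair_inj.1 h
    rw [← h2, S.injOn z hz x hx h1]
  · rintro rfl
    exact ⟨x, hx, rfl⟩

lemma isFunc_funTarget (S : CollapseSetup κ θ X) {f : ZFSet.{u} → ZFSet.{u}}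
    (hf : ∀ x ∈ X, f x ∈ X) : ZFSet.IsFunc (target X) (target X) (funTarget X f) := by
  refine ⟨fun p hp => ?_, fun y hy => ?_⟩
  · obtain ⟨x, hx, rfl⟩ := mem_img.1 hp
    exact ZFSet.pair_mem_prod.2 ⟨mem_target.2 ⟨x, hx, rfl⟩, mem_target.2 ⟨f x, hf x hx, rfl⟩⟩
  · obtain ⟨x, hx, rfl⟩ := mem_target.1 hy
    exact ⟨_, (S.pair_mem_funTarget hx).2 rfl, fun z hz => (S.pair_mem_funTarget hx).1 hz⟩

lemma funTarget_mem_H {θ₀ : Cardinal.{u}} (hθ₀ : θ₀.IsRegular) (hX : X.card < θ₀)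
    {f : ZFSet.{u} → ZFSet.{u}} (hf : ∀ x ∈ X, f x ∈ X) : funTarget X f ∈ H θ₀ := by
  refine mem_H_of_forall hθ₀ ((card_img_le _ _).trans_lt hX) fun p hp => ?_
  obtain ⟨x, hx, rfl⟩ := mem_img.1 hp
  have h := transClass_H θ₀ _ (target_mem_H hX)
  exact pair_mem_H hθ₀ (h _ (mem_target.2 ⟨x, hx, rfl⟩)) (h _ (mem_target.2 ⟨f x, hf x hx, rfl⟩))

/-! ### Pulling good models back along the collapse -/

section GoodModel

variable {θ₀ : Cardinal.{u}} {f : ZFSet.{u} → ZFSet.{u}} {w : ZFSet.{u}}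

lemma goodModel_closed (S : CollapseSetup κ θ X) (hθ₀ : θ₀.IsRegular) (hκ : κ < θ₀)
    (hX : X.card < θ₀) (hw : GoodModel (H θ₀) (cardSet κ) (target X) (funTarget X f) w)
    {s : ZFSet.{u}} (hs : s ⊆ pre X w) (hc : s.card < κ) : s ∈ pre X w := by
  have hsX : s ⊆ X := fun z hz => (mem_pre.1 (hs hz)).1
  refine mem_pre.2 ⟨S.closed s hsX hc.le, ?_⟩
  have hsub : collapse X s ⊆ w := fun z hz => by
    rw [collapse_of_subset hsX] at hz
    obtain ⟨y, hy, rfl⟩ := mem_img.1 hz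
    exact (mem_pre.1 (hs hy)).2
  have hH : collapse X s ∈ H θ₀ := mem_H_of_subset (target_mem_H hX) fun z hz => hw.1 (hsub hz)
  refine hw.2.2.2.2.2 _ hH hsub ⟨cardSet s.card, Ordinal.mem_toZFSet_iff.2
    ⟨_, Cardinal.ord_lt_ord.2 hc, rfl⟩, exists_enum hθ₀ (cardSet_mem_H (hc.trans hκ)) hH ?_⟩
  rw [card_cardSet, collapse_of_subset hsX]
  exact card_img_le _ _

lemma goodModel_card (S : CollapseSetup κ θ X)
    (hw : GoodModel (H θ₀) (cardSet κ) (target X) (funTarget X f) w) : (pre X w).card = κ := by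
  obtain ⟨e, _, he⟩ := hw.2.1
  refine le_antisymm ?_ ?_
  · have := he.card_le
    rw [card_cardSet] at this
    exact (S.card_pre_le w).trans this
  · have : (cardSet κ).card ≤ (pre X w).card := ZFSet.card_mono fun x hx => by
      have := S.of_mem_card hx
      exact mem_pre.2 ⟨this.1, by
        rw [this.2]
        exact hw.2.2.1 hx⟩
    rwa [card_cardSet] at this

lemma goodModel_pre_mem (S : CollapseSetup κ θ X)
    (hw : GoodModel (H θ₀) (cardSet κ) (target X) (funTarget X f) w) : pre X w ∈ X :=
  S.closed _ pre_subset (S.goodModel_card hw).le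

lemma goodModel_apply (S : CollapseSetup κ θ X) (hf : ∀ x ∈ X, f x ∈ X)
    (hw : GoodModel (H θ₀) (cardSet κ) (target X) (funTarget X f) w) {x : ZFSet.{u}}
    (hx : x ∈ pre X w) : f x ∈ pre X w := by
  rw [mem_pre] at hx
  exact mem_pre.2 ⟨hf x hx.1, hw.2.2.2.2.1 _ hx.2 _ (mem_target.2 ⟨_, hf x hx.1, rfl⟩)
    ((S.pair_mem_funTarget hx.1).2 rfl)⟩

/-- The preimage is closed under finite subsets and under `f`, which on pairs is a Skolem function
for H(θ). -/
lemma goodModel_elemSub (S : CollapseSetup κ θ X) (hθ₀ : θ₀.IsRegular) (hκ : κ < θ₀)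
    (hX : X.card < θ₀) (hf : ∀ x ∈ X, f x ∈ X)
    (hsk : ∀ a b : ZFSet.{u}, f (ZFSet.pair a b) = skolem (H θ) (ZFSet.pair a b))
    (hw : GoodModel (H θ₀) (cardSet κ) (target X) (funTarget X f) w) :
    ElemSub (pre X w) (H θ) :=
  elemSub_of_closed (fun x hx => S.elem.subset (mem_pre.1 hx).1)
    (fun s hs hc => S.goodModel_closed hθ₀ hκ hX hw hs (hc.trans_le S.regular.aleph0_le))
    fun a b hab => hsk a b ▸ S.goodModel_apply hf hw hab

lemma goodModel_isModel (S : CollapseSetup κ θ X) (hθ₀ : θ₀.IsRegular) (hκ : κ < θ₀)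
    (hX : X.card < θ₀) (hel : ElemSub (pre X w) (H θ))
    (hw : GoodModel (H θ₀) (cardSet κ) (target X) (funTarget X f) w) :
    IsModel κ (pre X w) := by
  classical
  have hord : ∀ β ≤ κ.ord, β.toZFSet ∈ pre X w := fun β hβ => by
    obtain ⟨h1, h2⟩ := S.ordinal_mem hβ
    refine mem_pre.2 ⟨h1, ?_⟩
    rw [h2]
    rcases hβ.eq_or_lt with rfl | hβ
    · exact hw.2.2.2.1
    · exact hw.2.2.1 (Ordinal.mem_toZFSet_iff.2 ⟨β, hβ, rfl⟩)
  refine ⟨⟨S.goodModel_card hw, hord, hel.modelsZFCMinus S.regular' fun o ho =>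
    hord o (ho.trans ?_)⟩, fun β hβ s hs => ?_⟩
  · rw [← Cardinal.ord_aleph0]
    exact Cardinal.ord_le_ord.2 S.regular.aleph0_le
  · refine S.goodModel_closed hθ₀ hκ hX hw (fun p hp => ?_) ?_
    · obtain ⟨a, ha, rfl⟩ := (mem_isFunc_iff hs).1 hp
      obtain ⟨o, ho, rfl⟩ := Ordinal.mem_toZFSet_iff.1 ha
      exact hel.pair_mem S.regular' (hord o (ho.le.trans hβ.le)) (app_mem hs ha)
    · refine (card_le_of_injOn (y := β.toZFSet) (f := fun p => if h : ∃ a ∈ β.toZFSet,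
        p = ZFSet.pair a (app s a) then h.choose else ∅) (fun p hp => ?_) fun p hp q hq h => ?_).trans_lt
          (by simpa using Cardinal.lt_ord.1 hβ)
      · have h := (mem_isFunc_iff hs).1 hp
        rw [dif_pos h]
        exact h.choose_spec.1
      · have hp' := (mem_isFunc_iff hs).1 hp
        have hq' := (mem_isFunc_iff hs).1 hq
        rw [dif_pos hp', dif_pos hq'] at h
        rw [hp'.choose_spec.2, hq'.choose_spec.2, h]

end GoodModel

end CollapseSetup

/-! ### Filter sequences from good structures -/

lemma card_of_unbounded {κ : Cardinal.{u}} (hκ : κ.IsRegular) {A : ZFSet.{u}} (hA : A ⊆ cardSet κ)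
    (h : ∀ γ, γ ∈ cardSet κ → ∃ β, β ∈ A ∧ γ ∈ β) : A.card = κ := by
  refine le_antisymm ((ZFSet.card_mono hA).trans_eq (card_cardSet κ)) (not_lt.1 fun hlt => ?_)
  obtain ⟨j, hj, hj'⟩ := exists_bound hκ hlt (f := ZFSet.rank) fun z hz => by
    obtain ⟨o, ho, rfl⟩ := Ordinal.mem_toZFSet_iff.1 (hA hz)
    simpa using ho
  obtain ⟨β, hβ, hjβ⟩ := h j.toZFSet (Ordinal.mem_toZFSet_iff.2 ⟨j, hj, rfl⟩)
  have := ZFSet.rank_lt_of_mem hjβ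
  rw [Ordinal.rank_toZFSet] at this
  exact this.not_ge (hj' β hβ)

namespace CollapseSetup

variable {α κ θ θ₀ : Cardinal.{u}} {X W F : ZFSet.{u}} {f : ZFSet.{u} → ZFSet.{u}}

/-- The sequence of the preimages under the collapse. -/
noncomputable def preSeq (X W : ZFSet.{u}) (i : Ordinal.{u}) : ZFSet.{u} :=
  pre X (app W i.toZFSet)

lemma goodModel_app (hG : GoodSeq (H θ₀) (cardSet α) (cardSet κ) (target X) (funTarget X f) W F)
    {i : Ordinal.{u}} (hi : i < α.ord) :
    GoodModel (H θ₀) (cardSet κ) (target X) (funTarget X f) (app W i.toZFSet) :=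
  have hi' : i.toZFSet ∈ cardSet α := Ordinal.mem_toZFSet_iff.2 ⟨i, hi, rfl⟩
  hG.1.2 _ hi' _ (app_mem hG.1.1 hi') (app_spec hG.1.1 hi')

lemma goodMeasure_app (hG : GoodSeq (H θ₀) (cardSet α) (cardSet κ) (target X) (funTarget X f) W F)
    {i : Ordinal.{u}} (hi : i < α.ord) : GoodMeasure (cardSet κ) F (app W i.toZFSet) :=
  have hi' : i.toZFSet ∈ cardSet α := Ordinal.mem_toZFSet_iff.2 ⟨i, hi, rfl⟩
  hG.2.2.2.2.1 _ hi' _ (app_mem hG.1.1 hi') (app_spec hG.1.1 hi')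

lemma goodSeq_chain (hG : GoodSeq (H θ₀) (cardSet α) (cardSet κ) (target X) (funTarget X f) W F)
    {i j : Ordinal.{u}} (hi : i < α.ord) (hj : j < i) :
    app W j.toZFSet ∈ app W i.toZFSet ∧ app W j.toZFSet ⊆ app W i.toZFSet ∧
    ∃ z, z ∈ app W i.toZFSet ∧ ((∀ x, x ∈ z → x ∈ F ∧ x ∈ app W j.toZFSet) ∧
      ∀ x, x ∈ app W j.toZFSet → x ∈ F → x ∈ z) :=
  have hi' : i.toZFSet ∈ cardSet α := Ordinal.mem_toZFSet_iff.2 ⟨i, hi, rfl⟩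
  have hj' : j.toZFSet ∈ cardSet α := Ordinal.mem_toZFSet_iff.2 ⟨j, hj.trans hi, rfl⟩
  hG.2.1 _ hi' _ (Ordinal.mem_toZFSet_iff.2 ⟨j, hj, rfl⟩) _ (app_mem hG.1.1 hi') _
    (app_mem hG.1.1 hj') (app_spec hG.1.1 hj') (app_spec hG.1.1 hi')

lemma mem_pre_of_subset (S : CollapseSetup κ θ X) {A w : ZFSet.{u}} (hA : A ⊆ cardSet κ) :
    A ∈ pre X w ↔ A ∈ w := by
  obtain ⟨h1, h2⟩ := S.of_subset_card hA
  rw [mem_pre, h2, and_iff_right h1]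

/-- `GoodSeq` only mentions unboundedness and lower bounds in `F` for two sets; finite intersections
follow by induction, and unbounded subsets of the regular κ have size κ. -/
lemma isFilter_of_goodSeq (S : CollapseSetup κ θ X) (hα : α.IsRegular)
    (hG : GoodSeq (H θ₀) (cardSet α) (cardSet κ) (target X) (funTarget X f) W F) :
    IsFilter κ F := by
  classical
  refine ⟨fun A hA => (hG.2.2.1 A hA).1, fun s hs => ?_⟩
  have : ∃ C, C ∈ F ∧ ∀ A ∈ s, C ⊆ A := by
    induction s using Finset.induction_on with
    | empty =>
      rcases (goodMeasure_app hG hα.ord_pos).1 _ (goodModel_app hG hα.ord_pos).2.2.2.1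
        (fun _ h => h) with h | ⟨B, hB, _⟩
      exacts [⟨_, h, by simp⟩, ⟨B, hB, by simp⟩]
    | insert A s _ ih =>
      obtain ⟨C, hC, hCs⟩ := ih fun B hB => hs B (Finset.mem_insert_of_mem hB)
      obtain ⟨D, hD, hDC, hDA⟩ := hG.2.2.2.1 C hC A (hs A (Finset.mem_insert_self _ _))
      refine ⟨D, hD, fun B hB => ?_⟩
      rcases Finset.mem_insert.1 hB with rfl | hB
      · exact hDA
      · exact fun z hz => hCs B hB (hDC hz)
  obtain ⟨C, hC, hCs⟩ := this
  obtain ⟨hCk, hC'⟩ := hG.2.2.1 C hC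
  refine card_of_unbounded S.regular ZFSet.sep_subset fun γ hγ => ?_
  obtain ⟨β, hβ, hγβ⟩ := hC' γ hγ
  exact ⟨β, ZFSet.mem_sep.2 ⟨hCk hβ, fun A hA => hCs A hA hβ⟩, hγβ⟩

lemma isFilterSequence_preSeq (S : CollapseSetup κ θ X) (hα : α.IsRegular) (hακ : α ≤ κ)
    (hG : GoodSeq (H θ₀) (cardSet α) (cardSet κ) (target X) (funTarget X f) W F)
    (hmodel : ∀ i < α.ord, IsModel κ (preSeq X W i)) :
    IsFilterSequence α.ord κ (preSeq X W) F := by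
  have hsub : ∀ i < α.ord, app W i.toZFSet ⊆ target X := fun i hi => (goodModel_app hG hi).1
  have hF := S.isFilter_of_goodSeq hα hG
  refine ⟨hmodel, fun i j hij hj x hx => ?_, fun i j hij hj => ?_, ⟨hF, fun A hA hAk => ?_,
    fun Y hY hYf => ?_⟩, fun i hi => ?_⟩
  · obtain ⟨h1, h2⟩ := mem_pre.1 hx
    exact mem_pre.2 ⟨h1, (goodSeq_chain hG hj hij).2.1 h2⟩
  · refine mem_pre.2 ⟨S.goodModel_pre_mem (goodModel_app hG (hij.trans hj)), ?_⟩
    rw [preSeq, collapse_pre (hsub i (hij.trans hj))]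
    exact (goodSeq_chain hG hj hij).1
  · obtain ⟨i, hi, hA⟩ := mem_seqUnion.1 hA
    rw [preSeq, S.mem_pre_of_subset hAk] at hA
    refine ((goodMeasure_app hG hi).1 A hA hAk).imp_right ?_
    rintro ⟨B, hB, hB'⟩
    have : cardSet κ \ A = B := by
      ext z
      rw [ZFSet.mem_sdiff]
      exact ⟨fun h => (hB' z h.1).2 h.2, fun h =>
        have hz := hF.1 B hB h
        ⟨hz, (hB' z hz).1 h⟩⟩
    rwa [this]
  · obtain ⟨i, hi, hY⟩ := mem_seqUnion.1 hY
    -- A sequence of subsets of κ consists of pairs fixed by the collapse, so it is fixed too and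
    -- can be used in the normality clause of the collapsed structure.
    have hYX : ∀ p ∈ Y, p ∈ X ∧ collapse X p = p := fun p hp => by
      obtain ⟨γ, hγ, rfl⟩ := (mem_isFunc_iff hYf).1 hp
      obtain ⟨h1, h2⟩ := S.of_mem_card hγ
      obtain ⟨h3, h4⟩ := S.of_subset_card (hF.1 _ (app_mem hYf hγ))
      refine ⟨S.pair_mem h1 h3, ?_⟩
      rw [S.collapse_pair h1 h3, h2, h4]
    have hYY : collapse X Y = Y :=
      collapse_eq_self_of_forall (fun p hp => (hYX p hp).1) fun p hp => (hYX p hp).2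
    have hYw := (mem_pre.1 hY).2
    rw [hYY] at hYw
    obtain ⟨D, hD, hD'⟩ := (goodMeasure_app hG hi).2 Y hYw hYf
    have : diagInter κ Y = D := by
      ext β
      rw [diagInter, ZFSet.mem_sep]
      have key : ∀ β, (∀ γ ∈ β, ∃ A, ZFSet.pair γ A ∈ Y ∧ β ∈ A) ↔
          (∀ γ, γ ∈ β → ∃ A, A ∈ F ∧ (ZFSet.pair γ A ∈ Y ∧ β ∈ A)) := fun β => by
        refine forall₂_congr fun γ _ => exists_congr fun A => ?_
        refine (and_iff_right_of_imp fun h => ?_).symm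
        exact (ZFSet.pair_mem_prod.1 (hYf.1 h.1)).2
      rw [key]
      exact ⟨fun h => (hD' β h.1).2 h.2, fun h =>
        have hz := hF.1 D hD h
        ⟨hz, (hD' β hz).1 h⟩⟩
    rwa [this]
  · have hii : i < i + 1 := lt_add_one i
    obtain ⟨_, _, z, hz, hz1, hz2⟩ := goodSeq_chain hG hi hii
    have : z = F ∩ preSeq X W i := by
      ext A
      rw [ZFSet.mem_inter]
      constructor
      · intro hA
        obtain ⟨h1, h2⟩ := hz1 A hA
        exact ⟨h1, (S.mem_pre_of_subset (hF.1 A h1)).2 h2⟩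
      · exact fun hA => hz2 A ((S.mem_pre_of_subset (hF.1 A hA.1)).1 hA.2) hA.1
    rw [← this]
    have hzX : ∀ A ∈ z, A ∈ X ∧ collapse X A = A := fun A hA =>
      S.of_subset_card (hF.1 A (hz1 A hA).1)
    refine mem_pre.2 ⟨S.closed z (fun A hA => (hzX A hA).1) ?_, ?_⟩
    · rw [this]
      exact (ZFSet.card_mono fun x hx => (ZFSet.mem_inter.1 hx).2).trans_eq
        (S.goodModel_card (goodModel_app hG (hii.trans hi)))
    · rwa [collapse_eq_self_of_forall (fun A hA => (hzX A hA).1) fun A hA => (hzX A hA).2]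

/-- The collapse carries membership in the ultrapower to `UMem`. The image of any family of
representatives is a subset of the collapse of `X`, hence an element of H(θ₀), where `GoodWF` gives
a minimal element. -/
lemma wellFounded_preSeq (S : CollapseSetup κ θ X) (hX : X.card < θ₀)
    (hG : GoodSeq (H θ₀) (cardSet α) (cardSet κ) (target X) (funTarget X f) W F)
    (hF : IsFilter κ F) (hel : ∀ i < α.ord, ElemSub (preSeq X W i) (H θ)) :
    WellFoundedUltrapower κ (seqUnion α.ord (preSeq X W)) F := by
  have hfun : ∀ g : UltraFun κ (seqUnion α.ord (preSeq X W)),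
      g.1 ∈ X ∧ (∃ i < α.ord, collapse X g.1 ∈ app W i.toZFSet) ∧
      (∀ β ∈ cardSet κ, app g.1 β ∈ X) ∧
      ∀ p, p ∈ collapse X g.1 ↔
        ∃ β ∈ cardSet κ, p = ZFSet.pair β (collapse X (app g.1 β)) := fun g => by
    obtain ⟨i, hi, hgi⟩ := mem_seqUnion.1 g.2.1
    obtain ⟨y, hy⟩ := g.2.2
    have hg := mem_pre.1 hgi
    have happ : ∀ β ∈ cardSet κ, app g.1 β ∈ X := fun β hβ => (mem_pre.1
      ((hel i hi).app_mem (transClass_H θ) hgi hy hβ (by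
        obtain ⟨h1, h2⟩ := S.of_mem_card hβ
        refine mem_pre.2 ⟨h1, ?_⟩
        rw [h2]
        exact (goodModel_app hG hi).2.2.1 hβ))).1
    refine ⟨hg.1, ⟨i, hi, hg.2⟩, happ, fun p => ?_⟩
    rw [collapse_of_subset, mem_img]
    · constructor
      · rintro ⟨q, hq, rfl⟩
        obtain ⟨β, hβ, rfl⟩ := (mem_isFunc_iff hy).1 hq
        obtain ⟨h1, h2⟩ := S.of_mem_card hβ
        exact ⟨β, hβ, by rw [S.collapse_pair h1 (happ β hβ), h2]⟩
      · rintro ⟨β, hβ, rfl⟩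
        obtain ⟨h1, h2⟩ := S.of_mem_card hβ
        exact ⟨_, app_spec hy hβ, by rw [S.collapse_pair h1 (happ β hβ), h2]⟩
    · intro q hq
      obtain ⟨β, hβ, rfl⟩ := (mem_isFunc_iff hy).1 hq
      exact S.pair_mem (S.of_mem_card hβ).1 (happ β hβ)
  have hpair : ∀ g : UltraFun κ (seqUnion α.ord (preSeq X W)), ∀ β ∈ cardSet κ, ∀ b,
      ZFSet.pair β b ∈ collapse X g.1 ↔ b = collapse X (app g.1 β) := fun g β hβ b => by
    rw [(hfun g).2.2.2]
    constructor
    · rintro ⟨β', _, h⟩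
      obtain ⟨rfl, h⟩ := ZFSet.pair_inj.1 h
      exact h
    · rintro rfl
      exact ⟨β, hβ, rfl⟩
  have hUMem : ∀ g g' : UltraFun κ (seqUnion α.ord (preSeq X W)), ultraMem κ _ F g g' →
      UMem (cardSet κ) F (collapse X g.1) (collapse X g'.1) := fun g g' h => by
    rw [ultraMem_iff] at h
    refine ⟨_, h, fun β hβ => ?_⟩
    rw [ZFSet.mem_sep, and_iff_right hβ, ← S.mem_iff ((hfun g).2.2.1 β hβ)]
    constructor
    · exact fun h => ⟨_, _, (hpair g β hβ _).2 rfl, (hpair g' β hβ _).2 rfl, h⟩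
    · rintro ⟨a, b, ha, hb, hab⟩
      rwa [← (hpair g β hβ _).1 ha, ← (hpair g' β hβ _).1 hb]
  rw [WellFoundedUltrapower, WellFounded.wellFounded_iff_has_min]
  rintro s ⟨g₀, hg₀⟩
  have hmem : ∀ g : UltraFun κ (seqUnion α.ord (preSeq X W)), collapse X g.1 ∈ target X :=
    fun g => mem_target.2 ⟨_, (hfun g).1, rfl⟩
  have hTH := target_mem_H hX
  let B := ZFSet.sep (fun z => ∃ g ∈ s, collapse X (Subtype.val g) = z) (target X)
  have hB : ∀ {z}, z ∈ B ↔ ∃ g ∈ s, collapse X (Subtype.val g) = z := by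
    intro z
    simp only [B, ZFSet.mem_sep]
    exact and_iff_right_of_imp fun ⟨g, _, h⟩ => h ▸ hmem g
  obtain ⟨z, hz, hmin⟩ := hG.2.2.2.2.2 B (mem_H_of_subset hTH ZFSet.sep_subset) (fun z hz => by
    obtain ⟨g, _, rfl⟩ := hB.1 hz
    obtain ⟨i, hi, hgi⟩ := (hfun g).2.1
    have hi' : i.toZFSet ∈ cardSet α := Ordinal.mem_toZFSet_iff.2 ⟨i, hi, rfl⟩
    refine ⟨_, hi', _, app_mem hG.1.1 hi', app_spec hG.1.1 hi', hgi, target X, hTH,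
      fun p hp => ?_, fun β hβ => ⟨_, (hpair g β hβ _).2 rfl, fun b hb => (hpair g β hβ b).1 hb⟩⟩
    obtain ⟨β, hβ, rfl⟩ := ((hfun g).2.2.2 p).1 hp
    exact ZFSet.pair_mem_prod.2 ⟨hβ, mem_target.2 ⟨_, (hfun g).2.2.1 β hβ, rfl⟩⟩)
    ⟨_, hB.2 ⟨g₀, hg₀, rfl⟩, hB.2 ⟨g₀, hg₀, rfl⟩⟩
  obtain ⟨g, hg, rfl⟩ := hB.1 hz
  exact ⟨g, hg, fun g' hg' h => hmin _ (hB.2 ⟨g', hg', rfl⟩) (hUMem g' g h)⟩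

end CollapseSetup

/-- If every structure in `H θ₀` has a filter sequence, then there are filter sequences of
elementary substructures of every `H θ`. -/
theorem AllGood.exists_isFilterSequence {α κ θ₀ θ : Cardinal.{u}} (hα : α.IsRegular)
    (hκ : κ.IsRegular) (hακ : α ≤ κ) (hθ₀ : θ₀.IsRegular) (hκθ₀ : 2 ^ κ < θ₀)
    (hgood : AllGood α κ θ₀) (hθ : θ.IsRegular) (hκθ : κ < θ) {A : ZFSet.{u}}
    (hA : A ⊆ cardSet κ) : ∃ (M : Ordinal.{u} → ZFSet.{u}) (F : ZFSet.{u}),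
      IsFilterSequence α.ord κ M F ∧ WellFoundedUltrapower κ (seqUnion α.ord M) F ∧
      A ∈ M 0 ∧ ∀ i < α.ord, ElemSub (M i) (H θ) := by
  classical
  have hκ2 : κ < 2 ^ κ := Cardinal.cantor κ
  have hkH := cardSet_mem_H hκθ
  -- The value at κ makes every model closed under `f` and containing κ contain `A`. Codes of
  -- formulas are pairs, hence finite sets and different from κ, so the Skolem function is not
  -- disturbed.
  let f : ZFSet.{u} → ZFSet.{u} := fun x => if x = cardSet κ then A else skolem (H θ) x
  have hfk : f (cardSet κ) = A := if_pos rfl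
  have hsk : ∀ a b : ZFSet.{u}, f (ZFSet.pair a b) = skolem (H θ) (ZFSet.pair a b) :=
    fun a b => if_neg fun h => by
      have h1 : (ZFSet.pair a b).card < ℵ₀ := ZFSet.card_insert_le.trans_lt
        (Cardinal.add_lt_aleph0 (by simp) Cardinal.one_lt_aleph0)
      rw [h, card_cardSet] at h1
      exact h1.not_ge hκ.aleph0_le
  have hfH : ∀ x ∈ H θ, f x ∈ H θ := fun x _ => by
    by_cases h : x = cardSet κ
    · rw [h, hfk]
      exact mem_H_of_subset hkH hA
    · simp only [f, if_neg h]
      exact skolem_mem (mem_H_of_subset hkH (ZFSet.empty_subset _)) x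
  -- Closure under subsets of size at most κ costs only size 2^κ, since (2^κ)^κ = 2^κ.
  obtain ⟨X, _, hXH, hX, hXf, hXc⟩ := exists_hull (l := 2 ^ κ) (μ := Order.succ κ)
    (isRegular_succ hκ.aleph0_le) (Order.succ_le_of_lt hκ2) (fun x hx => card_sep_card_lt
      (hκ.aleph0_le.trans hκ2.le) (Order.succ_le_of_lt hκ2) (fun ν hν => by
      rw [← Cardinal.power_mul]
      exact Cardinal.power_le_power_left two_ne_zero
        ((mul_le_mul_right (Order.lt_succ_iff.1 hν) κ).trans_eq (Cardinal.mul_eq_self hκ.aleph0_le))) hx)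
    (H θ) f hfH (fun s hs hsc => mem_H_of_forall hθ
      ((Order.lt_succ_iff.1 hsc).trans_lt hκθ) hs) (x₀ := ∅) (by simp) (by simp)
  have S : CollapseSetup κ θ X := ⟨hκ, hθ, elemSub_of_closed hXH (fun s hs hc => hXc s hs
    (hc.trans_le (hκ.aleph0_le.trans (Order.le_succ κ)))) fun a b hab => hsk a b ▸ hXf _ hab,
    fun s hs hc => hXc s hs (Order.lt_succ_iff.2 hc)⟩
  have hXθ₀ := hX.trans_lt hκθ₀
  have hκθ₀' := hκ2.trans hκθ₀
  have hnot := hgood _ (CollapseSetup.target_mem_H hXθ₀) _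
    (CollapseSetup.funTarget_mem_H hθ₀ hXθ₀ hXf)
  have : ∃ W, W ∈ H θ₀ ∧ ∃ F, F ∈ H θ₀ ∧ GoodSeq (H θ₀) (cardSet α) (cardSet κ)
      (CollapseSetup.target X) (CollapseSetup.funTarget X f) W F := by
    by_contra hcon
    exact hnot ⟨S.subClosed _, S.isFunc_funTarget hXf, hcon⟩
  obtain ⟨W, _, F, _, hG⟩ := this
  have hel : ∀ i < α.ord, ElemSub (CollapseSetup.preSeq X W i) (H θ) := fun i hi =>
    S.goodModel_elemSub hθ₀ hκθ₀' hXθ₀ hXf hsk (CollapseSetup.goodModel_app hG hi)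
  have hmodel : ∀ i < α.ord, IsModel κ (CollapseSetup.preSeq X W i) := fun i hi =>
    S.goodModel_isModel hθ₀ hκθ₀' hXθ₀ (hel i hi) (CollapseSetup.goodModel_app hG hi)
  refine ⟨_, F, S.isFilterSequence_preSeq hα hακ hG hmodel,
    S.wellFounded_preSeq hXθ₀ hG (S.isFilter_of_goodSeq hα hG) hel, ?_, hel⟩
  rw [← hfk]
  exact S.goodModel_apply hXf (CollapseSetup.goodModel_app hG hα.ord_pos)
    (hmodel 0 hα.ord_pos).card_mem

/-! ### Powerset preserving embeddings -/

/-- A powerset preserving embedding `J` of the elementary substructure `M` of `H θ` into `N`. -/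
structure EmbSetup (κ θ : Cardinal.{u}) (M N : ZFSet.{u}) (J : ZFSet.{u} → ZFSet.{u}) : Prop where
  regular : κ.IsRegular
  regular' : θ.IsRegular
  lt : 2 ^ κ < θ
  elem : ElemSub M (H θ)
  trans : N.IsTransitive
  emb : ∃ j : {x // x ∈ M} ↪ₑ[setLang] {x // x ∈ N}, ∀ x, (j x).1 = J x.1
  card_mem : cardSet κ ∈ M
  card_subset : cardSet κ ⊆ M
  fixes : ∀ x ∈ cardSet κ, J x = x
  moves : J (cardSet κ) ≠ cardSet κ
  same_subsets : ∀ A ⊆ cardSet κ, A ∈ M ↔ A ∈ N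

namespace EmbSetup

variable {κ θ : Cardinal.{u}} {M N : ZFSet.{u}} {J : ZFSet.{u} → ZFSet.{u}}

lemma transClass (S : EmbSetup κ θ M N J) : TransClass (N : Set ZFSet.{u}) :=
  fun y hy x hx => S.trans y hy hx

lemma map_iff (S : EmbSetup κ θ M N J) {Γ : Type (u + 1)} [Ctx Γ] (P : Set ZFSet.{u} → Γ → Prop)
    [hP : Def P] {g g' : Γ} (hg : RelTuple (fun x y => x ∈ M ∧ J x = y) g g') :
    P (H θ) g ↔ P (N : Set ZFSet.{u}) g' := by
  obtain ⟨j, hj⟩ := S.emb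
  refine Def.map_iff (T' := (N : Set ZFSet.{u})) S.elem (transClass_H θ) S.transClass j P
    fun i => ⟨(hg i).1, (hj _).trans (hg i).2⟩

lemma apply_mem (S : EmbSetup κ θ M N J) {x : ZFSet.{u}} (hx : x ∈ M) : J x ∈ N := by
  obtain ⟨j, hj⟩ := S.emb
  rw [← hj ⟨x, hx⟩]
  exact (j _).2

lemma mem_iff (S : EmbSetup κ θ M N J) {x y : ZFSet.{u}} (hx : x ∈ M) (hy : y ∈ M) :
    x ∈ y ↔ J x ∈ J y :=
  S.map_iff (fun _ (g : ZFSet.{u} × ZFSet.{u}) => g.1 ∈ g.2) (g := (x, y)) (g' := (J x, J y))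
    (by simp [hx, hy])

lemma pair_mem_iff (S : EmbSetup κ θ M N J) {x y z : ZFSet.{u}} (hx : x ∈ M) (hy : y ∈ M)
    (hz : z ∈ M) : ZFSet.pair x y ∈ z ↔ ZFSet.pair (J x) (J y) ∈ J z :=
  S.map_iff (fun _ (g : ZFSet.{u} × ZFSet.{u} × ZFSet.{u}) => ZFSet.pair g.1 g.2.1 ∈ g.2.2)
    (g := (x, y, z)) (g' := (J x, J y, J z)) (by simp [hx, hy, hz])

lemma subset_iff (S : EmbSetup κ θ M N J) {x y : ZFSet.{u}} (hx : x ∈ M) (hy : y ∈ M) :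
    x ⊆ y ↔ J x ⊆ J y :=
  S.map_iff (fun _ (g : ZFSet.{u} × ZFSet.{u}) => g.1 ⊆ g.2) (g := (x, y)) (g' := (J x, J y))
    (by simp [hx, hy])

lemma mem_apply_iff (S : EmbSetup κ θ M N J) {γ y : ZFSet.{u}} (hγ : γ ∈ cardSet κ) (hy : y ∈ M) :
    γ ∈ J y ↔ γ ∈ y := by
  rw [S.mem_iff (S.card_subset hγ) hy, S.fixes γ hγ]

/-- The image of κ is an ordinal, since that is expressed by a bounded formula; it includes κ
because the elements of κ are fixed, and it differs from κ. -/
lemma card_mem_apply (S : EmbSetup κ θ M N J) : cardSet κ ∈ J (cardSet κ) := by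
  have h1 : J (cardSet κ) |>.IsOrdinal := by
    have := (S.map_iff (fun _ (x : ZFSet.{u}) => (∀ y, y ∈ x → ∀ z, z ∈ y → z ∈ x) ∧
      ∀ y, y ∈ x → ∀ z, z ∈ y → ∀ w, w ∈ z → w ∈ y) (g := cardSet κ) (g' := J (cardSet κ))
      (by simp [S.card_mem])).1 ⟨fun y hy z hz => mem_cardSet_of_mem hy hz,
        fun y hy z hz w hw => mem_of_mem_of_mem_cardSet hy hz hw⟩
    exact ⟨fun y hy z hz => this.1 y hy z hz, fun {z y x} h1 h2 h3 => this.2 _ h3 _ h2 _ h1⟩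
  have h2 : cardSet κ ⊆ J (cardSet κ) := fun γ hγ => (S.mem_apply_iff hγ S.card_mem).2 hγ
  rcases ((ZFSet.isOrdinal_toZFSet _).subset_iff_eq_or_mem h1).1 h2 with h | h
  exacts [absurd h.symm S.moves, h]

lemma card_mem_target (S : EmbSetup κ θ M N J) : cardSet κ ∈ N :=
  S.transClass _ (S.apply_mem S.card_mem) _ S.card_mem_apply

/-- Separation in the target of the embedding. -/
lemma sep_mem (S : EmbSetup κ θ M N J) {Γ : Type (u + 1)} [Ctx Γ]
    (P : Set ZFSet.{u} → Γ → ZFSet.{u} → Prop) [hP : Def (fun T (p : Γ × ZFSet.{u}) => P T p.1 p.2)]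
    {g : Γ} (hg : AllIn (N : Set ZFSet.{u}) g) {a : ZFSet.{u}} (ha : a ∈ N) :
    ZFSet.sep (fun x => P (N : Set ZFSet.{u}) g x) a ∈ N := by
  have hD0 : Def (fun T (p : (((ZFSet.{u} × Γ) × ZFSet.{u}) × ZFSet.{u}) × ZFSet.{u}) =>
      P T p.1.1.1.2 p.2) :=
    hP.subst₂ (fun p : (((ZFSet.{u} × Γ) × ZFSet.{u}) × ZFSet.{u}) × ZFSet.{u} => p.1.1.1.2)
      (fun p => p.2)
  have hD1 : Def (fun T (x : ZFSet.{u}) => ∃ d : Γ, AllIn T d ∧ ∃ a, a ∈ T ∧ ¬ ∃ c, c ∈ T ∧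
      ∀ x, x ∈ T → (x ∈ c ↔ x ∈ a ∧ P T d x)) :=
    Def.exTuple (fun T (x : ZFSet.{u}) (d : Γ) => ∃ a, a ∈ T ∧ ¬ ∃ c, c ∈ T ∧
      ∀ x, x ∈ T → (x ∈ c ↔ x ∈ a ∧ P T d x))
  -- The instance of separation is closed off as a sentence, true in H(θ) and hence in `N`; the
  -- parameter κ is a dummy.
  have h := (S.map_iff (fun T (x : ZFSet.{u}) => ¬ ∃ d : Γ, AllIn T d ∧ ∃ a, a ∈ T ∧ ¬ ∃ c, c ∈ T ∧
      ∀ x, x ∈ T → (x ∈ c ↔ x ∈ a ∧ P T d x)) (g := cardSet κ) (g' := J (cardSet κ))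
      (by simp [S.card_mem])).1 (by
    rintro ⟨d, _, a, ha, h⟩
    exact h ⟨ZFSet.sep (fun x => P (H θ) d x) a, mem_H_of_subset ha ZFSet.sep_subset,
      fun x _ => ZFSet.mem_sep⟩)
  push Not at h
  obtain ⟨c, hc, hc'⟩ := h g hg a ha
  have : ZFSet.sep (fun x => P (N : Set ZFSet.{u}) g x) a = c := by
    ext x
    rw [ZFSet.mem_sep]
    exact ⟨fun hx => (hc' x (S.transClass a ha x hx.1)).2 hx,
      fun hx => (hc' x (S.transClass c hc x hx)).1 hx⟩
  rwa [this]

lemma apply_eq_of_subset (S : EmbSetup κ θ M N J) {γ a : ZFSet.{u}} (hγ : γ ∈ cardSet κ)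
    (ha : a ⊆ γ) (haM : a ∈ M) : J a = a := by
  have h1 := (S.subset_iff haM (S.card_subset hγ)).1 ha
  rw [S.fixes γ hγ] at h1
  ext x
  constructor
  · intro hx
    exact (S.mem_apply_iff (mem_cardSet_of_mem hγ (h1 hx)) haM).1 hx
  · intro hx
    exact (S.mem_apply_iff (mem_cardSet_of_mem hγ (ha hx)) haM).2 hx

/-- Otherwise `M` contains an injection e of κ into the subsets of ν. The value a of J(e) at κ is a
subset of ν in `N`, so it is in `M` and is fixed by J. By elementarity a = e(β) for some β < κ, so
J(e) takes the value a at both β and κ, contradicting injectivity. -/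
lemma two_power_lt (S : EmbSetup κ θ M N J) {ν : Cardinal.{u}} (hν : ν < κ) : 2 ^ ν < κ := by
  by_contra hcon
  rw [not_lt] at hcon
  have hκθ := (Cardinal.cantor κ).trans S.lt
  have hνk : cardSet ν ∈ cardSet κ := Ordinal.mem_toZFSet_iff.2 ⟨_, Cardinal.ord_lt_ord.2 hν, rfl⟩
  obtain ⟨G, hG, hinj⟩ := exists_img_eq (x := cardSet κ) (y := (cardSet ν).powerset) (by
    rwa [card_cardSet, ZFSet.card_powerset, card_cardSet])
  have hGs : ∀ z ∈ cardSet κ, G z ⊆ cardSet ν := fun z hz => ZFSet.mem_powerset.1 (hG z hz)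
  have hkH := cardSet_mem_H hκθ
  have hGH : ∀ z ∈ cardSet κ, G z ∈ H θ := fun z hz =>
    mem_H_of_subset (cardSet_mem_H (hν.trans hκθ)) (hGs z hz)
  obtain ⟨e, heM, he1, he2⟩ := S.elem.exists_mem (transClass_H θ)
    (fun T (g : ZFSet.{u} × ZFSet.{u}) e => (∀ β, β ∈ g.1 → ∃ a, a ∈ T ∧ (ZFSet.pair β a ∈ e ∧
      a ⊆ g.2)) ∧ ∀ β, β ∈ g.1 → ∀ γ, γ ∈ g.1 → ∀ a, a ∈ T → ZFSet.pair β a ∈ e →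
        ZFSet.pair γ a ∈ e → β = γ) (g := (cardSet κ, cardSet ν))
    (by simp [S.card_mem, S.card_subset hνk])
    ⟨graph (cardSet κ) G, graph_mem_H S.regular' hkH hGH, fun β hβ => ⟨G β, hGH β hβ,
      pair_mem_graph.2 ⟨hβ, rfl⟩, hGs β hβ⟩, fun β hβ γ hγ a _ h1 h2 => by
        rw [pair_mem_graph] at h1 h2
        exact hinj β hβ γ hγ (h1.2.symm.trans h2.2)⟩
  have key := (S.map_iff
    (fun T (g : (ZFSet.{u} × ZFSet.{u}) × ZFSet.{u}) => (∀ β, β ∈ g.1.1 → ∃ a, a ∈ T ∧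
      (ZFSet.pair β a ∈ g.2 ∧ a ⊆ g.1.2)) ∧ ∀ β, β ∈ g.1.1 → ∀ γ, γ ∈ g.1.1 → ∀ a, a ∈ T →
        ZFSet.pair β a ∈ g.2 → ZFSet.pair γ a ∈ g.2 → β = γ)
    (g := ((cardSet κ, cardSet ν), e)) (g' := ((J (cardSet κ), J (cardSet ν)), J e))
    (by simp [S.card_mem, S.card_subset hνk, heM])).1 ⟨he1, he2⟩
  obtain ⟨a, ha, hka, hav⟩ := key.1 _ S.card_mem_apply
  rw [S.fixes _ hνk] at hav
  have haM := (S.same_subsets a fun x hx => mem_cardSet_of_mem hνk (hav hx)).2 ha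
  have hJa := S.apply_eq_of_subset hνk hav haM
  obtain ⟨β, hβ, hβa⟩ := (S.map_iff (fun _ (g : ZFSet.{u} × ZFSet.{u} × ZFSet.{u}) =>
    ∃ β, β ∈ g.1 ∧ ZFSet.pair β g.2.1 ∈ g.2.2) (g := (cardSet κ, a, e))
    (g' := (J (cardSet κ), J a, J e)) (by simp [S.card_mem, haM, heM])).2
    ⟨cardSet κ, S.card_mem_apply, by rwa [hJa]⟩
  have h1 := (S.pair_mem_iff (S.card_subset hβ) haM heM).1 hβa
  rw [S.fixes β hβ, hJa] at h1
  have h2 := key.2 β ((S.mem_apply_iff hβ S.card_mem).2 hβ) _ S.card_mem_apply a ha h1 hka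
  rw [h2] at hβ
  exact ZFSet.mem_irrefl _ hβ

/-! ### The derived measure -/

/-- The measure derived from the embedding. -/
noncomputable def measure (κ : Cardinal.{u}) (M : ZFSet.{u}) (J : ZFSet.{u} → ZFSet.{u}) :
    ZFSet.{u} := ZFSet.sep (fun A => A ⊆ cardSet κ ∧ cardSet κ ∈ J A) M

lemma mem_measure {A : ZFSet.{u}} :
    A ∈ measure κ M J ↔ A ∈ M ∧ A ⊆ cardSet κ ∧ cardSet κ ∈ J A := ZFSet.mem_sep

lemma measure_unbounded (S : EmbSetup κ θ M N J) {A γ : ZFSet.{u}} (hA : A ∈ measure κ M J)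
    (hγ : γ ∈ cardSet κ) : ∃ β, β ∈ A ∧ γ ∈ β := by
  obtain ⟨hAM, hAk, hkA⟩ := mem_measure.1 hA
  refine (S.map_iff (fun _ (g : ZFSet.{u} × ZFSet.{u}) => ∃ β, β ∈ g.1 ∧ g.2 ∈ β) (g := (A, γ))
    (g' := (J A, J γ)) (by simp [hAM, S.card_subset hγ])).2 ⟨_, hkA, ?_⟩
  rwa [S.fixes γ hγ]

lemma inter_mem_measure (S : EmbSetup κ θ M N J) {A B : ZFSet.{u}} (hA : A ∈ measure κ M J)
    (hB : B ∈ measure κ M J) : A ∩ B ∈ measure κ M J := by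
  obtain ⟨hAM, hAk, hkA⟩ := mem_measure.1 hA
  obtain ⟨hBM, hBk, hkB⟩ := mem_measure.1 hB
  have hM := S.elem.inter_mem hAM hBM
  refine mem_measure.2 ⟨hM, fun x hx => hAk (ZFSet.mem_inter.1 hx).1, ?_⟩
  exact (S.map_iff (fun T (g : ZFSet.{u} × ZFSet.{u} × ZFSet.{u}) => ∀ x, x ∈ g.1 → x ∈ g.2.1 →
    x ∈ g.2.2) (g := (A, B, A ∩ B)) (g' := (J A, J B, J (A ∩ B))) (by simp [hAM, hBM, hM])).1
    (fun x h1 h2 => ZFSet.mem_inter.2 ⟨h1, h2⟩) _ hkA hkB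

/-- κ belongs to exactly one of the images of a set and its complement. For a sequence Y of sets in
the measure, J(Y)(γ) = J(Y(γ)) contains κ for each γ < κ, so κ lies in the image of the diagonal
intersection. -/
lemma goodMeasure (S : EmbSetup κ θ M N J) {m : ZFSet.{u}} (hm : m ⊆ M) :
    GoodMeasure (cardSet κ) (measure κ M J) m := by
  refine ⟨fun A hA hAk => ?_, fun Y hY hYf => ?_⟩
  · by_cases h : cardSet κ ∈ J A
    · exact Or.inl (mem_measure.2 ⟨hm hA, hAk, h⟩)
    · have hM := S.elem.sdiff_mem S.card_mem (hm hA)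
      refine Or.inr ⟨cardSet κ \ A, mem_measure.2 ⟨hM, fun x hx => (ZFSet.mem_sdiff.1 hx).1, ?_⟩,
        fun β hβ => by rw [ZFSet.mem_sdiff, and_iff_right hβ]⟩
      exact ((S.map_iff (fun T (g : ZFSet.{u} × ZFSet.{u} × ZFSet.{u}) => ∀ x, x ∈ g.1 →
        x ∈ g.2.1 ∨ x ∈ g.2.2) (g := (cardSet κ, A, cardSet κ \ A))
        (g' := (J (cardSet κ), J A, J (cardSet κ \ A))) (by simp [S.card_mem, hm hA, hM])).1
        (fun x hx => by
          rw [ZFSet.mem_sdiff]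
          tauto) _ S.card_mem_apply).resolve_left h
  · have hYM := hm hY
    have hDM := diagInter_mem S.elem S.card_mem hYM
    have hpair : ∀ {γ A : ZFSet.{u}}, ZFSet.pair γ A ∈ Y → A ∈ measure κ M J := fun h =>
      (ZFSet.pair_mem_prod.1 (hYf.1 h)).2
    refine ⟨diagInter κ Y, mem_measure.2 ⟨hDM, ZFSet.sep_subset, ?_⟩, fun β hβ => ?_⟩
    · refine (S.map_iff (fun T (g : ZFSet.{u} × ZFSet.{u} × ZFSet.{u}) => ∀ β, β ∈ g.1 →
        (∀ γ, γ ∈ β → ∃ A, A ∈ T ∧ (ZFSet.pair γ A ∈ g.2.1 ∧ β ∈ A)) → β ∈ g.2.2)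
        (g := (cardSet κ, Y, diagInter κ Y)) (g' := (J (cardSet κ), J Y, J (diagInter κ Y)))
        (by simp [S.card_mem, hYM, hDM])).1 (fun β hβ h => ?_) _ S.card_mem_apply fun γ hγ => ?_
      · rw [diagInter, ZFSet.mem_sep]
        exact ⟨hβ, fun γ hγ => (h γ hγ).imp fun A h => h.2⟩
      · have h1 := app_spec hYf hγ
        obtain ⟨h2, h3, h4⟩ := mem_measure.1 (app_mem hYf hγ)
        refine ⟨_, S.apply_mem h2, ?_, h4⟩
        have := (S.pair_mem_iff (S.card_subset hγ) h2 hYM).1 h1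
        rwa [S.fixes γ hγ] at this
    · rw [diagInter, ZFSet.mem_sep, and_iff_right hβ]
      exact forall₂_congr fun γ _ => exists_congr fun A => (and_iff_right_of_imp fun h =>
        hpair h.1).symm

/-- The derived measure is amenable. -/
lemma measure_inter_mem (S : EmbSetup κ θ M N J) {m : ZFSet.{u}} (hm : m ∈ M) (hc : m.card ≤ κ) :
    measure κ M J ∩ m ∈ M := by
  have hmM := S.elem.subset_of_card_le S.regular' S.card_mem S.card_subset hm
    (by rwa [card_cardSet])
  have hkH := S.elem.subset S.card_mem
  obtain ⟨e, heM, he⟩ := S.elem.exists_mem (transClass_H θ)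
    (fun _ (g : ZFSet.{u} × ZFSet.{u}) e => Enum g.1 e g.2) (g := (cardSet κ, m))
    (by simp [S.card_mem, hm]) (exists_enum S.regular' hkH (S.elem.subset hm)
      (by rwa [card_cardSet]))
  have hJe := (S.map_iff (fun _ (g : ZFSet.{u} × ZFSet.{u} × ZFSet.{u}) => Enum g.1 g.2.1 g.2.2)
    (g := (cardSet κ, e, m)) (g' := (J (cardSet κ), J e, J m))
    (by simp [S.card_mem, heM, hm])).1 he
  -- The set of γ < κ with κ ∈ J(e)(γ) is a subset of κ in `N`, hence in `M`. It records which sets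
  -- enumerated by `e` are in the measure, and this is where powerset preservation gives
  -- amenability.
  have hBN := S.sep_mem (fun _ (g : ZFSet.{u} × ZFSet.{u} × ZFSet.{u}) γ => ∃ z, z ∈ g.1 ∧
    (ZFSet.pair γ z ∈ g.2.1 ∧ g.2.2 ∈ z)) (g := (J m, J e, cardSet κ))
    (by simp [S.apply_mem hm, S.apply_mem heM, S.card_mem_target]) S.card_mem_target
  rw [← S.same_subsets _ ZFSet.sep_subset] at hBN
  have hFM := S.elem.sep_mem (fun _ (g : ZFSet.{u} × ZFSet.{u} × ZFSet.{u}) A => A ⊆ g.1 ∧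
    ∃ γ, γ ∈ g.2.1 ∧ ZFSet.pair γ A ∈ g.2.2) (g := (cardSet κ, _, e))
    (by simpa [S.card_mem, heM] using hBN) hm
  convert hFM using 1
  ext A
  rw [ZFSet.mem_inter, ZFSet.mem_sep]
  dsimp only
  constructor
  · rintro ⟨hA, hAm⟩
    obtain ⟨hAM, hAk, hkA⟩ := mem_measure.1 hA
    obtain ⟨γ, hγ, hγA⟩ := he.2 A hAm
    refine ⟨hAm, hAk, γ, ZFSet.mem_sep.2 ⟨hγ, J A, (S.mem_iff hAM hm).1 hAm, ?_, hkA⟩, hγA⟩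
    have := (S.pair_mem_iff (S.card_subset hγ) hAM heM).1 hγA
    rwa [S.fixes γ hγ] at this
  · rintro ⟨hAm, hAk, γ, hγ, hγA⟩
    have hAM := hmM hAm
    obtain ⟨hγ, z, hz, hγz, hkz⟩ := ZFSet.mem_sep.1 hγ
    have h1 := (S.pair_mem_iff (S.card_subset hγ) hAM heM).1 hγA
    rw [S.fixes γ hγ] at h1
    have h2 := hJe.1 γ ((S.mem_apply_iff hγ S.card_mem).2 hγ) z hz (J A)
      ((S.mem_iff hAM hm).1 hAm) hγz h1
    exact ⟨mem_measure.2 ⟨hAM, hAk, h2 ▸ hkz⟩, hAm⟩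

/-- Sending `g` to J(g)(κ) turns membership modulo the measure into true membership, so a `g` for
which the rank of this value is least is minimal. -/
lemma goodWF (S : EmbSetup κ θ M N J) {T : Set ZFSet.{u}} {a h W : ZFSet.{u}}
    (hW : ∀ i ∈ a, ∀ m, ZFSet.pair i m ∈ W → m ⊆ M) :
    GoodWF T a (cardSet κ) h W (measure κ M J) := by
  intro B _ hB hne
  have hBM : ∀ g, g ∈ B → g ∈ M ∧ ∃ y, ZFSet.IsFunc (cardSet κ) y g := fun g hg => by
    obtain ⟨i, hi, m, _, him, hgm, y, _, hy⟩ := hB g hg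
    exact ⟨hW i hi m him hgm, y, hy⟩
  obtain ⟨g₀, hg₀, _⟩ := hne
  obtain ⟨g, hg, hmin⟩ := (InvImage.wf (fun g => (app (J g) (cardSet κ)).rank)
    Ordinal.lt_wf).has_min {g | g ∈ B} ⟨g₀, hg₀⟩
  refine ⟨g, hg, fun g' hg' hmem => hmin g' hg' (ZFSet.rank_lt_of_mem ?_)⟩
  have happ : ∀ g ∈ B, ∀ b, ZFSet.pair (cardSet κ) b ∈ J g → b = app (J g) (cardSet κ) :=
    fun g hg b hb => by
      obtain ⟨hgM, y, hy⟩ := hBM g hg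
      have h2 := (S.map_iff (fun T (p : ZFSet.{u} × ZFSet.{u}) => ∃ y, y ∈ T ∧
        ZFSet.IsFunc p.1 y p.2) (g := (cardSet κ, g)) (g' := (J (cardSet κ), J g))
        (by simp [S.card_mem, hgM])).1 ⟨img (app g) (cardSet κ),
          img_mem_H S.regular' (S.elem.subset S.card_mem) fun z hz =>
            S.elem.subset (S.elem.app_mem (transClass_H θ) hgM hy hz (S.card_subset hz)),
          isFunc_app hy fun z hz => mem_img.2 ⟨z, hz, rfl⟩⟩
      obtain ⟨y', _, hy'⟩ := h2
      exact ((RamseyLike.pair_mem_iff hy').1 hb).2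
  obtain ⟨Z, hZ, hZ'⟩ := hmem
  obtain ⟨hZM, hZk, hkZ⟩ := mem_measure.1 hZ
  have hgM := (hBM g hg).1
  have hgM' := (hBM g' hg').1
  obtain ⟨a, _, b, _, ha, hb, hab⟩ := (S.map_iff
    (fun T (p : ZFSet.{u} × ZFSet.{u} × ZFSet.{u}) => ∀ β, β ∈ p.1 → ∃ a, a ∈ T ∧ ∃ b, b ∈ T ∧
      (ZFSet.pair β a ∈ p.2.1 ∧ ZFSet.pair β b ∈ p.2.2 ∧ a ∈ b)) (g := (Z, g', g))
    (g' := (J Z, J g', J g)) (by simp [hZM, hgM, hgM'])).1 (fun β hβ => by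
      obtain ⟨a, b, ha, hb, hab⟩ := (hZ' β (hZk hβ)).1 hβ
      exact ⟨a, (of_pair_mem_mem (transClass_H θ) (S.elem.subset hgM') ha).2, b,
        (of_pair_mem_mem (transClass_H θ) (S.elem.subset hgM) hb).2, ha, hb, hab⟩) _ hkZ
  rw [← happ g' hg' a ha, ← happ g hg b hb]
  exact hab

end EmbSetup

/-! ### Good structures from powerset preserving embeddings -/

namespace EmbSetup

variable {α κ θ : Cardinal.{u}} {M N : ZFSet.{u}} {J : ZFSet.{u} → ZFSet.{u}}

lemma lt' (S : EmbSetup κ θ M N J) : κ < θ := (Cardinal.cantor κ).trans S.lt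

lemma mem_of_subClosed (S : EmbSetup κ θ M N J) {h s : ZFSet.{u}} (hhH : h ∈ H θ)
    (hh : SubClosed (H θ) (cardSet κ) h) (hs : s ⊆ h) (hc : s.card ≤ κ) : s ∈ h :=
  have hsH := mem_H_of_subset hhH hs
  hh s hsH hs (exists_enum S.regular' (cardSet_mem_H S.lt') hsH (by rwa [card_cardSet]))

/-- The model is a hull in `h` under `f` and subsets of size less than κ. It has size κ because κ is
a regular strong limit. Elements of `s` are included as subsets as well, which makes the chain
increasing. -/
lemma exists_goodModel (S : EmbSetup κ θ M N J) {h f s : ZFSet.{u}} (hhH : h ∈ H θ)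
    (hh : SubClosed (H θ) (cardSet κ) h) (hf : ZFSet.IsFunc h h f) (hs : s ⊆ h) (hsc : s.card ≤ κ)
    (hsy : ∀ y ∈ s, y ⊆ h ∧ y.card ≤ κ) :
    ∃ m, m ∈ H θ ∧ (GoodModel (H θ) (cardSet κ) h f m ∧ ∀ y, y ∈ s → y ∈ m ∧ y ⊆ m) := by
  have hκ0 := S.regular.aleph0_le
  have hord : ∀ o ≤ κ.ord, o.toZFSet ∈ h := fun o ho => hh.ordinal_mem S.regular' S.lt' ho
  have hk : cardSet κ ⊆ h := fun x hx => by
    obtain ⟨o, ho, rfl⟩ := Ordinal.mem_toZFSet_iff.1 hx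
    exact hord o ho.le
  obtain ⟨m, h1, h2, h3, h4, h5⟩ := exists_hull (l := κ) (μ := κ) S.regular le_rfl
    (fun x hx => card_sep_card_lt_of_isRegular S.regular (fun ν hν => (S.two_power_lt hν).le) hx)
    {x | x ∈ h} (app f) (fun x hx => app_mem hf hx)
    (fun t ht htc => S.mem_of_subClosed hhH hh ht htc.le)
    (x₀ := (cardSet κ ∪ {cardSet κ}) ∪ (s ∪ bUnion s id)) (fun x hx => by
      simp only [ZFSet.mem_union, ZFSet.mem_singleton, mem_bUnion, id] at hx
      rcases hx with (hx | rfl) | hx | ⟨y, hy, hx⟩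
      exacts [hk hx, hord _ le_rfl, hs hx, (hsy y hy).1 hx]) (by
      have hadd := Cardinal.add_eq_self hκ0
      calc _ ≤ (κ + κ) + (κ + κ) := ZFSet.card_union_le.trans (add_le_add
            (ZFSet.card_union_le.trans (add_le_add (card_cardSet κ).le
              (ZFSet.card_singleton.le.trans (Cardinal.one_le_aleph0.trans hκ0))))
            (ZFSet.card_union_le.trans (add_le_add hsc
              (card_bUnion_le hκ0 hsc fun z hz => (hsy z hz).2))))
        _ = κ := by rw [hadd, hadd])
  have hm : m ⊆ h := fun x hx => h2 x hx
  have hmH := mem_H_of_subset hhH hm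
  have hx₀ : ∀ {x}, ((x ∈ cardSet κ ∨ x = cardSet κ) ∨ (x ∈ s ∨ ∃ y ∈ s, x ∈ y)) → x ∈ m :=
    fun {x} hx => h1 (by simpa only [ZFSet.mem_union, ZFSet.mem_singleton, mem_bUnion, id] using hx)
  refine ⟨m, hmH, ⟨hm, exists_enum S.regular' (cardSet_mem_H S.lt') hmH (by rwa [card_cardSet]),
    fun x hx => hx₀ (Or.inl (Or.inl hx)), hx₀ (Or.inl (Or.inr rfl)), fun x hx y _ hxy => ?_,
    fun t _ ht => ?_⟩, fun y hy => ⟨hx₀ (Or.inr (Or.inl hy)),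
      fun x hx => hx₀ (Or.inr (Or.inr ⟨y, hy, hx⟩))⟩⟩
  · rw [((RamseyLike.pair_mem_iff hf).1 hxy).2]
    exact h4 x hx
  · rintro ⟨β, hβ, e, _, he⟩
    obtain ⟨o, ho, rfl⟩ := Ordinal.mem_toZFSet_iff.1 hβ
    exact h5 t ht (he.card_le.trans_lt (by simpa using Cardinal.lt_ord.1 ho))

open Classical in
/-- The next model of the filter sequence: a good model in `M` with the elements of `s` as elements
and as subsets. -/
noncomputable def nextModel (κ θ : Cardinal.{u}) (M h f s : ZFSet.{u}) : ZFSet.{u} :=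
  if hm : ∃ m, m ∈ M ∧ (GoodModel (H θ) (cardSet κ) h f m ∧ ∀ y, y ∈ s → y ∈ m ∧ y ⊆ m) then
    hm.choose else ∅

lemma nextModel_spec (S : EmbSetup κ θ M N J) {h f s : ZFSet.{u}} (hhM : h ∈ M) (hfM : f ∈ M)
    (hh : SubClosed (H θ) (cardSet κ) h) (hf : ZFSet.IsFunc h h f) (hsM : s ∈ M) (hs : s ⊆ h)
    (hsc : s.card ≤ κ) (hsy : ∀ y ∈ s, y ⊆ h ∧ y.card ≤ κ) :
    nextModel κ θ M h f s ∈ M ∧ (GoodModel (H θ) (cardSet κ) h f (nextModel κ θ M h f s) ∧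
      ∀ y, y ∈ s → y ∈ nextModel κ θ M h f s ∧ y ⊆ nextModel κ θ M h f s) := by
  have hm := S.elem.exists_mem (transClass_H θ)
    (fun T (g : (ZFSet.{u} × ZFSet.{u}) × ZFSet.{u} × ZFSet.{u}) m =>
      GoodModel T g.1.1 g.1.2 g.2.1 m ∧ ∀ y, y ∈ g.2.2 → y ∈ m ∧ y ⊆ m)
    (g := ((cardSet κ, h), (f, s))) (by simp [S.card_mem, hhM, hfM, hsM])
    (S.exists_goodModel (S.elem.subset hhM) hh hf hs hsc hsy)
  rw [nextModel, dif_pos hm]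
  exact hm.choose_spec

/-- A bad structure in `M` leads to a contradiction. -/
theorem not_bad (S : EmbSetup κ θ M N J) (hα : α.IsRegular) (hακ : α ≤ κ)
    (hclosed : ClosedUnderLT M α.ord) {h f : ZFSet.{u}} (hhM : h ∈ M) (hfM : f ∈ M) :
    ¬ Bad (H θ) (cardSet α) (cardSet κ) h f := by
  rintro ⟨hh, hf, hbad⟩
  have hhH := S.elem.subset hhM
  let F := measure κ M J
  let next := nextModel κ θ M h f
  -- Each stage yields the next model and its trace of the measure, so that later models contain
  -- both.
  let Y : Ordinal.{u} → ZFSet.{u} := iter fun s => {next s, F ∩ next s}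
  let s : Ordinal.{u} → ZFSet.{u} := fun i => ZFSet.iUnion fun j : Set.Iio i => Y j.1
  let W : Ordinal.{u} → ZFSet.{u} := fun i => next (s i)
  have hs : ∀ {i z}, z ∈ s i ↔ ∃ j < i, z = W j ∨ z = F ∩ W j := by
    intro i z
    have : ∀ j, Y j = {W j, F ∩ W j} := iter_eq _
    simp [s, this]
  have hcard : ∀ m, GoodModel (H θ) (cardSet κ) h f m → m.card ≤ κ := fun m hm => by
    obtain ⟨e, _, he⟩ := hm.2.1
    simpa using he.card_le
  have hW : ∀ i < α.ord, W i ∈ M ∧ (GoodModel (H θ) (cardSet κ) h f (W i) ∧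
      ∀ y, y ∈ s i → y ∈ W i ∧ y ⊆ W i) := fun i => by
    induction i using WellFoundedLT.induction with
    | _ i ih =>
      intro hi
      have key : ∀ y ∈ s i, y ∈ M ∧ y ⊆ h ∧ y.card ≤ κ := fun y hy => by
        obtain ⟨j, hj, hy⟩ := hs.1 hy
        obtain ⟨h1, h2, _⟩ := ih j hj (hj.trans hi)
        have h3 := hcard _ h2
        rcases hy with rfl | rfl
        · exact ⟨h1, h2.1, h3⟩
        · have h4 : F ∩ W j ⊆ W j := fun x hx => (ZFSet.mem_inter.1 hx).2
          exact ⟨S.measure_inter_mem h1 h3, fun x hx => h2.1 (h4 hx), (ZFSet.card_mono h4).trans h3⟩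
      -- There are fewer than α earlier models and traces, so closure of `M` under <α-sequences puts
      -- the set of them into `M`; this keeps the recursion inside `M`.
      have hsα : (s i).card < α := by
        refine (ZFSet.card_mono (y := bUnion i.toZFSet fun z => {W z.rank, F ∩ W z.rank})
          fun y hy => ?_).trans_lt (card_bUnion_lt hα (by simpa using Cardinal.lt_ord.1 hi)
            fun z _ => lt_of_lt_of_le (ZFSet.card_insert_le.trans_lt (Cardinal.add_lt_aleph0
              (by simp) Cardinal.one_lt_aleph0)) hα.aleph0_le)
        obtain ⟨j, hj, hy⟩ := hs.1 hy
        rw [mem_bUnion]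
        exact ⟨j.toZFSet, Ordinal.mem_toZFSet_iff.2 ⟨j, hj, rfl⟩, by simpa using hy⟩
      exact S.nextModel_spec hhM hfM hh hf
        (hclosed.mem_of_subset S.elem S.regular' hα.pos (fun y hy => (key y hy).1) hsα)
        (fun y hy => S.mem_of_subClosed hhH hh (key y hy).2.1 (key y hy).2.2)
        (hsα.le.trans hακ) fun y hy => (key y hy).2
  have hWM : ∀ i < α.ord, W i ⊆ M := fun i hi => S.elem.subset_of_card_le S.regular' S.card_mem
    S.card_subset (hW i hi).1 (by simpa using hcard _ (hW i hi).2.1)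
  have hFH : F ∈ H θ := by
    refine mem_H_of_subset (y := F) (x := (cardSet κ).powerset)
      (mem_H_of_forall S.regular' (by simpa using S.lt) fun y hy =>
        mem_H_of_subset (cardSet_mem_H S.lt') (ZFSet.mem_powerset.1 hy)) fun A hA => ?_
    exact ZFSet.mem_powerset.2 (mem_measure.1 hA).2.1
  have hrank : ∀ {i}, i ∈ cardSet α → ∃ o < α.ord, i = o.toZFSet ∧ W i.rank = W o :=
    fun {i} hi => by
      obtain ⟨o, ho, rfl⟩ := Ordinal.mem_toZFSet_iff.1 hi
      exact ⟨o, ho, rfl, by simp⟩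
  have hWh : ∀ i < α.ord, W i ∈ h := fun i hi =>
    S.mem_of_subClosed hhH hh (hW i hi).2.1.1 (hcard _ (hW i hi).2.1)
  have hWF : ZFSet.IsFunc (cardSet α) h (graph (cardSet α) fun z => W z.rank) :=
    isFunc_graph fun z hz => by
      obtain ⟨o, ho, _, h2⟩ := hrank hz
      rw [h2]
      exact hWh o ho
  refine hbad ⟨_, graph_mem_H S.regular' (cardSet_mem_H (hακ.trans_lt S.lt')) fun z hz =>
    transClass_H θ h hhH _ (app_graph (f := fun z => W z.rank) hz ▸ app_mem hWF hz), F, hFH,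
    ⟨hWF, fun i hi m _ him => ?_⟩, fun i hi j hj m _ m' _ hjm him => ?_, fun A hA =>
      ⟨(mem_measure.1 hA).2.1, fun γ hγ => S.measure_unbounded hA hγ⟩, fun A hA B hB =>
      ⟨_, S.inter_mem_measure hA hB, fun x hx => (ZFSet.mem_inter.1 hx).1,
        fun x hx => (ZFSet.mem_inter.1 hx).2⟩, fun i hi m _ him => ?_, S.goodWF fun i hi m him => ?_⟩
  · obtain ⟨o, ho, _, h2⟩ := hrank hi
    rw [(pair_mem_graph.1 him).2, h2]
    exact (hW o ho).2.1
  · obtain ⟨o, ho, h1, h2⟩ := hrank hi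
    rw [h1] at hj
    obtain ⟨p, hp, rfl⟩ := Ordinal.mem_toZFSet_iff.1 hj
    have h3 := (pair_mem_graph.1 hjm).2
    rw [Ordinal.rank_toZFSet] at h3
    rw [(pair_mem_graph.1 him).2, h2, h3]
    have h4 := (hW o ho).2.2 (W p) (hs.2 ⟨p, hp, Or.inl rfl⟩)
    have h5 := (hW o ho).2.2 (F ∩ W p) (hs.2 ⟨p, hp, Or.inr rfl⟩)
    exact ⟨h4.1, h4.2, F ∩ W p, h5.1, fun x hx => ZFSet.mem_inter.1 hx,
      fun x hx hx' => ZFSet.mem_inter.2 ⟨hx', hx⟩⟩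
  · obtain ⟨o, ho, _, h2⟩ := hrank hi
    rw [(pair_mem_graph.1 him).2, h2]
    exact S.goodMeasure (hWM o ho)
  · obtain ⟨o, ho, _, h2⟩ := hrank hi
    rw [(pair_mem_graph.1 him).2, h2]
    exact hWM o ho

end EmbSetup

/-- If `κ` is `α`-Ramsey, then every structure in some large `H θ` has a filter sequence. -/
theorem IsRamsey.exists_allGood {α κ : Cardinal.{u}} (hα : α.IsRegular) (hκ : κ.IsRegular)
    (hακ : α ≤ κ) (h : IsRamsey α κ) : ∃ θ : Cardinal.{u}, θ.IsRegular ∧ 2 ^ κ < θ ∧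
      AllGood α κ θ := by
  classical
  obtain ⟨θ, hμ, hθ, hM⟩ := h (Order.succ (2 ^ κ))
  have hlt : 2 ^ κ < θ := Order.succ_le_iff.1 hμ
  -- One embedding suffices, whatever subset of κ it is for: bad pairs reflect into every such `M`.
  obtain ⟨M, _, hw, hel, hcl, N, hN, j, hj⟩ := hM ∅ (ZFSet.empty_subset _)
  refine ⟨θ, hθ, hlt, ?_⟩
  have S : EmbSetup κ θ M N fun x => if h : x ∈ M then (j ⟨x, h⟩).1 else ∅ :=
    { regular := hκ
      regular' := hθ
      lt := hlt
      elem := hel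
      trans := hN
      emb := ⟨j, fun x => by rw [dif_pos x.2]⟩
      card_mem := hw.card_mem
      card_subset := hw.card_subset
      fixes := fun x hx => by
        rw [dif_pos (hw.card_subset hx)]
        exact hj.fixes ⟨x, _⟩ hx
      moves := by
        obtain ⟨⟨x, hx⟩, h1, h2⟩ := hj.moves
        dsimp only at h1
        subst h1
        rwa [dif_pos hx]
      same_subsets := hj.same_subsets }
  by_contra hcon
  obtain ⟨hh, hhM, f, hf, hbad⟩ := S.elem.exists_bad
    (hw.ordinals _ (Cardinal.ord_le_ord.2 hακ)) S.card_mem hcon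
  exact S.not_bad hα hακ hcl hhM hf hbad

/-- If every structure in some large `H θ₀` has a filter sequence, then `κ` is `α`-Ramsey. -/
theorem AllGood.isRamsey {α κ θ₀ : Cardinal.{u}} (hα : α.IsRegular) (hκ : κ.IsRegular)
    (hακ : α ≤ κ) (hθ₀ : θ₀.IsRegular) (hκθ₀ : 2 ^ κ < θ₀) (h : AllGood α κ θ₀) : IsRamsey α κ := by
  intro μ
  -- Good structures at θ₀ yield filter sequences at every regular cardinal above κ, so any
  -- successor cardinal above μ and κ can be taken.
  have hθ : (Order.succ (max μ κ)).IsRegular :=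
    isRegular_succ (hκ.aleph0_le.trans (le_max_right _ _))
  have hκθ : κ < Order.succ (max μ κ) := Order.lt_succ_of_le (le_max_right _ _)
  refine ⟨Order.succ (max μ κ), (le_max_left _ _).trans (Order.le_succ _), hθ, fun A hA => ?_⟩
  obtain ⟨M, F, hs, hwf, hA, hel⟩ := h.exists_isFilterSequence hα hκ hακ hθ₀ hκθ₀ hθ hκθ hA
  exact hs.exists_isPowersetPreserving hα hκ hακ hθ hwf hel hA

end RamseyLike

/-! ### The equivalences -/

theorem mainTheorem7 (α κ : Cardinal.{u}) (hα : α.IsRegular) (hκ : κ.IsRegular) (hακ : α ≤ κ) :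
    (RamseyLike.IsRamsey α κ ↔
      ∀ θ : Cardinal.{u}, θ.IsRegular → κ < θ →
        ∃ (M : Ordinal.{u} → ZFSet.{u}) (F : ZFSet.{u}),
          RamseyLike.IsFilterSequence α.ord κ M F ∧
          RamseyLike.WellFoundedUltrapower κ (RamseyLike.seqUnion α.ord M) F ∧
          ∀ i < α.ord, RamseyLike.ElemSubH (M i) θ) ∧
    (Cardinal.aleph0 < α →
      (RamseyLike.IsRamsey α κ ↔
        ∀ θ : Cardinal.{u}, θ.IsRegular → κ < θ →
          ∃ (M : Ordinal.{u} → ZFSet.{u}) (F : ZFSet.{u}),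
            RamseyLike.IsFilterSequence α.ord κ M F ∧
            ∀ i < α.ord, RamseyLike.ElemSubH (M i) θ) ∧
      (RamseyLike.IsRamsey α κ ↔
        ∃ θ : Cardinal.{u}, θ.IsRegular ∧ 2 ^ κ < θ ∧
          ∀ A : ZFSet.{u}, A ⊆ RamseyLike.cardSet κ →
            ∃ (M : Ordinal.{u} → ZFSet.{u}) (F : ZFSet.{u}),
              RamseyLike.IsFilterSequence α.ord κ M F ∧
              A ∈ M 0 ∧
              ∀ i < α.ord, RamseyLike.ElemSubH (M i) θ)) := by
  -- A single regular θ above 2^κ is enough to return to Ramseyness, and (2^κ)⁺ is one.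
  have hsucc : Cardinal.IsRegular (Order.succ ((2 : Cardinal.{u}) ^ κ)) :=
    Cardinal.isRegular_succ (hκ.aleph0_le.trans (Cardinal.cantor κ).le)
  have hlt : (2 : Cardinal.{u}) ^ κ < Order.succ ((2 : Cardinal.{u}) ^ κ) := Order.lt_succ _
  have hlt' : κ < Order.succ ((2 : Cardinal.{u}) ^ κ) := (Cardinal.cantor κ).trans hlt
  have forward : ∀ θ : Cardinal.{u}, RamseyLike.IsRamsey α κ → θ.IsRegular → κ < θ →
      ∀ A ⊆ RamseyLike.cardSet κ, ∃ (M : Ordinal.{u} → ZFSet.{u}) (F : ZFSet.{u}),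
        RamseyLike.IsFilterSequence α.ord κ M F ∧
        RamseyLike.WellFoundedUltrapower κ (RamseyLike.seqUnion α.ord M) F ∧
        A ∈ M 0 ∧ ∀ i < α.ord, RamseyLike.ElemSub (M i) (RamseyLike.H θ) :=
    fun θ h hθ hκθ A hA => by
      obtain ⟨θ₀, hθ₀, hκθ₀, hgood⟩ := h.exists_allGood hα hκ hακ
      exact hgood.exists_isFilterSequence hα hκ hακ hθ₀ hκθ₀ hθ hκθ hA
  have backward : ∀ (θ : Cardinal.{u}) (M : Ordinal.{u} → ZFSet.{u}) (F : ZFSet.{u}),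
      θ.IsRegular → (2 : Cardinal.{u}) ^ κ < θ → RamseyLike.IsFilterSequence α.ord κ M F →
      RamseyLike.WellFoundedUltrapower κ (RamseyLike.seqUnion α.ord M) F →
      (∀ i < α.ord, RamseyLike.ElemSubH (M i) θ) → RamseyLike.IsRamsey α κ :=
    fun θ M F hθ hκθ hs hwf hel => (RamseyLike.allGood_of_isFilterSequence hα hκ hακ hθ hκθ hs hwf
      hel).isRamsey hα hκ hακ hθ hκθ
  refine ⟨⟨fun h θ hθ hκθ => ?_, fun h => ?_⟩, fun hα0 => ⟨⟨fun h θ hθ hκθ => ?_, fun h => ?_⟩,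
    ⟨fun h => ⟨_, hsucc, hlt, fun A hA => ?_⟩, ?_⟩⟩⟩
  · obtain ⟨M, F, hs, hwf, _, hel⟩ := forward θ h hθ hκθ ∅ (ZFSet.empty_subset _)
    exact ⟨M, F, hs, hwf, hel⟩
  · obtain ⟨M, F, hs, hwf, hel⟩ := h _ hsucc hlt'
    exact backward _ M F hsucc hlt hs hwf hel
  · obtain ⟨M, F, hs, _, _, hel⟩ := forward θ h hθ hκθ ∅ (ZFSet.empty_subset _)
    exact ⟨M, F, hs, hel⟩
  · obtain ⟨M, F, hs, hel⟩ := h _ hsucc hlt'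
    exact backward _ M F hsucc hlt hs (hs.wellFounded hα hκ hακ hα0 hsucc hel) hel
  · obtain ⟨M, F, hs, _, hA, hel⟩ := forward _ h hsucc hlt' A hA
    exact ⟨M, F, hs, hA, hel⟩
  · rintro ⟨θ, hθ, hκθ, h⟩
    -- The instance for one subset of κ suffices: `AllGood` recovers filter sequences through every
    -- subset.
    obtain ⟨M, F, hs, _, hel⟩ := h ∅ (ZFSet.empty_subset _)
    exact backward _ M F hθ hκθ hs (hs.wellFounded hα hκ hακ hα0 hθ hel) hel
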